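/- Let $\mathbf H^2,\mathbf H^3$ be real hyperbolic $2$- and $3$-space. If $\mathcal O$ is a maximal order in a quaternion algebra $B$ over a number field $k$, let $\mathcal O^1$ be its group of elements of reduced norm one. An arithmetic Fuchsian group is a subgroup $\Gamma<\mathrm{PSL}(2,\mathbf R)$ that is commensurable, up to conjugation in $\mathrm{PSL}(2,\mathbf C)$, with the image $\Gamma^1_{\mathcal O}$ of $\mathcal O^1$ under $B\to B\otimes_k k_v\cong \mathrm{Mat}(2,\mathbf R)$, for some totally real $k$, some $B$ unramified at exactly one real place $v$ of $k$, and some maximal order $\mathcal O$ of $B$. An arithmetic Kleinian group is a subgroup $\Gamma<\mathrm{PSL}(2,\mathbf C)$ that is commensurable, up to conjugation, with the image $\Gamma^1_{\mathcal O}$ of $\mathcal O^1$ under $B\to B\otimes_k k_v\cong \mathrm{Mat}(2,\mathbf C)$, for some $k$ with exactly one complex place $v$, some $B$ ramified at all real places of $k$, and some maximal order $\mathcal O$ of $B$. An arithmetic hyperbolic $2$-orbifold (respectively $3$-orbifold) is a quotient $M=\mathbf H^2/\Gamma$ (respectively $M=\mathbf H^3/\Gamma$) with $\Gamma$ arithmetic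 Fuchsian (respectively Kleinian). A finite manifold cover of $M=\mathbf H^n/\Gamma$ is the natural map $M'=\mathbf H^n/\Gamma'\to M$ for a torsion-free subgroup $\Gamma'$ of finite index in $\Gamma$. A closed geodesic of length $\ell>0$ on $M$ is a map $c:\mathbf R/\ell\mathbf Z\to M$ that is covered by a complete unit-speed geodesic $\mathbf R\to\mathbf H^n$; it lifts to $M'$ if it is the composition of a closed geodesic $\mathbf R/\ell\mathbf Z\to M'$ with $M'\to M$. The systole $\mathrm{Sys}(M)$ is the length of a shortest closed geodesic on $M$. **Lemma.** Let $M$ be an arithmetic hyperbolic $2$- or $3$-orbifold. For every closed geodesic $c$ on $M$ there is a finite manifold cover $M'\to M$ such that $c$ lifts to $M'$. In particular, $M$ has a shortest closed geodesic, and there is a finite manifold cover $M'\to M$ with $\mathrm{Sys}(M')=\mathrm{Sys}(M)$. -/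

import Mathlib

open scoped MatrixGroups Quaternion Pointwise NumberField

/-! ### Hyperbolic 3-space

Hyperbolic 2-space is Mathlib's `UpperHalfPlane`, with its distance and its action of `SL(2, ℝ)`.
Hyperbolic 3-space is the upper half-space `{(z, t) | z ∈ ℂ, t > 0}` with the metric
`(|dz|² + dt²) / t²` of curvature `-1`, given through its distance function, and with the
Poincaré extension of the action of `SL(2, ℂ)` by Möbius transformations of `ℂ`. -/

/-- The upper half-space model of hyperbolic 3-space. -/
@[ext]
structure UpperHalfSpace where
  /-- the horizontal coordinate -/
  z : ℂ
  /-- the height -/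
  t : ℝ
  t_pos : 0 < t

namespace UpperHalfSpace

/-- The hyperbolic distance of curvature `-1`:
`sinh (d(p,q) / 2) = |p - q| / (2 √(t(p) t(q)))`, where `|p - q|` is the Euclidean distance.
This is the same formula as in the upper half-plane. -/
noncomputable instance : Dist UpperHalfSpace :=
  ⟨fun p q => 2 * Real.arsinh
    (Real.sqrt (‖p.z - q.z‖ ^ 2 + (p.t - q.t) ^ 2) / (2 * Real.sqrt (p.t * q.t)))⟩

/-- `|c z + d|² + |c|² t²` for `g = !![a, b; c, d]` and `p = (z, t)`. -/
noncomputable def den (g : SL(2, ℂ)) (p : UpperHalfSpace) : ℝ :=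
  Complex.normSq (g 1 0 * p.z + g 1 1) + Complex.normSq (g 1 0) * p.t ^ 2

theorem det_eq (g : SL(2, ℂ)) : g 0 0 * g 1 1 - g 0 1 * g 1 0 = 1 := by
  rw [← Matrix.det_fin_two, g.det_coe]

theorem den_pos (g : SL(2, ℂ)) (p : UpperHalfSpace) : 0 < den g p := by
  have ht := p.t_pos
  unfold den
  by_cases hc : g 1 0 = 0
  · have hd : g 1 1 ≠ 0 := by
      intro hd
      have := det_eq g
      simp [hc, hd] at this
    have := Complex.normSq_pos.2 hd
    simpa [hc] using this
  · have h1 := Complex.normSq_pos.2 hc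
    have h2 := Complex.normSq_nonneg (g 1 0 * p.z + g 1 1)
    positivity

/-- The Poincaré extension of `z ↦ (a z + b) / (c z + d)`:
`(z, t) ↦ (((a z + b) conj (c z + d) + a conj(c) t²) / D, t / D)` with
`D = |c z + d|² + |c|² t²`. -/
noncomputable def act (g : SL(2, ℂ)) (p : UpperHalfSpace) : UpperHalfSpace where
  z := ((g 0 0 * p.z + g 0 1) * starRingEnd ℂ (g 1 0 * p.z + g 1 1)
        + g 0 0 * starRingEnd ℂ (g 1 0) * (p.t : ℂ) ^ 2) / (den g p : ℂ)
  t := p.t / den g p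
  t_pos := div_pos p.t_pos (den_pos g p)

theorem den_coe (g : SL(2, ℂ)) (p : UpperHalfSpace) :
    (den g p : ℂ) = (g 1 0 * p.z + g 1 1)
        * (starRingEnd ℂ (g 1 0) * starRingEnd ℂ p.z + starRingEnd ℂ (g 1 1))
      + g 1 0 * starRingEnd ℂ (g 1 0) * (p.t : ℂ) ^ 2 := by
  have h := Complex.mul_conj (g 1 0 * p.z + g 1 1)
  simp only [map_add, map_mul] at h
  simp [den, ← h, Complex.mul_conj]

theorem det_conj_eq (g : SL(2, ℂ)) : starRingEnd ℂ (g 0 0) * starRingEnd ℂ (g 1 1)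
    - starRingEnd ℂ (g 0 1) * starRingEnd ℂ (g 1 0) = 1 := by
  rw [← map_mul, ← map_mul, ← map_sub, det_eq, map_one]

theorem den_mul_aux {a a' b b' c c' d d' r r' s s' z z' t D : ℂ} (hD : D ≠ 0)
    (hD' : D = (c * z + d) * (c' * z' + d') + c * c' * t ^ 2)
    (h1 : a * d - b * c = 1) (h2 : a' * d' - b' * c' = 1) :
    ((r * a + s * c) * z + (r * b + s * d)) * ((r' * a' + s' * c') * z' + (r' * b' + s' * d'))
        + (r * a + s * c) * (r' * a' + s' * c') * t ^ 2
      = ((r * (((a * z + b) * (c' * z' + d') + a * c' * t ^ 2) / D) + s)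
          * (r' * (((a' * z' + b') * (c * z + d) + a' * c * t ^ 2) / D) + s')
          + r * r' * (t / D) ^ 2) * D := by
  have key : ((a * z + b) * (c' * z' + d') + a * c' * t ^ 2)
        * ((a' * z' + b') * (c * z + d) + a' * c * t ^ 2) + t ^ 2
      = D * ((a * z + b) * (a' * z' + b') + a * a' * t ^ 2) := by
    rw [hD']
    linear_combination (-t ^ 2) * (a * d - b * c) * h2 - t ^ 2 * h1
  field_simp
  rw [hD'] at key ⊢
  linear_combination (-r * r') * key

theorem den_mul (g h : SL(2, ℂ)) (p : UpperHalfSpace) :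
    den (g * h) p = den g (act h p) * den h p := by
  have hD : (den h p : ℂ) ≠ 0 := by exact_mod_cast (den_pos h p).ne'
  have key := den_mul_aux (r := g 1 0) (r' := starRingEnd ℂ (g 1 0)) (s := g 1 1)
    (s' := starRingEnd ℂ (g 1 1)) hD (den_coe h p) (det_eq h) (det_conj_eq h)
  apply Complex.ofReal_injective
  rw [Complex.ofReal_mul, den_coe, den_coe]
  simpa only [act, Matrix.SpecialLinearGroup.coe_mul, Matrix.mul_apply, Fin.sum_univ_two, map_add,
    map_mul, map_div₀, map_pow, Complex.conj_ofReal, Complex.conj_conj, Complex.ofReal_div]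
    using key

noncomputable instance : MulAction SL(2, ℂ) UpperHalfSpace where
  smul := act
  one_smul p := by
    have h : den 1 p = 1 := by simp [den]
    change act 1 p = p
    ext1
    · simp [act, h]
    · simp [act, h]
  mul_smul g h p := by
    change act (g * h) p = act g (act h p)
    have hm := den_mul g h p
    ext1
    · have hD : (den h p : ℂ) ≠ 0 := by exact_mod_cast (den_pos h p).ne'
      have key := den_mul_aux (r := g 0 0) (r' := starRingEnd ℂ (g 1 0)) (s := g 0 1)
        (s' := starRingEnd ℂ (g 1 1)) hD (den_coe h p) (det_eq h) (det_conj_eq h)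
      have e1 : (act (g * h) p).z = (((g * h) 0 0 * p.z + (g * h) 0 1)
          * starRingEnd ℂ ((g * h) 1 0 * p.z + (g * h) 1 1)
        + (g * h) 0 0 * starRingEnd ℂ ((g * h) 1 0) * (p.t : ℂ) ^ 2) / (den (g * h) p : ℂ) := rfl
      have e2 : (act g (act h p)).z = ((g 0 0 * (act h p).z + g 0 1)
          * starRingEnd ℂ (g 1 0 * (act h p).z + g 1 1)
        + g 0 0 * starRingEnd ℂ (g 1 0) * ((act h p).t : ℂ) ^ 2) / (den g (act h p) : ℂ) := rfl
      rw [e1, e2, hm, Complex.ofReal_mul, ← mul_div_mul_right _ (den g (act h p) : ℂ) hD]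
      congr 1
      simpa only [act, Matrix.SpecialLinearGroup.coe_mul, Matrix.mul_apply, Fin.sum_univ_two,
        map_add, map_mul, map_div₀, map_pow, Complex.conj_ofReal, Complex.conj_conj,
        Complex.ofReal_div] using key
    · simp only [act] at hm ⊢
      rw [hm, div_div, mul_comm (den h p)]

end UpperHalfSpace

/-! ### Hyperbolic orbifolds, closed geodesics, finite manifold covers, systoles

Throughout, `X` is hyperbolic `2`-space with `F = ℝ` or hyperbolic `3`-space with `F = ℂ`. -/

section Orbifold

variable {F : Type} [Field F] (X : Type) [MulAction SL(2, F) X]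

/-- The full preimage in `SL(2, F)` of a subgroup of `PSL(2, F)`. -/
def preimageSL (Γ : Subgroup PSL(2, F)) : Subgroup SL(2, F) :=
  Γ.comap (QuotientGroup.mk' (Subgroup.center SL(2, F)))

/-- (The underlying space of) the orbifold `X / Γ`: the set of orbits of `Γ < PSL(2, F)` on `X`.
The orbits of `Γ` are those of its preimage in `SL(2, F)`. -/
abbrev HypOrbifold (Γ : Subgroup PSL(2, F)) : Type :=
  MulAction.orbitRel.Quotient (preimageSL Γ) X

/-- The projection `X → X / Γ`. -/
def HypOrbifold.mk (Γ : Subgroup PSL(2, F)) (x : X) : HypOrbifold X Γ :=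
  Quotient.mk (MulAction.orbitRel (preimageSL Γ) X) x

/-- The covering `X / Γ' → X / Γ` for `Γ' ≤ Γ`, sending the `Γ'`-orbit of `x` to its `Γ`-orbit. -/
def HypOrbifold.cover {Γ' Γ : Subgroup PSL(2, F)} (h : Γ' ≤ Γ) :
    HypOrbifold X Γ' → HypOrbifold X Γ :=
  Quotient.map' id (by
    rintro x y ⟨g, hg⟩
    exact ⟨⟨g.1, h g.2⟩, hg⟩)

/-- The orbifold `X / Γ` is a manifold if and only if `Γ` has no torsion elements. -/
def IsManifoldGroup (Γ : Subgroup PSL(2, F)) : Prop :=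
  ∀ g ∈ Γ, IsOfFinOrder g → g = 1

/-- `X / Γ' → X / Γ` is a finite manifold cover: `Γ'` is a torsion-free subgroup of finite index
of `Γ`. -/
structure IsFiniteManifoldCover (Γ' Γ : Subgroup PSL(2, F)) : Prop where
  le : Γ' ≤ Γ
  finite_index : Γ'.relIndex Γ ≠ 0
  manifold : IsManifoldGroup Γ'

variable {X}

/-- A complete geodesic of hyperbolic space, parametrized by arc length. -/
def IsGeodesicLine [Dist X] (A : ℝ → X) : Prop :=
  ∀ s t : ℝ, dist (A s) (A t) = |s - t|

/-- `c : ℝ / ℓℤ → X / Γ` is a closed geodesic of length `ℓ > 0` on the orbifold `X / Γ`,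
parametrized by arc length: it is covered by a complete geodesic of `X`. -/
def IsClosedGeodesic [Dist X] {Γ : Subgroup PSL(2, F)} {ℓ : ℝ}
    (c : AddCircle ℓ → HypOrbifold X Γ) : Prop :=
  0 < ℓ ∧ ∃ A : ℝ → X, IsGeodesicLine A ∧ ∀ t : ℝ, c (t : AddCircle ℓ) = HypOrbifold.mk X Γ (A t)

/-- The closed geodesic `c` on `X / Γ` lifts to `X / Γ'`: it is the image of a closed geodesic on
`X / Γ'` (of the same length) under the covering `X / Γ' → X / Γ`. -/
def LiftsToCover [Dist X] {Γ' Γ : Subgroup PSL(2, F)} (h : Γ' ≤ Γ) {ℓ : ℝ}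
    (c : AddCircle ℓ → HypOrbifold X Γ) : Prop :=
  ∃ c' : AddCircle ℓ → HypOrbifold X Γ', IsClosedGeodesic c' ∧
    ∀ t, HypOrbifold.cover X h (c' t) = c t

variable (X)

/-- The set of lengths of closed geodesics on `X / Γ`. -/
def closedGeodesicLengths [Dist X] (Γ : Subgroup PSL(2, F)) : Set ℝ :=
  {ℓ | ∃ c : AddCircle ℓ → HypOrbifold X Γ, IsClosedGeodesic c}

/-- `s` is the systole of `X / Γ`: the length of a shortest closed geodesic. -/
def IsSystole [Dist X] (Γ : Subgroup PSL(2, F)) (s : ℝ) : Prop :=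
  IsLeast (closedGeodesicLengths X Γ) s

end Orbifold

/-! ### Arithmetic Fuchsian and Kleinian groups -/

section Arithmetic

/-- The extension of scalars `B → B ⊗_{k, φ} F`, for the quaternion algebra `B = (a, b / k)` and a
ring homomorphism `φ : k → F`, where `B ⊗ F` is identified with `(φ a, φ b / F)`. -/
def quatBaseChange {k F : Type} [Field k] [Field F] (φ : k →+* F) (a b : k) :
    ℍ[k,a,b] →+* ℍ[F,φ a,φ b] where
  toFun x := ⟨φ x.re, φ x.imI, φ x.imJ, φ x.imK⟩
  map_one' := by ext <;> simp
  map_zero' := by ext <;> simp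
  map_mul' x y := by ext <;> simp
  map_add' x y := by ext <;> simp

variable {k : Type} [Field k] {a b : k}

/-- An order of the quaternion algebra `B = (a, b / k)` over a number field `k`: a subring which
contains the ring of integers `𝓞 k`, is a finitely generated `𝓞 k`-module, and spans `B` over
`k`. -/
structure IsQuatOrder (O : Subalgebra (𝓞 k) ℍ[k,a,b]) : Prop where
  fg : (Subalgebra.toSubmodule O).FG
  span : Submodule.span k (O : Set ℍ[k,a,b]) = ⊤

/-- A maximal order. -/
def IsMaximalQuatOrder (O : Subalgebra (𝓞 k) ℍ[k,a,b]) : Prop :=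
  Maximal IsQuatOrder O

/-- Orders are stable under quaternion conjugation. -/
theorem IsQuatOrder.star_mem [NumberField k] {O : Subalgebra (𝓞 k) ℍ[k,a,b]}
    (hO : IsQuatOrder O) {x : ℍ[k,a,b]} (hx : x ∈ O) : star x ∈ O := by
  have hint : IsIntegral (𝓞 k) x := .of_mem_of_fg O hO.fg x hx
  -- it is enough that the reduced trace is integral
  suffices h : IsIntegral (𝓞 k) (2 * x.re) by
    obtain ⟨y, hy⟩ := IsIntegrallyClosed.isIntegral_iff.1 h
    have : star x = algebraMap (𝓞 k) ℍ[k,a,b] y - x := by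
      rw [IsScalarTower.algebraMap_apply (𝓞 k) k, hy, QuaternionAlgebra.coe_algebraMap,
        QuaternionAlgebra.star_eq_two_re_sub]
      simp
    rw [this]
    exact O.sub_mem (O.algebraMap_mem y) hx
  have hcoe : Function.Injective (algebraMap k ℍ[k,a,b]) := QuaternionAlgebra.algebraMap_injective
  by_cases hk : ∃ r : k, algebraMap k ℍ[k,a,b] r = x
  · obtain ⟨r, rfl⟩ := hk
    have hr : IsIntegral (𝓞 k) r := (isIntegral_algebraMap_iff hcoe).1 hint
    simpa [QuaternionAlgebra.coe_algebraMap, two_mul] using hr.add hr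
  · obtain ⟨p, hp, hpx⟩ := hint
    let n : k := (star x * x).re
    let q : Polynomial k := Polynomial.X ^ 2 - Polynomial.C (2 * x.re) * Polynomial.X
      + Polynomial.C n
    have hq : q.Monic := by
      simp only [q]
      monicity!
    have hq2 : q.degree = 2 := by
      simp only [q]
      compute_degree!
    have hqx : Polynomial.aeval x q = 0 := by
      have h1 : algebraMap k ℍ[k,a,b] n = star x * x := by
        rw [QuaternionAlgebra.coe_algebraMap, ← QuaternionAlgebra.star_mul_eq_coe]
      have h2 : algebraMap k ℍ[k,a,b] (2 * x.re) = star x + x := by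
        rw [QuaternionAlgebra.coe_algebraMap, QuaternionAlgebra.star_add_self']
        simp
      simp only [q, map_add, map_sub, map_mul, map_pow, Polynomial.aeval_X, Polynomial.aeval_C]
      rw [← map_mul, h1, h2]
      noncomm_ring
    have hpx' : Polynomial.aeval x (p.map (algebraMap (𝓞 k) k)) = 0 := by
      rw [Polynomial.aeval_map_algebraMap]
      exact hpx
    have hdvd : q ∣ p.map (algebraMap (𝓞 k) k) := by
      rw [← Polynomial.modByMonic_eq_zero_iff_dvd hq]
      set r := p.map (algebraMap (𝓞 k) k) %ₘ q with hr
      have hrx : Polynomial.aeval x r = 0 := by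
        rw [hr, Polynomial.aeval_modByMonic_eq_self_of_root hqx]
        exact hpx'
      have hdeg : r.degree ≤ 1 := by
        have := Polynomial.degree_modByMonic_lt (p.map (algebraMap (𝓞 k) k)) hq
        rw [hq2] at this
        exact Order.le_of_lt_succ this
      rw [Polynomial.eq_X_add_C_of_degree_le_one hdeg] at hrx ⊢
      simp only [map_add, map_mul, Polynomial.aeval_C, Polynomial.aeval_X] at hrx
      have h1 : r.coeff 1 = 0 := by
        by_contra h1
        apply hk
        refine ⟨-(r.coeff 1)⁻¹ * r.coeff 0, ?_⟩
        have h3 : x = algebraMap k ℍ[k,a,b] (r.coeff 1)⁻¹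
            * (algebraMap k ℍ[k,a,b] (r.coeff 1) * x) := by
          rw [← mul_assoc, ← map_mul, inv_mul_cancel₀ h1, map_one, one_mul]
        rw [eq_neg_of_add_eq_zero_left hrx] at h3
        rw [h3]
        simp
      have h0 : r.coeff 0 = 0 := by
        rw [h1, map_zero, zero_mul, zero_add] at hrx
        exact hcoe (by rw [hrx, map_zero])
      simp [h0, h1]
    obtain ⟨g, hg⟩ := IsIntegrallyClosed.eq_map_mul_C_of_dvd k hp hdvd
    rw [hq.leadingCoeff, map_one, mul_one] at hg
    have hc : q.coeff 1 = -(2 * x.re) := by simp [q]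
    rw [← hg, Polynomial.coeff_map] at hc
    have : IsIntegral (𝓞 k) (-(2 * x.re)) := hc ▸ isIntegral_algebraMap
    simpa using this.neg

/-- The group `Γ_O^1 < PSL(2, F)`: the image of `O^1`, the group of elements of reduced norm
`x * star x = 1` of the order `O`, under the map `B → B ⊗ F ≅ Mat(2, F)`. -/
def normOneGroup [NumberField k] {F : Type} [Field F] (φ : k →+* F)
    (θ : ℍ[F,φ a,φ b] ≃ₐ[F] Matrix (Fin 2) (Fin 2) F)
    (O : Subalgebra (𝓞 k) ℍ[k,a,b]) (hO : IsQuatOrder O) : Subgroup PSL(2, F) where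
  carrier := {p | ∃ x ∈ O, x * star x = 1 ∧ ∃ g : SL(2, F),
    (g : Matrix (Fin 2) (Fin 2) F) = θ (quatBaseChange φ a b x) ∧
      p = QuotientGroup.mk' (Subgroup.center SL(2, F)) g}
  one_mem' := ⟨1, O.one_mem, by simp, 1, by simp, by simp⟩
  mul_mem' := by
    rintro _ _ ⟨x, hx, hx1, g, hg, rfl⟩ ⟨y, hy, hy1, h, hh, rfl⟩
    refine ⟨x * y, O.mul_mem hx hy, ?_, g * h, by simp [hg, hh], by simp⟩
    rw [star_mul, mul_assoc, ← mul_assoc y, hy1, one_mul, hx1]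
  inv_mem' := by
    rintro _ ⟨x, hx, hx1, g, hg, rfl⟩
    have hx2 : star x * x = 1 := by rw [star_comm_self', hx1]
    refine ⟨star x, hO.star_mem hx, by rw [star_star, hx2], g⁻¹, ?_, by simp⟩
    have h1 : (g : Matrix (Fin 2) (Fin 2) F) * θ (quatBaseChange φ a b (star x)) = 1 := by
      rw [hg, ← map_mul, ← map_mul, hx1, map_one, map_one]
    have h2 : ((g⁻¹ : SL(2, F)) : Matrix (Fin 2) (Fin 2) F) * (g : Matrix (Fin 2) (Fin 2) F) = 1 := by
      rw [← Matrix.SpecialLinearGroup.coe_mul, inv_mul_cancel, Matrix.SpecialLinearGroup.coe_one]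
    exact left_inv_eq_right_inv h2 h1

/-- Commensurability in the wide sense: `Γ₁` is commensurable with a conjugate of `Γ₂`. -/
def WideCommensurable {G : Type} [Group G] (Γ₁ Γ₂ : Subgroup G) : Prop :=
  ∃ g : G, Subgroup.Commensurable Γ₁ (MulAut.conj g • Γ₂)

/-- The inclusion `PSL(2, ℝ) → PSL(2, ℂ)`. -/
noncomputable def pslInclusion : PSL(2, ℝ) →* PSL(2, ℂ) :=
  QuotientGroup.map _ _ (Matrix.SpecialLinearGroup.map Complex.ofRealHom) (by
    intro g hg
    rw [Matrix.SpecialLinearGroup.mem_center_iff] at hg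
    obtain ⟨r, hr, h⟩ := hg
    rw [Subgroup.mem_comap, Matrix.SpecialLinearGroup.mem_center_iff]
    refine ⟨(r : ℂ), by exact_mod_cast hr, ?_⟩
    ext i j
    have hij := congrFun (congrFun h i) j
    simp only [Matrix.scalar_apply] at hij
    rw [Matrix.SpecialLinearGroup.map_apply_coe, RingHom.mapMatrix_apply, Matrix.map_apply, ← hij]
    by_cases e : i = j <;> simp [e])

/-- The quaternion algebra `(a, b / k)` is ramified at the real place given by the embedding `σ`:
its completion is not a matrix algebra. -/
def RamifiedAtReal {k : Type} [Field k] (a b : k) (σ : k →+* ℝ) : Prop :=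
  IsEmpty (ℍ[ℝ,σ a,σ b] ≃ₐ[ℝ] Matrix (Fin 2) (Fin 2) ℝ)

/-- Arithmetic Fuchsian groups: subgroups of `PSL(2, ℝ)` which are commensurable in the wide sense
(in `PSL(2, ℂ)`) with some `Γ_O^1`, for `O` a maximal order in a quaternion algebra
`B = (a, b / k)`, `a, b ≠ 0`, over a totally real number field `k` which is unramified at exactly
one real place `φ` of `k`. -/
def IsArithmeticFuchsian (Γ : Subgroup PSL(2, ℝ)) : Prop :=
  ∃ (k : Type) (_ : Field k) (_ : NumberField k) (_ : NumberField.IsTotallyReal k)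
    (a b : k) (_ : a ≠ 0) (_ : b ≠ 0) (φ : k →+* ℝ)
    (θ : ℍ[ℝ,φ a,φ b] ≃ₐ[ℝ] Matrix (Fin 2) (Fin 2) ℝ)
    (_ : ∀ σ : k →+* ℝ, σ ≠ φ → RamifiedAtReal a b σ)
    (O : Subalgebra (𝓞 k) ℍ[k,a,b]) (hO : IsMaximalQuatOrder O),
    WideCommensurable (Γ.map pslInclusion) ((normOneGroup φ θ O hO.prop).map pslInclusion)

/-- Arithmetic Kleinian groups: subgroups of `PSL(2, ℂ)` which are commensurable in the wide sense
with some `Γ_O^1`, for `O` a maximal order in a quaternion algebra `B = (a, b / k)`, `a, b ≠ 0`,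
over a number field `k` with exactly one complex place, given by `φ`, which is ramified at all
real places of `k`. -/
def IsArithmeticKleinian (Γ : Subgroup PSL(2, ℂ)) : Prop :=
  ∃ (k : Type) (_ : Field k) (_ : NumberField k)
    (_ : NumberField.InfinitePlace.nrComplexPlaces k = 1)
    (a b : k) (_ : a ≠ 0) (_ : b ≠ 0) (φ : k →+* ℂ)
    (_ : ¬ NumberField.ComplexEmbedding.IsReal φ)
    (θ : ℍ[ℂ,φ a,φ b] ≃ₐ[ℂ] Matrix (Fin 2) (Fin 2) ℂ)
    (_ : ∀ σ : k →+* ℝ, RamifiedAtReal a b σ)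
    (O : Subalgebra (𝓞 k) ℍ[k,a,b]) (hO : IsMaximalQuatOrder O),
    WideCommensurable Γ (normOneGroup φ θ O hO.prop)

end Arithmetic

/-!
The group `Γ` is countable, so a closed geodesic of length `ℓ` on `X / Γ` is covered by a line which
a *single* `γ ∈ Γ` translates by `ℓ`: uncountably many points of the line are moved by countably
many elements, and two lines with two common points coincide. Hence the geodesic lifts to
`X / Γ'` as soon as `γ ∈ Γ'`, and the task is to find a torsion-free subgroup of finite index which
contains a given element `γ` with an eigenvalue `l`, `|l| = e^(ℓ/2) > 1`. The hyperbolic plane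
embeds in hyperbolic 3-space compatibly with `SL(2, ℝ) → SL(2, ℂ)`, so both dimensions are treated
in `PSL(2, ℂ)`.

Let `R = 𝓞 k`. Conjugation makes `Γ` act faithfully on a finitely generated `R`-module `A` of
matrices, the span of a finite index normal subgroup of `Γ` which lies in `O¹`
(`exists_lattice_rep`, `exists_common_subgroup_of_commensurable`). There `T = ρ(γ)` is a root of
`(T - 1)(T² - tT + 1)`, where `t = μ + μ⁻¹`, `μ = l²`, lies in `R`. With `w_m = μ^(-m) + … + μ^m`,
which is a polynomial in `t` (`symmGeomSum`), `X^(2m+1) - 1` is `w_m X^m (X - 1)` modulo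
`X² - tX + 1`, so the order of `T` modulo `w_m` divides `(2m + 1) e`, where `e = |R / w_m|`. The
primes which occur as orders of torsion elements of `Γ` divide a fixed number `N`. If `N ∣ m`,
`w_m ≡ 1` modulo `N`, and `w_m` is not a unit, then the order of `T` modulo `w_m` is prime to `N`;
the preimage `Γ'` of the cyclic group generated by `T` modulo `w_m` contains `γ`, and a torsion
element of prime order in it would be trivial modulo `w_m`, which forces it to be trivial by a
Nakayama argument (`exists_torsionFree_of_symmGeomSum`). Such an `m` exists
(`exists_not_isUnit_symmGeomSum`): where `B` is ramified, `|μ| = 1`, so that `w_m` returns close to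
`1` infinitely often, while it tends to infinity at the given place; if such a `w_m` were a unit, its
inverse would be one of finitely many algebraic integers with conjugates bounded by `2`, but it is
arbitrarily small at the given place.

For the systole, the length spectrum is nonempty because a norm one unit of a quadratic subfield of
`B` which is split at the given place gives a loxodromic element (`exists_loxodromic`), and discrete
because the traces are, up to bounded powers, algebraic integers with bounded conjugates
(`finite_translation_lengths`). So there is a shortest closed geodesic; it lifts to some `Γ'`, and
closed geodesics on `X / Γ'` project to closed geodesics on `X / Γ`.
-/

/-! ### Congruence quotients of groups of automorphisms of a module -/

section Congruence

open Polynomial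

/-- The sequence `w₀ = 1`, `w₁ = 1 + t`, `wₘ₊₂ = t wₘ₊₁ - wₘ`. If `t = x + x⁻¹` then
`wₘ = x⁻ᵐ + ⋯ + x⁻¹ + 1 + x + ⋯ + xᵐ`. -/
def symmGeomSum {R : Type*} [CommRing R] (t : R) : ℕ → R
  | 0 => 1
  | 1 => 1 + t
  | m + 2 => t * symmGeomSum t (m + 1) - symmGeomSum t m

theorem map_symmGeomSum {R S : Type*} [CommRing R] [CommRing S] (f : R →+* S) (t : R) (m : ℕ) :
    f (symmGeomSum t m) = symmGeomSum (f t) m := by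
  induction m using Nat.twoStepInduction with
  | zero => simp [symmGeomSum]
  | one => simp [symmGeomSum]
  | more m h1 h2 => simp [symmGeomSum, h1, h2]

theorem X_pow_sub_one_eq_symmGeomSum {R : Type*} [CommRing R] (t : R) (m : ℕ) :
    ∃ Q : R[X], X ^ (2 * m + 1) - 1 =
      C (symmGeomSum t m) * (X ^ m * (X - 1)) + (X ^ 2 - C t * X + 1) * Q := by
  induction m using Nat.twoStepInduction with
  | zero => exact ⟨0, by simp [symmGeomSum]⟩
  | one => exact ⟨X - 1, by simp only [symmGeomSum, map_add, map_one]; ring⟩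
  | more m h1 h2 =>
    obtain ⟨Q1, h1⟩ := h1
    obtain ⟨Q2, h2⟩ := h2
    refine ⟨C t * X * Q2 - X ^ 2 * Q1 + X ^ (2 * m + 3) - 1, ?_⟩
    have e1 : 2 * (m + 2) + 1 = 2 * m + 5 := by ring
    have e2 : 2 * (m + 1) + 1 = 2 * m + 3 := by ring
    rw [e2] at h2
    rw [e1]
    simp only [symmGeomSum, map_sub, map_mul]
    linear_combination (C t * X) * h2 - X ^ 2 * h1

/-- If `T` has eigenvalues `1, x, x⁻¹` with `x + x⁻¹ = t`, then a power of `T` is unipotent modulo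
`symmGeomSum t m`. -/
theorem sq_pow_sub_one_mem {R E : Type*} [CommRing R] [Ring E] [Algebra R E] {T : E} {t : R}
    (hT : (T - 1) * (T ^ 2 - t • T + 1) = 0) (m : ℕ) :
    ∃ Z : E, (T ^ (2 * m + 1) - 1) ^ 2 = symmGeomSum t m • Z := by
  obtain ⟨Q, hQ⟩ := X_pow_sub_one_eq_symmGeomSum t m
  let S : R[X] := ∑ i ∈ Finset.range (2 * m + 1), X ^ i
  have hS : (X : R[X]) ^ (2 * m + 1) - 1 = S * (X - 1) := (geom_sum_mul X _).symm
  have h : ((X : R[X]) ^ (2 * m + 1) - 1) ^ 2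
      = C (symmGeomSum t m) * (S * (X - 1) * (X ^ m * (X - 1)))
        + ((X - 1) * (X ^ 2 - C t * X + 1)) * (S * Q) := by
    calc _ = (S * (X - 1)) * ((X : R[X]) ^ (2 * m + 1) - 1) := by rw [← hS]; ring
      _ = _ := by rw [hQ]; ring
  have h' := congrArg (aeval T) h
  have h0 : aeval T ((X - 1) * (X ^ 2 - C t * X + 1) : R[X]) = 0 := by
    simpa [Algebra.smul_def] using hT
  rw [map_add, map_mul _ (((X : R[X]) - 1) * _), h0, zero_mul, add_zero, map_mul _ (C _), aeval_C,
    ← Algebra.smul_def] at h'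
  exact ⟨_, by simpa using h'⟩

theorem one_add_pow_eq {E : Type*} [Ring E] (Y : E) (e : ℕ) :
    ∃ Q : E, (1 + Y) ^ e = 1 + e • Y + Y ^ 2 * Q := by
  induction e with
  | zero => exact ⟨0, by simp⟩
  | succ e ih =>
    obtain ⟨Q, hQ⟩ := ih
    refine ⟨Q + Q * Y + e • 1, ?_⟩
    rw [pow_succ, hQ]
    simp only [nsmul_eq_mul, Nat.cast_add, Nat.cast_one]
    have := Nat.cast_commute e Y
    simp only [mul_add, add_mul, mul_one, one_mul, sq, ← mul_assoc]
    rw [mul_assoc _ Y Y, (Nat.cast_commute e (Y * Y)).eq]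
    abel

theorem one_add_pow_sub_one_mem {R E : Type*} [CommRing R] [Ring E] [Algebra R E] {Y Z : E} {w r : R}
    (hY : Y ^ 2 = w • Z) {e : ℕ} (he : (e : R) = w * r) :
    ∃ Z' : E, (1 + Y) ^ e - 1 = w • Z' := by
  obtain ⟨Q, hQ⟩ := one_add_pow_eq Y e
  refine ⟨r • Y + Z * Q, ?_⟩
  rw [hQ, hY, smul_add, smul_smul, ← he, ← Nat.cast_smul_eq_nsmul R, smul_mul_assoc]
  abel

/-- An endomorphism of order prime to `w` which is trivial modulo `w` is trivial. -/
theorem eq_one_of_pow_eq_one_of_congr_one {R A : Type*} [CommRing R] [IsDomain R]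
    [IsNoetherianRing R] [AddCommGroup A] [Module R A] [Module.Finite R A]
    [Module.IsTorsionFree R A] {w : R} (hw : ¬ IsUnit w) {q : ℕ} (hq : IsCoprime w (q : R))
    {T : Module.End R A} (hT : T ^ q = 1) (hTw : ∀ x, ∃ y, T x - x = w • y) : T = 1 := by
  let D : Submodule R A := LinearMap.range (T - 1)
  have hpow : ∀ i : ℕ, ∀ x, ∃ y, (T ^ i) ((T - 1) x) = (T - 1) x + w • (T - 1) y := by
    intro i x
    induction i with
    | zero => exact ⟨0, by simp⟩
    | succ i ih =>
      obtain ⟨y, hy⟩ := ih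
      obtain ⟨z, hz⟩ := hTw x
      refine ⟨z + T y, ?_⟩
      rw [pow_succ', Module.End.mul_apply, hy, map_add, map_smul]
      have h1 : T ((T - 1) x) = (T - 1) x + w • (T - 1) z := by
        rw [← map_smul, ← hz]
        simp
      have h2 : T ((T - 1) y) = (T - 1) (T y) := by simp
      rw [h1, h2, map_add, smul_add]
      abel
  have hsum : ∀ n : ℕ, ∀ x, ∃ y, ∑ i ∈ Finset.range n, (T ^ i) ((T - 1) x)
      = (n : R) • (T - 1) x + w • (T - 1) y := by
    intro n x
    induction n with
    | zero => exact ⟨0, by simp⟩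
    | succ n ih =>
      obtain ⟨y, hy⟩ := ih
      obtain ⟨z, hz⟩ := hpow n x
      refine ⟨y + z, ?_⟩
      rw [Finset.sum_range_succ, hy, hz, map_add, smul_add]
      push_cast
      rw [add_smul, one_smul]
      abel
  have hDw : D ≤ Ideal.span {w} • D := by
    rintro _ ⟨x, rfl⟩
    rw [Submodule.ideal_span_singleton_smul]
    obtain ⟨y, hy⟩ := hsum q x
    have h0 : ∑ i ∈ Finset.range q, (T ^ i) ((T - 1) x) = 0 := by
      have : (∑ i ∈ Finset.range q, T ^ i) * (T - 1) = 0 := by rw [geom_sum_mul, hT, sub_self]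
      simpa [LinearMap.sum_apply] using congrArg (fun f => f x) this
    rw [h0] at hy
    obtain ⟨a, b, hab⟩ := hq
    rw [Submodule.mem_smul_pointwise_iff_exists]
    refine ⟨(T - 1) (a • x - b • y), ⟨_, rfl⟩, ?_⟩
    have : (T - 1) x = (a * w) • (T - 1) x + b • ((q : R) • (T - 1) x) := by
      rw [smul_smul, ← add_smul, hab, one_smul]
    rw [this, eq_neg_of_add_eq_zero_left hy.symm, map_sub, map_smul, map_smul, smul_sub, smul_smul,
      smul_neg, smul_comm w b, mul_comm a w]
    abel
  obtain ⟨r, hr, hrD⟩ := Submodule.exists_sub_one_mem_and_smul_eq_zero_of_fg_of_le_smul _ D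
    (IsNoetherian.noetherian D) hDw
  have hr0 : r ≠ 0 := by
    rintro rfl
    rw [Ideal.mem_span_singleton] at hr
    exact hw (isUnit_of_dvd_unit hr (by simp))
  ext x
  have := (smul_eq_zero.1 (hrD ((T - 1) x) ⟨x, rfl⟩)).resolve_left hr0
  simpa [sub_eq_zero] using this

/-- Reduction of endomorphisms modulo `w`. -/
noncomputable def endReduction {R : Type*} (A : Type*) [CommRing R] [AddCommGroup A] [Module R A] (w : R) :
    Module.End R A →* Module.End R (A ⧸ (Ideal.span {w} • ⊤ : Submodule R A)) where
  toFun f := Submodule.mapQ _ _ f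
    (by rw [← Submodule.map_le_iff_le_comap, Submodule.map_smul'']; exact Submodule.smul_mono le_rfl le_top)
  map_one' := by ext; simp
  map_mul' f g := by ext; simp

theorem endReduction_eq_one_iff {R A : Type*} [CommRing R] [AddCommGroup A] [Module R A] {w : R}
    {f : Module.End R A} : endReduction A w f = 1 ↔ ∀ x, ∃ y, f x - x = w • y := by
  have : endReduction A w f = 1 ↔ ∀ x, f x - x ∈ (Ideal.span {w} • ⊤ : Submodule R A) := by
    rw [LinearMap.ext_iff]
    constructor
    · intro h x
      have := h (Submodule.Quotient.mk x)
      simpa [endReduction, Submodule.Quotient.eq] using this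
    · intro h x
      obtain ⟨x, rfl⟩ := Submodule.Quotient.mk_surjective _ x
      simpa [endReduction, Submodule.Quotient.eq] using h x
  rw [this]
  simp only [Submodule.ideal_span_singleton_smul, Submodule.mem_smul_pointwise_iff_exists,
    Submodule.mem_top, true_and, eq_comm]

theorem finite_end_quotient {R A : Type*} [CommRing R] [AddCommGroup A] [Module R A]
    [Module.Finite R A] (w : R) [Finite (R ⧸ Ideal.span {w})] :
    Finite (Module.End R (A ⧸ (Ideal.span {w} • ⊤ : Submodule R A))) := by
  have : Module.Finite (R ⧸ Ideal.span {w}) (A ⧸ (Ideal.span {w} • ⊤ : Submodule R A)) :=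
    Module.Finite.of_restrictScalars_finite R _ _
  have : Finite (A ⧸ (Ideal.span {w} • ⊤ : Submodule R A)) :=
    Module.finite_of_finite (R ⧸ Ideal.span {w})
  exact DFunLike.finite _

theorem exists_prime_orderOf_pow {G : Type*} [Group G] {g : G} (hg : IsOfFinOrder g) (h1 : g ≠ 1) :
    ∃ n q : ℕ, q.Prime ∧ orderOf (g ^ n) = q := by
  have hpos := orderOf_pos_iff.2 hg
  have hne : orderOf g ≠ 1 := by rwa [Ne, orderOf_eq_one_iff]
  obtain ⟨q, hq, n, hn⟩ := Nat.exists_prime_and_dvd hne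
  refine ⟨n, q, hq, ?_⟩
  rw [orderOf_pow' _ (by rintro rfl; simp [hn] at hpos), hn, Nat.gcd_mul_left_left]
  have : 0 < n := Nat.pos_of_ne_zero (by rintro rfl; simp [hn] at hpos)
  exact Nat.mul_div_cancel _ this

theorem exists_natCast_eq_mul_coprime {R : Type*} [CommRing R] {w : R} [Finite (R ⧸ Ideal.span {w})]
    {N : ℕ} (hN : IsCoprime w (N : R)) : ∃ e : ℕ, e.Coprime N ∧ ∃ r, (e : R) = w * r := by
  refine ⟨Nat.card (R ⧸ Ideal.span {w}), ?_, ?_⟩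
  · by_contra hc
    obtain ⟨p, hp, hpe, n, rfl⟩ := Nat.Prime.not_coprime_iff_dvd.1 hc
    have := Fact.mk hp
    obtain ⟨y, hy⟩ := exists_prime_addOrderOf_dvd_card' p hpe
    obtain ⟨a, b, hab⟩ := hN
    have h1 : (Ideal.Quotient.mk (Ideal.span {w}) b * (n : R ⧸ Ideal.span {w})) * p = 1 := by
      have h0 : Ideal.Quotient.mk (Ideal.span {w}) w = 0 := by
        rw [Ideal.Quotient.eq_zero_iff_dvd]
      have := congrArg (Ideal.Quotient.mk (Ideal.span {w})) hab
      rw [map_add, map_mul, h0, mul_zero, zero_add, map_mul, map_one, map_natCast,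
        Nat.cast_mul] at this
      rw [← this]
      ring
    have h2 : y = 0 := by
      have h3 : (p : R ⧸ Ideal.span {w}) * y = 0 := by
        rw [← nsmul_eq_mul, ← hy, addOrderOf_nsmul_eq_zero]
      rw [← one_mul y, ← h1, mul_assoc, h3, mul_zero]
    rw [h2, addOrderOf_zero] at hy
    exact hp.one_lt.ne hy
  · have : (Nat.card (R ⧸ Ideal.span {w}) : R ⧸ Ideal.span {w}) = 0 := by
      have := card_nsmul_eq_zero' (G := R ⧸ Ideal.span {w}) (x := 1)
      simpa using this
    rw [← map_natCast (Ideal.Quotient.mk (Ideal.span {w})), Ideal.Quotient.eq_zero_iff_dvd] at this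
    exact this

/-- For a faithful action `ρ` of `G` on a lattice `A`, and `γ ∈ G` acting with eigenvalues
`1, x, x⁻¹`, the preimage of the cyclic group generated by `γ` in the congruence quotient of level
`w = symmGeomSum t m` (with `t = x + x⁻¹`) is torsion-free: the torsion primes of `G` divide `N`,
whereas the order of `γ` modulo `w` is prime to `N`. -/
theorem exists_torsionFree_of_symmGeomSum {R A G : Type*} [CommRing R] [IsDomain R]
    [IsNoetherianRing R] [AddCommGroup A] [Module R A] [Module.Finite R A]
    [Module.IsTorsionFree R A] [Group G] (ρ : G →* Module.End R A) (hρ : Function.Injective ρ)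
    (hfin : ∀ w : R, w ≠ 0 → Finite (R ⧸ Ideal.span {w}))
    (h30 : (3 : R) ≠ 0) (h3 : ¬ IsUnit (3 : R)) :
    ∃ N : ℕ, N ≠ 0 ∧ ∀ (γ : G) (t : R) (m : ℕ),
      (ρ γ - 1) * ((ρ γ) ^ 2 - t • ρ γ + 1) = 0 → symmGeomSum t m ≠ 0 →
      ¬ IsUnit (symmGeomSum t m) → IsCoprime (symmGeomSum t m) (N : R) → N ∣ m →
      ∃ G' : Subgroup G, G'.index ≠ 0 ∧ γ ∈ G' ∧ ∀ g ∈ G', IsOfFinOrder g → g = 1 := by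
  let f : ∀ w : R, G →* (Module.End R (A ⧸ (Ideal.span {w} • ⊤ : Submodule R A)))ˣ :=
    fun w => ((endReduction A w).comp ρ).toHomUnits
  have hf1 : ∀ w g, f w g = 1 ↔ ∀ x, ∃ y, ρ g x - x = w • y := by
    intro w g
    rw [← endReduction_eq_one_iff, ← Units.val_inj]
    rfl
  have hffin : ∀ w : R, w ≠ 0 →
      Finite (Module.End R (A ⧸ (Ideal.span {w} • ⊤ : Submodule R A)))ˣ := by
    intro w hw
    have := hfin w hw
    have := finite_end_quotient (A := A) w
    infer_instance
  -- elements of prime order in a congruence subgroup of level prime to the order are trivial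
  have hker : ∀ (w : R), ¬ IsUnit w → ∀ (g : G) (q : ℕ), orderOf g = q → q.Prime →
      IsCoprime w (q : R) → f w g ≠ 1 := by
    intro w hw g q hgq hq hwq hfg
    have h1 : ρ g = 1 := by
      refine eq_one_of_pow_eq_one_of_congr_one hw hwq ?_ ((hf1 w g).1 hfg)
      rw [← map_pow, ← hgq, pow_orderOf_eq_one, map_one]
    rw [← map_one ρ] at h1
    rw [hρ h1, orderOf_one] at hgq
    exact hq.one_lt.ne hgq
  have hfin3 := hffin 3 h30
  let E := Nat.card (Module.End R (A ⧸ (Ideal.span {(3 : R)} • ⊤ : Submodule R A)))ˣ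
  have hE : E ≠ 0 := Nat.card_pos.ne'
  have hN : ∀ (g : G) (q : ℕ), orderOf g = q → q.Prime → q ∣ 3 * E := by
    intro g q hgq hq
    by_contra hqN
    have hq3 : Nat.Coprime 3 q := by
      rw [Nat.coprime_comm, hq.coprime_iff_not_dvd]
      exact fun h => hqN (h.mul_right _)
    have hqE : Nat.Coprime q E := by
      rw [hq.coprime_iff_not_dvd]
      exact fun h => hqN (h.mul_left _)
    refine hker 3 h3 g q hgq hq (by exact_mod_cast hq3.cast) ?_
    rw [← orderOf_eq_one_iff]
    refine Nat.eq_one_of_dvd_coprimes hqE ?_ (orderOf_dvd_natCard _)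
    rw [← hgq]
    exact orderOf_map_dvd _ _
  refine ⟨3 * E, by positivity, ?_⟩
  intro γ t m hγ hw0 hw hwN hNm
  set w := symmGeomSum t m with hwdef
  have := hfin w hw0
  have := hffin w hw0
  obtain ⟨e, heN, r, her⟩ := exists_natCast_eq_mul_coprime hwN
  have hγ1 : f w γ ^ ((2 * m + 1) * e) = 1 := by
    rw [← map_pow, hf1]
    obtain ⟨Z, hZ⟩ := sq_pow_sub_one_mem hγ m
    obtain ⟨Z', hZ'⟩ := one_add_pow_sub_one_mem hZ her
    intro x
    refine ⟨Z' x, ?_⟩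
    rw [add_sub_cancel, ← pow_mul, ← map_pow] at hZ'
    simpa using congrArg (fun f => f x) hZ'
  refine ⟨(Subgroup.zpowers (f w γ)).comap (f w), ?_, Subgroup.mem_zpowers _, ?_⟩
  · rw [Subgroup.index_comap]
    exact Subgroup.index_ne_zero_of_finite
  · intro g hg hgfin
    by_contra hg1
    obtain ⟨n, q, hq, hgn⟩ := exists_prime_orderOf_pow hgfin hg1
    have hqN := hN _ q hgn hq
    have hmem : f w (g ^ n) ∈ Subgroup.zpowers (f w γ) := by
      rw [map_pow]
      exact Subgroup.pow_mem _ (Subgroup.mem_comap.1 hg) n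
    have hwq : IsCoprime w (q : R) :=
      hwN.of_isCoprime_of_dvd_right (Nat.cast_dvd_cast hqN)
    refine hker w hw _ q hgn hq hwq ?_
    rw [← orderOf_eq_one_iff]
    have hcop : Nat.Coprime q ((2 * m + 1) * e) := by
      refine Nat.Coprime.mul_right ?_ (heN.symm.coprime_dvd_left hqN)
      have hqm := hqN.trans hNm
      rw [hq.coprime_iff_not_dvd]
      intro h
      have := (Nat.dvd_add_right (hqm.mul_left 2)).1 h
      exact hq.one_lt.ne' (Nat.dvd_one.1 this)
    refine Nat.eq_one_of_dvd_coprimes hcop ?_ ?_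
    · rw [← hgn]
      exact orderOf_map_dvd _ _
    · refine (orderOf_dvd_of_mem_zpowers hmem).trans ?_
      exact orderOf_dvd_of_pow_eq_one hγ1

end Congruence

/-! ### Non-units with prescribed residue in a linear recurrence -/

section Recurrence

open Filter Topology

theorem exists_period_symmGeomSum {S : Type*} [CommRing S] [Finite S] (t : S) :
    ∃ M : ℕ, M ≠ 0 ∧ ∀ j, symmGeomSum t (M * j) = 1 := by
  let f : Equiv.Perm (S × S) :=
    { toFun := fun p => (p.2, t * p.2 - p.1)
      invFun := fun p => (t * p.1 - p.2, p.1)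
      left_inv := fun p => by simp
      right_inv := fun p => by simp }
  have hf : ∀ m, (f ^ m) (1, 1 + t) = (symmGeomSum t m, symmGeomSum t (m + 1)) := by
    intro m
    induction m with
    | zero => simp [symmGeomSum]
    | succ m ih =>
      rw [pow_succ', Equiv.Perm.mul_apply, ih]
      simp [f, symmGeomSum]
  refine ⟨orderOf f, (orderOf_pos f).ne', fun j => ?_⟩
  have := hf (orderOf f * j)
  rw [pow_mul, pow_orderOf_eq_one, one_pow, Equiv.Perm.one_apply] at this
  exact (congrArg Prod.fst this).symm

theorem sub_one_mul_symmGeomSum {K : Type*} [Field K] {ν : K} (hν : ν ≠ 0) (m : ℕ) :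
    (ν - 1) * symmGeomSum (ν + ν⁻¹) m = ν ^ (m + 1) - ν⁻¹ ^ m := by
  induction m using Nat.twoStepInduction with
  | zero => simp [symmGeomSum]
  | one => simp only [symmGeomSum]; field_simp; ring
  | more m h1 h2 =>
    simp only [symmGeomSum]
    have : (ν - 1) * ((ν + ν⁻¹) * symmGeomSum (ν + ν⁻¹) (m + 1) - symmGeomSum (ν + ν⁻¹) m)
      = (ν + ν⁻¹) * ((ν - 1) * symmGeomSum (ν + ν⁻¹) (m + 1))
        - (ν - 1) * symmGeomSum (ν + ν⁻¹) m := by ring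
    rw [this, h1, h2]
    have hi : ν * ν⁻¹ = 1 := mul_inv_cancel₀ hν
    ring_nf
    linear_combination (ν ^ (m + 1) - ν⁻¹ ^ m) * hi

/-- Powers of a point of a torus return to every neighbourhood of `1`. -/
theorem exists_pow_mem_nhds_one {ι : Type*} [Finite ι] (ν : ι → ℂ) (hν : ∀ i, ‖ν i‖ = 1)
    {U : Set (ι → ℂ)} (hU : U ∈ 𝓝 1) (m₀ : ℕ) : ∃ j, m₀ ≤ j ∧ ν ^ j ∈ U := by
  have := Fintype.ofFinite ι
  have hb : ∀ n : ℕ, ν ^ n ∈ Set.pi Set.univ (fun _ : ι => Metric.sphere (0 : ℂ) 1) := by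
    intro n i _
    simp [hν]
  obtain ⟨z, hz, e, he, hlim⟩ := (isCompact_univ_pi fun _ : ι => isCompact_sphere (0 : ℂ) 1).tendsto_subseq hb
  have hz0 : ∀ i, z i ≠ 0 := by
    intro i h0
    have := hz i trivial
    simp [h0] at this
  have h1 : Tendsto (fun n => ν ^ (e (n + m₀)) / ν ^ (e n)) atTop (𝓝 1) := by
    have h : z / z = 1 := by ext i; simp [hz0 i]
    rw [← h, tendsto_pi_nhds]
    intro i
    have h2 := tendsto_pi_nhds.1 hlim i
    exact ((tendsto_add_atTop_iff_nat m₀).2 h2).div h2 (hz0 i)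
  obtain ⟨n, hn⟩ := (h1.eventually hU).exists
  have hle : e n + m₀ ≤ e (n + m₀) := by
    have := he.add_le_nat m₀ n
    rwa [add_comm m₀ (e n), add_comm m₀ n] at this
  refine ⟨e (n + m₀) - e n, by omega, ?_⟩
  suffices h : ν ^ (e (n + m₀) - e n) = ν ^ e (n + m₀) / ν ^ e n by
    rw [h]
    exact hn
  ext i
  have hi : ν i ≠ 0 := by
    intro h0
    have := hν i
    simp [h0] at this
  simp only [Pi.pow_apply, Pi.div_apply]
  rw [pow_sub₀ _ hi (by omega), div_eq_mul_inv]

theorem norm_symmGeomSum_sub_one_le {ν : ℂ} (hν : ‖ν‖ = 1) (m : ℕ) :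
    ‖ν - 1‖ * ‖symmGeomSum (ν + ν⁻¹) m - 1‖ ≤ 2 * ‖ν ^ m - 1‖ := by
  have hν0 : ν ≠ 0 := by rintro rfl; simp at hν
  have h := sub_one_mul_symmGeomSum hν0 m
  have h1 : (ν - 1) * (symmGeomSum (ν + ν⁻¹) m - 1) = ν * (ν ^ m - 1) + ν⁻¹ ^ m * (ν ^ m - 1) := by
    have hi : ν⁻¹ ^ m * ν ^ m = 1 := by rw [← mul_pow, inv_mul_cancel₀ hν0, one_pow]
    rw [mul_sub, h, mul_sub (ν⁻¹ ^ m), hi]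
    ring
  rw [← norm_mul, h1]
  refine (norm_add_le _ _).trans_eq ?_
  simp [hν]
  ring

theorem tendsto_norm_symmGeomSum {μ : ℂ} (hμ : 1 < ‖μ‖) :
    Tendsto (fun m => ‖symmGeomSum (μ + μ⁻¹) m‖) atTop atTop := by
  have hμ0 : μ ≠ 0 := by rintro rfl; simp at hμ; linarith
  have h1 : 0 < ‖μ - 1‖ := by
    rw [norm_pos_iff, sub_ne_zero]
    rintro rfl
    simp at hμ
  refine tendsto_atTop_mono (f := fun m => (‖μ‖ ^ m - 1) / ‖μ - 1‖) (fun m => ?_) ?_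
  · rw [div_le_iff₀ h1, mul_comm, ← norm_mul, sub_one_mul_symmGeomSum hμ0]
    have h2 := norm_sub_norm_le (μ ^ (m + 1)) (μ⁻¹ ^ m)
    simp only [norm_pow, norm_inv] at h2
    have h3 : ‖μ‖⁻¹ ^ m ≤ 1 := pow_le_one₀ (by positivity) (inv_le_one_of_one_le₀ hμ.le)
    have h4 : ‖μ‖ ^ m ≤ ‖μ‖ ^ (m + 1) := pow_le_pow_right₀ hμ.le (Nat.le_succ m)
    linarith
  · exact (tendsto_atTop_add_const_right _ _ (tendsto_pow_atTop_atTop_of_one_lt hμ)).atTop_div_const h1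

theorem finite_quotient_span_singleton {k : Type*} [Field k] [NumberField k] {w : 𝓞 k} (hw : w ≠ 0) :
    Finite (𝓞 k ⧸ Ideal.span {w}) :=
  Ideal.finiteQuotientOfFreeOfNeBot _ (by simpa using hw)

/-- Let `t = μ + μ⁻¹` with `|μ| > 1` at the place `φ` and `|μ| = 1` at all other places. Then
there are `m` divisible by `N` for which `symmGeomSum t m` is `1` modulo `N` and not a unit:
it can be made large at `φ` while it stays close to `1` at the other places, so that if it were
always a unit, the inverses would be infinitely many integers with bounded conjugates. -/
theorem exists_not_isUnit_symmGeomSum {k : Type*} [Field k] [NumberField k] (φ : k →+* ℂ)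
    {t : 𝓞 k} {μ : ℂ} (hμ : 1 < ‖μ‖) (ht : φ t = μ + μ⁻¹)
    (hσ : ∀ σ : k →+* ℂ, σ ≠ φ → σ ≠ NumberField.ComplexEmbedding.conjugate φ →
      ∃ ν : ℂ, ‖ν‖ = 1 ∧ σ t = ν + ν⁻¹) {N : ℕ} (hN : N ≠ 0) :
    ∃ m, N ∣ m ∧ symmGeomSum t m ≠ 0 ∧ ¬ IsUnit (symmGeomSum t m) ∧
      IsCoprime (symmGeomSum t m) (N : 𝓞 k) := by
  have hN' : (N : 𝓞 k) ≠ 0 := by exact_mod_cast hN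
  have := finite_quotient_span_singleton hN'
  obtain ⟨M, hM, hper⟩ := exists_period_symmGeomSum (Ideal.Quotient.mk (Ideal.span {(N : 𝓞 k)}) t)
  have hcop : ∀ j, IsCoprime (symmGeomSum t (M * j)) (N : 𝓞 k) := by
    intro j
    have := hper j
    rw [← map_symmGeomSum, ← map_one (Ideal.Quotient.mk _), Ideal.Quotient.eq,
      Ideal.mem_span_singleton] at this
    obtain ⟨c, hc⟩ := this
    exact ⟨1, -c, by linear_combination hc⟩
  -- integers with conjugates bounded by `2` are bounded away from `0` at `φ`
  obtain ⟨δ, hδ, hδ'⟩ : ∃ δ > 0, ∀ v : k, IsIntegral ℤ v → v ≠ 0 → (∀ σ : k →+* ℂ, ‖σ v‖ ≤ 2) →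
      δ ≤ ‖φ v‖ := by
    have hfin := NumberField.Embeddings.finite_of_norm_le k ℂ 2
    have hfin' := hfin.sdiff (t := {0})
    obtain hemp | hne := ({x : k | IsIntegral ℤ x ∧ ∀ φ : k →+* ℂ, ‖φ x‖ ≤ 2} \ {0}).eq_empty_or_nonempty
    · refine ⟨1, one_pos, fun v hv hv0 hb => ?_⟩
      have hmem : v ∈ {x : k | IsIntegral ℤ x ∧ ∀ φ : k →+* ℂ, ‖φ x‖ ≤ 2} \ {0} := ⟨⟨hv, hb⟩, hv0⟩
      rw [hemp] at hmem
      exact hmem.elim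
    · obtain ⟨x, hx, hmin⟩ := hfin'.exists_minimalFor (fun x => ‖φ x‖) _ hne
      refine ⟨‖φ x‖, by simpa using hx.2, fun v hv hv0 hb => ?_⟩
      by_contra! h
      exact h.not_ge (hmin ⟨⟨hv, hb⟩, hv0⟩ h.le)
  let ι := {σ : k →+* ℂ // σ ≠ φ ∧ σ ≠ NumberField.ComplexEmbedding.conjugate φ}
  choose ν hν1 hν2 using fun σ : ι => hσ σ.1 σ.2.1 σ.2.2
  have hc2 : ((2 : 𝓞 k) : k) = 2 := map_ofNat (algebraMap (𝓞 k) k) 2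
  have hνne : ∀ σ, ν σ ≠ 1 := by
    intro σ h1
    have h2 := hν2 σ
    rw [h1] at h2
    have h3 : t = 2 := by
      apply NumberField.RingOfIntegers.ext
      apply σ.1.injective
      rw [h2, hc2, map_ofNat]
      norm_num
    rw [h3] at ht
    have hμ0 : μ ≠ 0 := by rintro rfl; simp at hμ; linarith
    have h4 : (μ - 1) ^ 2 = 0 := by
      have h5 : (φ ((2 : 𝓞 k) : k)) = 2 := by rw [hc2, map_ofNat]
      rw [h5] at ht
      field_simp at ht
      linear_combination -ht
    have h5 : μ = 1 := by
      have := pow_eq_zero_iff (two_ne_zero) |>.1 h4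
      linear_combination this
    rw [h5] at hμ
    simp at hμ
  have hlarge := (tendsto_norm_symmGeomSum hμ).eventually_gt_atTop (max δ⁻¹ 1)
  obtain ⟨m₀, hm₀⟩ := eventually_atTop.1 hlarge
  have hU : ∀ᶠ z in 𝓝 (1 : ι → ℂ), ∀ σ, ‖z σ - 1‖ < ‖ν σ - 1‖ / 4 := by
    rw [eventually_all]
    intro σ
    have hc : Tendsto (fun z : ι → ℂ => ‖z σ - 1‖) (𝓝 1) (𝓝 0) := by
      have : Continuous fun z : ι → ℂ => ‖z σ - 1‖ := by fun_prop
      simpa using this.tendsto 1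
    exact hc.eventually_lt_const (by
      have := norm_pos_iff.2 (sub_ne_zero.2 (hνne σ))
      positivity)
  obtain ⟨j, hj, hjU⟩ := exists_pow_mem_nhds_one (fun σ => ν σ ^ (M * N))
    (fun σ => by simp [hν1]) hU m₀
  set m := M * (N * j) with hm
  have hmm₀ : m₀ ≤ m := by
    have : 1 ≤ M * N := Nat.one_le_iff_ne_zero.2 (mul_ne_zero hM hN)
    calc m₀ ≤ 1 * j := by omega
      _ ≤ M * N * j := Nat.mul_le_mul_right _ this
      _ = m := by rw [hm, mul_assoc]
  have hφ : max δ⁻¹ 1 < ‖φ (symmGeomSum t m : 𝓞 k)‖ := by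
    have h1 := map_symmGeomSum (φ.comp (algebraMap (𝓞 k) k)) t m
    have h2 : (φ.comp (algebraMap (𝓞 k) k)) t = μ + μ⁻¹ := ht
    rw [h2] at h1
    have := hm₀ m hmm₀
    rw [← h1] at this
    exact this
  have hφ0 : 0 < ‖φ (symmGeomSum t m : 𝓞 k)‖ := lt_trans (by positivity) hφ
  refine ⟨m, ⟨M * j, by rw [hm]; ring⟩, ?_, ?_, hcop _⟩
  · intro h0
    simp [h0] at hφ0
  · rintro ⟨u, hu⟩
    have hv : ∀ σ : k →+* ℂ, σ ((u⁻¹ : (𝓞 k)ˣ) : 𝓞 k) = (σ (symmGeomSum t m : 𝓞 k))⁻¹ := by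
      intro σ
      rw [← hu]
      apply eq_inv_of_mul_eq_one_left
      rw [← map_mul, ← map_mul]
      simp
    have hvb : ∀ σ : k →+* ℂ, ‖σ ((u⁻¹ : (𝓞 k)ˣ) : 𝓞 k)‖ ≤ 2 := by
      intro σ
      rw [hv, norm_inv]
      have hone : ‖φ (symmGeomSum t m : 𝓞 k)‖⁻¹ ≤ 2 := by
        have := inv_le_one_of_one_le₀ ((le_max_right δ⁻¹ 1).trans hφ.le)
        linarith
      by_cases h1 : σ = φ
      · rw [h1]
        exact hone
      by_cases h2 : σ = NumberField.ComplexEmbedding.conjugate φ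
      · rw [h2, NumberField.ComplexEmbedding.conjugate_coe_eq, RCLike.norm_conj]
        exact hone
      · let s : ι := ⟨σ, h1, h2⟩
        have h3 := map_symmGeomSum (σ.comp (algebraMap (𝓞 k) k)) t m
        have h4 : (σ.comp (algebraMap (𝓞 k) k)) t = ν s + (ν s)⁻¹ := hν2 s
        rw [h4] at h3
        have h5 := norm_symmGeomSum_sub_one_le (hν1 s) m
        have h6 : ‖ν s ^ m - 1‖ < ‖ν s - 1‖ / 4 := by
          have := hjU s
          simpa [← pow_mul, hm, mul_assoc] using this
        have h7 := norm_pos_iff.2 (sub_ne_zero.2 (hνne s))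
        have h8 : ‖symmGeomSum (ν s + (ν s)⁻¹) m - 1‖ ≤ 1 / 2 := by
          by_contra! h
          nlinarith
        rw [← h3] at h8
        change ‖σ (symmGeomSum t m : 𝓞 k) - 1‖ ≤ 1 / 2 at h8
        have h9 := norm_sub_norm_le (1 : ℂ) (σ (symmGeomSum t m : 𝓞 k))
        rw [norm_one, norm_sub_rev] at h9
        rw [show (2 : ℝ) = (1 / 2)⁻¹ by norm_num]
        exact inv_anti₀ (by norm_num) (by linarith)
    have h1 := hδ' _ (NumberField.RingOfIntegers.isIntegral_coe _) (by
      rw [Ne, NumberField.RingOfIntegers.coe_eq_zero_iff]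
      exact Units.ne_zero _) hvb
    rw [hv, norm_inv] at h1
    have h2 := (le_inv_comm₀ hδ hφ0).1 h1
    exact absurd ((le_max_left _ _).trans_lt hφ) h2.not_gt

end Recurrence

/-! ### Units of norm one in orders -/

section Units

open NumberField

/-- The embedding `x + y √c ↦ φ x + φ y s` of `k(√c)`, for a square root `s` of `φ c`. -/
noncomputable def quadraticEmbedding {k : Type*} [Field k] {c : k} (φ : k →+* ℂ) {s : ℂ}
    (hs : s ^ 2 = φ c) : QuadraticAlgebra k c 0 →+* ℂ where
  toFun x := φ x.re + φ x.im * s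
  map_one' := by
    change φ 1 + φ 0 * s = 1
    simp
  map_zero' := by
    change φ 0 + φ 0 * s = 0
    simp
  map_mul' x y := by
    simp only [QuadraticAlgebra.re_mul, QuadraticAlgebra.im_mul, map_add, map_mul, map_zero]
    linear_combination -(φ x.im * φ y.im) * hs
  map_add' x y := by
    simp only [QuadraticAlgebra.re_add, QuadraticAlgebra.im_add, map_add]
    ring

/-- If the place `φ` of `k` splits in the quadratic extension `k(√c)`, then `k(√c)` has units of
relative norm one and infinite order. -/
theorem exists_unit_norm_gt_one {k : Type*} [Field k] [NumberField k] {c : k}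
    (hc : ∀ r : k, r ^ 2 ≠ c) (φ : k →+* ℂ) {s : ℂ} (hs : s ^ 2 = φ c)
    (hsplit : ComplexEmbedding.conjugate φ = φ → starRingEnd ℂ s ≠ -s) :
    ∃ x : QuadraticAlgebra k c 0, IsIntegral ℤ x ∧ x * star x = 1 ∧
      1 < ‖quadraticEmbedding φ hs x‖ := by
  have : Fact (∀ r : k, r ^ 2 ≠ c + 0 * r) := ⟨fun r => by simpa using hc r⟩
  let L := QuadraticAlgebra k c 0
  have : FiniteDimensional ℚ L := Module.Finite.trans k L
  have : NumberField L := ⟨⟩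
  have hs' : (-s) ^ 2 = φ c := by rw [neg_sq, hs]
  let ψ₁ : L →+* ℂ := quadraticEmbedding φ hs
  let ψ₂ : L →+* ℂ := quadraticEmbedding φ hs'
  have hψ : ∀ x : L, ψ₁ (star x) = ψ₂ x := by
    intro x
    change φ (x.re + 0 * x.im) + φ (-x.im) * s = φ x.re + φ x.im * -s
    rw [zero_mul, add_zero, map_neg]
    ring
  have hs0 : s ≠ 0 := by
    rintro rfl
    refine hc 0 ?_
    apply φ.injective
    rw [← hs]
    simp
  have hne : InfinitePlace.mk ψ₂ ≠ InfinitePlace.mk ψ₁ := by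
    rw [Ne, InfinitePlace.mk_eq_iff]
    have hω : ∀ r : ℂ, ∀ hr : r ^ 2 = φ c, quadraticEmbedding φ hr QuadraticAlgebra.omega = r := by
      intro r hr
      simp [quadraticEmbedding]
    have hk : ∀ r : ℂ, ∀ hr : r ^ 2 = φ c, ∀ y : k, quadraticEmbedding φ hr (algebraMap k L y) = φ y := by
      intro r hr y
      simp [quadraticEmbedding, L]
    rintro (h | h)
    · have := congrArg (fun f => f QuadraticAlgebra.omega) h
      simp only [ψ₁, ψ₂, hω] at this
      have h2 : (2 : ℂ) * s = 0 := by linear_combination -this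
      simp [hs0] at h2
    · refine hsplit ?_ ?_
      · ext y
        have := congrArg (fun f => f (algebraMap k L y)) h
        simpa only [ψ₁, ψ₂, ComplexEmbedding.conjugate_coe_eq, hk] using this
      · have := congrArg (fun f => f QuadraticAlgebra.omega) h
        simp only [ψ₁, ψ₂, ComplexEmbedding.conjugate_coe_eq, hω, map_neg] at this
        linear_combination -this
  obtain ⟨u, hu⟩ := Units.dirichletUnitTheorem.exists_unit L (InfinitePlace.mk ψ₁)
  have hu' : ∀ w : InfinitePlace L, w ≠ InfinitePlace.mk ψ₁ → w (u : 𝓞 L) < 1 := by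
    intro w hw
    have h0 : 0 < w (u : 𝓞 L) := by
      rw [InfinitePlace.pos_iff, Ne, RingOfIntegers.coe_eq_zero_iff]
      exact u.ne_zero
    exact (Real.log_neg_iff h0).1 (hu w hw)
  have h1 := InfinitePlace.one_le_of_lt_one (u.ne_zero) hu'
  have h2 := hu' _ hne
  rw [InfinitePlace.apply] at h1 h2
  -- the unit is `ε / star ε`, for a unit `ε` which is large at one place above `φ` only
  let e : L := (u : 𝓞 L)
  let e' : L := ((u⁻¹ : (𝓞 L)ˣ) : 𝓞 L)
  have hee : e * e' = 1 := by
    have : (u : 𝓞 L) * ((u⁻¹ : (𝓞 L)ˣ) : 𝓞 L) = 1 := by simp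
    simpa only [map_mul, map_one] using congrArg (algebraMap (𝓞 L) L) this
  have hint : IsIntegral ℤ e' := RingOfIntegers.isIntegral_coe _
  have hint' : IsIntegral ℤ e := RingOfIntegers.isIntegral_coe _
  have hstar : e' * star e' * (e * star e) = 1 := by
    calc _ = (e * e') * star (e * e') := by rw [star_mul]; ring
      _ = 1 := by rw [hee, one_mul]; exact star_one L
  refine ⟨e * star e', hint'.mul ?_, ?_, ?_⟩
  · exact hint.map (starRingEnd L).toIntAlgHom
  · rw [star_mul, star_star]
    linear_combination hstar
  · change 1 < ‖ψ₁ (e * star e')‖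
    rw [map_mul, hψ, norm_mul]
    have h3 : ‖ψ₂ e‖ * ‖ψ₂ e'‖ = 1 := by
      rw [← norm_mul, ← map_mul, hee, map_one, norm_one]
    change 1 ≤ ‖ψ₁ e‖ at h1
    change ‖ψ₂ e‖ < 1 at h2
    have h4 : 0 < ‖ψ₂ e'‖ := by
      by_contra! h
      nlinarith [norm_nonneg (ψ₂ e), norm_nonneg (ψ₂ e')]
    have h5 : 1 < ‖ψ₂ e'‖ := by nlinarith
    nlinarith

theorem exists_smul_mem_order {k B : Type*} [Field k] [NumberField k] [Ring B] [Algebra k B]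
    [Algebra (𝓞 k) B] [IsScalarTower (𝓞 k) k B] {O : Subalgebra (𝓞 k) B}
    (hO : Submodule.span k (O : Set B) = ⊤) (y : B) : ∃ e : ℤ, e ≠ 0 ∧ e • y ∈ O := by
  have hy : y ∈ Submodule.span k (O : Set B) := by rw [hO]; trivial
  induction hy using Submodule.span_induction with
  | mem x hx => exact ⟨1, one_ne_zero, by simpa using hx⟩
  | zero => exact ⟨1, one_ne_zero, by simp⟩
  | add x y _ _ hx hy =>
    obtain ⟨e, he, hx⟩ := hx
    obtain ⟨f, hf, hy⟩ := hy
    refine ⟨e * f, mul_ne_zero he hf, ?_⟩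
    rw [smul_add]
    refine O.add_mem ?_ ?_
    · rw [mul_comm, mul_smul]
      exact zsmul_mem hx f
    · rw [mul_smul]
      exact zsmul_mem hy e
  | smul r x _ hx =>
    obtain ⟨e, he, hx⟩ := hx
    obtain ⟨d, hd, hr⟩ := ((IsFractionRing.isAlgebraic_iff ℤ ℚ k).2
      (Algebra.IsAlgebraic.isAlgebraic r)).exists_integral_multiple
    obtain ⟨z, hz⟩ : ∃ z : 𝓞 k, (z : k) = d • r := ⟨⟨_, hr⟩, rfl⟩
    refine ⟨d * e, mul_ne_zero hd he, ?_⟩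
    have : (d * e) • r • x = z • e • x := by
      have h1 : z • e • x = (d • r) • e • x := by
        rw [← hz, ← algebraMap_smul k z (e • x)]
      rw [h1, mul_smul, smul_assoc, smul_comm r e x]
    rw [this]
    exact O.smul_mem hx z

/-- A unit of a number field which maps to an algebra has a power in a given order. -/
theorem exists_pow_mem_order {k B L : Type*} [Field k] [NumberField k] [Ring B] [Algebra k B]
    [Algebra (𝓞 k) B] [IsScalarTower (𝓞 k) k B] {O : Subalgebra (𝓞 k) B}
    (hO : Submodule.span k (O : Set B) = ⊤) [Field L] [NumberField L] (f : L →+* B) {x y : L}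
    (hx : IsIntegral ℤ x) (hy : IsIntegral ℤ y) (hxy : x * y = 1) :
    ∃ m : ℕ, m ≠ 0 ∧ f (x ^ m) ∈ O := by
  classical
  obtain ⟨e, he, heO⟩ : ∃ e : ℤ, e ≠ 0 ∧ ∀ z : 𝓞 L, e • f z ∈ O := by
    obtain ⟨S, hS⟩ : (⊤ : Submodule ℤ (𝓞 L)).FG := Module.Finite.fg_top
    choose g hg0 hg using fun z : 𝓞 L => exists_smul_mem_order hO (f z)
    refine ⟨∏ z ∈ S, g z, Finset.prod_ne_zero_iff.2 fun z _ => hg0 z, fun z => ?_⟩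
    have hz : z ∈ Submodule.span ℤ (S : Set (𝓞 L)) := by rw [hS]; trivial
    induction hz using Submodule.span_induction with
    | mem z hz =>
      rw [← Finset.prod_erase_mul _ _ hz, mul_smul]
      exact zsmul_mem (hg z) _
    | zero => simp
    | add x y _ _ hx hy =>
      have : f ((x + y : 𝓞 L) : L) = f x + f y := by rw [← map_add]; rfl
      rw [this, smul_add]
      exact O.add_mem hx hy
    | smul r x _ hx =>
      have : f ((r • x : 𝓞 L) : L) = r • f x := by rw [← map_zsmul]; simp
      rw [this, smul_comm]
      exact zsmul_mem hx _
  let u : (𝓞 L)ˣ := ⟨⟨x, hx⟩, ⟨y, hy⟩, by ext; exact hxy, by ext; rw [mul_comm] at hxy; exact hxy⟩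
  have he' : (e : 𝓞 L) ≠ 0 := by exact_mod_cast he
  have := finite_quotient_span_singleton he'
  let q := Ideal.Quotient.mk (Ideal.span {(e : 𝓞 L)})
  let U : (𝓞 L ⧸ Ideal.span {(e : 𝓞 L)})ˣ := Units.map q u
  have hU : q ((u : 𝓞 L) ^ orderOf U) = 1 := by
    have := congrArg Units.val (pow_orderOf_eq_one U)
    rw [map_pow]
    exact this
  rw [← map_one q, Ideal.Quotient.eq, Ideal.mem_span_singleton] at hU
  obtain ⟨z, hz⟩ := hU
  refine ⟨orderOf U, (orderOf_pos U).ne', ?_⟩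
  have h1 : x ^ orderOf U = 1 + e * (z : L) := by
    have := congrArg (algebraMap (𝓞 L) L) hz
    simp only [map_sub, map_pow, map_one, map_mul, map_intCast] at this
    rw [← this]
    change _ = 1 + (x ^ _ - 1)
    ring
  rw [h1, map_add, map_one, map_mul, map_intCast, ← zsmul_eq_mul]
  exact O.add_mem O.one_mem (heO z)

/-- A pure quaternion `v` which generates a quadratic field split at the place `φ` gives an element
of norm one and infinite order of a given order. -/
theorem exists_norm_one_mem_order {k B : Type*} [Field k] [NumberField k] [Ring B] [Algebra k B]
    [Algebra (𝓞 k) B] [IsScalarTower (𝓞 k) k B] {O : Subalgebra (𝓞 k) B}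
    (hO : Submodule.span k (O : Set B) = ⊤) {c : k} (hc : ∀ r : k, r ^ 2 ≠ c) {v : B}
    (hv : v * v = algebraMap k B c) (φ : k →+* ℂ) {s : ℂ} (hs : s ^ 2 = φ c)
    (hsplit : ComplexEmbedding.conjugate φ = φ → starRingEnd ℂ s ≠ -s) :
    ∃ α β : k, algebraMap k B α + β • v ∈ O ∧ α ^ 2 - c * β ^ 2 = 1 ∧ 1 < ‖φ α + φ β * s‖ := by
  obtain ⟨x, hx, hx1, hxn⟩ := exists_unit_norm_gt_one hc φ hs hsplit
  have : Fact (∀ r : k, r ^ 2 ≠ c + 0 * r) := ⟨fun r => by simpa using hc r⟩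
  have : FiniteDimensional ℚ (QuadraticAlgebra k c 0) := Module.Finite.trans k _
  have : NumberField (QuadraticAlgebra k c 0) := ⟨⟩
  let f : QuadraticAlgebra k c 0 →ₐ[k] B :=
    QuadraticAlgebra.lift ⟨v, by rw [hv, zero_smul, add_zero, Algebra.algebraMap_eq_smul_one]⟩
  obtain ⟨m, hm, hmO⟩ := exists_pow_mem_order hO f.toRingHom hx
    (hx.map (starRingEnd (QuadraticAlgebra k c 0)).toIntAlgHom) hx1
  refine ⟨(x ^ m).re, (x ^ m).im, ?_, ?_, ?_⟩
  · have : f (x ^ m) = algebraMap k B (x ^ m).re + (x ^ m).im • v := by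
      simp [f, QuadraticAlgebra.lift, Algebra.algebraMap_eq_smul_one]
    rw [← this]
    exact hmO
  · have h1 : x ^ m * star (x ^ m) = 1 := by rw [star_pow, ← mul_pow, hx1, one_pow]
    have h2 := congrArg QuadraticAlgebra.re h1
    simp only [QuadraticAlgebra.re_mul, QuadraticAlgebra.re_star, QuadraticAlgebra.im_star,
      QuadraticAlgebra.re_one] at h2
    linear_combination h2
  · change 1 < ‖quadraticEmbedding φ hs (x ^ m)‖
    rw [map_pow, norm_pow]
    exact one_lt_pow₀ hxn hm

/-- A number field contains non-squares which are positive at a given real place: iterated square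
roots of `2` have bounded conjugates, so that there are only finitely many of them. -/
theorem exists_not_isSquare (k : Type*) [Field k] [NumberField k] (φ : k →+* ℂ) :
    ∃ c : k, (∀ r : k, r ^ 2 ≠ c) ∧ ∃ s : ℝ, (s : ℂ) ^ 2 = φ c := by
  let S : Set k := {x | (IsIntegral ℤ x ∧ ∀ σ : k →+* ℂ, ‖σ x‖ ≤ 2) ∧ ∃ r : ℝ, 1 < r ∧ φ x = r}
  have hS : S.Finite := (Embeddings.finite_of_norm_le k ℂ 2).subset fun x hx => hx.1
  have h2 : (2 : k) ∈ S := by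
    refine ⟨⟨?_, fun σ => by rw [map_ofNat]; simp⟩, 2, by norm_num, by rw [map_ofNat]; simp⟩
    simpa using isIntegral_algebraMap (R := ℤ) (A := k) (x := 2)
  obtain ⟨c, ⟨⟨hcint, hcb⟩, r, hr, hrc⟩, hmin⟩ := hS.exists_minimalFor (fun x => ‖φ x‖) _ ⟨2, h2⟩
  refine ⟨c, ?_, Real.sqrt r, ?_⟩
  · intro y hy
    have key : ∀ y : k, y ^ 2 = c → ∀ ρ : ℝ, 0 ≤ ρ → φ y = ρ → False := by
      intro y hy ρ hρ0 hρ
      have h1 : ρ ^ 2 = r := by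
        have : (ρ : ℂ) ^ 2 = r := by rw [← hρ, ← map_pow, hy, hrc]
        exact_mod_cast this
      have h3 : 1 < ρ := by nlinarith
      have hyS : y ∈ S := by
        refine ⟨⟨IsIntegral.of_pow two_pos (by rwa [hy]), fun σ => ?_⟩, ρ, h3, hρ⟩
        have := hcb σ
        rw [← hy, map_pow, norm_pow] at this
        nlinarith [norm_nonneg (σ y)]
      have h4 : ‖φ y‖ = ρ := by rw [hρ, Complex.norm_real, Real.norm_of_nonneg hρ0]
      have h5 : ‖φ c‖ = r := by rw [hrc, Complex.norm_real, Real.norm_of_nonneg (by linarith)]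
      have h6 : ‖φ c‖ ≤ ‖φ y‖ := hmin hyS (by change ‖φ y‖ ≤ ‖φ c‖; rw [h4, h5]; nlinarith)
      rw [h4, h5] at h6
      nlinarith
    have h1 : (φ y) ^ 2 = ((Real.sqrt r : ℝ) : ℂ) ^ 2 := by
      rw [← map_pow, hy, hrc, ← Complex.ofReal_pow, Real.sq_sqrt (by linarith)]
    rcases sq_eq_sq_iff_eq_or_eq_neg.1 h1 with h | h
    · exact key y hy _ (Real.sqrt_nonneg _) h
    · exact key (-y) (by rw [neg_sq, hy]) _ (Real.sqrt_nonneg _) (by rw [map_neg, h, neg_neg])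
  · rw [hrc, ← Complex.ofReal_pow, Real.sq_sqrt (by linarith)]

end Units

/-! ### Conjugation of 2 × 2 matrices -/

section Adjoint

open Matrix

/-- The adjoint action `x ↦ g x g⁻¹` of `SL(2, ℂ)` on matrices. -/
noncomputable def conjSL : SL(2, ℂ) →* Module.End ℂ (Matrix (Fin 2) (Fin 2) ℂ) where
  toFun g := LinearMap.mulLeft ℂ (g : Matrix (Fin 2) (Fin 2) ℂ) *
    LinearMap.mulRight ℂ ((g⁻¹ : SL(2, ℂ)) : Matrix (Fin 2) (Fin 2) ℂ)
  map_one' := by ext1 x; simp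
  map_mul' g h := by
    ext1 x
    simp only [Module.End.mul_apply, LinearMap.mulLeft_apply, LinearMap.mulRight_apply, _root_.mul_inv_rev,
      Matrix.SpecialLinearGroup.coe_mul, mul_assoc]

theorem conjSL_apply (g : SL(2, ℂ)) (x : Matrix (Fin 2) (Fin 2) ℂ) :
    conjSL g x = (g : Matrix (Fin 2) (Fin 2) ℂ) * x * ((g⁻¹ : SL(2, ℂ)) : Matrix (Fin 2) (Fin 2) ℂ) :=
  (mul_assoc _ _ _).symm

theorem conjSL_eq_one_iff {g : SL(2, ℂ)} : conjSL g = 1 ↔ g ∈ Subgroup.center SL(2, ℂ) := by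
  constructor
  · intro h
    rw [Subgroup.mem_center_iff]
    intro x
    apply Subtype.ext
    have := congrArg (fun f => f (x : Matrix (Fin 2) (Fin 2) ℂ)) h
    simp only [conjSL_apply, Module.End.one_apply] at this
    rw [Matrix.SpecialLinearGroup.coe_mul, Matrix.SpecialLinearGroup.coe_mul]
    nth_rewrite 1 [← this]
    rw [mul_assoc, ← Matrix.SpecialLinearGroup.coe_mul g⁻¹ g, inv_mul_cancel,
      Matrix.SpecialLinearGroup.coe_one, mul_one]
  · intro h
    obtain ⟨r, hr, hg⟩ := Matrix.SpecialLinearGroup.mem_center_iff.1 h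
    ext1 x
    rw [conjSL_apply, ← hg, Matrix.scalar_apply, ← Matrix.smul_one_eq_diagonal, smul_mul_assoc,
      one_mul, smul_mul_assoc, ← mul_smul_comm]
    have : r • ((g⁻¹ : SL(2, ℂ)) : Matrix (Fin 2) (Fin 2) ℂ) = 1 := by
      have h1 : (g : Matrix (Fin 2) (Fin 2) ℂ) = r • 1 := by
        rw [← hg, Matrix.scalar_apply, ← Matrix.smul_one_eq_diagonal]
      rw [← one_mul ((g⁻¹ : SL(2, ℂ)) : Matrix (Fin 2) (Fin 2) ℂ), ← smul_mul_assoc, ← h1,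
        ← Matrix.SpecialLinearGroup.coe_mul, mul_inv_cancel, Matrix.SpecialLinearGroup.coe_one]
    rw [this, mul_one, Module.End.one_apply]

/-- The adjoint representation of `PSL(2, ℂ)`. -/
noncomputable def adjointRep : PSL(2, ℂ) →* Module.End ℂ (Matrix (Fin 2) (Fin 2) ℂ) :=
  QuotientGroup.lift _ conjSL fun _ hg => conjSL_eq_one_iff.2 hg

theorem adjointRep_mk (g : SL(2, ℂ)) :
    adjointRep (QuotientGroup.mk' (Subgroup.center SL(2, ℂ)) g) = conjSL g := rfl

theorem adjointRep_injective : Function.Injective adjointRep := by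
  rw [injective_iff_map_eq_one]
  intro p hp
  obtain ⟨g, rfl⟩ := QuotientGroup.mk'_surjective _ p
  rw [adjointRep_mk, conjSL_eq_one_iff] at hp
  exact (QuotientGroup.eq_one_iff g).2 hp

theorem commute_add_conj {R : Type*} [CommRing R] (A x : Matrix (Fin 2) (Fin 2) R) :
    Commute A (A * x * A.adjugate + A.adjugate * x * A - (A.trace ^ 2 - 2 * A.det) • x) := by
  change _ * _ = _ * _
  rw [A.eta_fin_two, x.eta_fin_two]
  simp only [adjugate_fin_two_of, trace_fin_two_of, det_fin_two_of, Matrix.mul_fin_two,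
    Matrix.smul_of, Matrix.of_add_of, Matrix.of_sub_of]
  ext i j
  fin_cases i <;> fin_cases j <;>
  · simp [Matrix.mul_apply, Fin.sum_univ_two]
    ring

/-- If `g` has eigenvalues `λ` and `λ⁻¹`, then `conjSL g` has eigenvalues `1`, `λ²` and `λ⁻²`. -/
theorem conjSL_cubic (g : SL(2, ℂ)) {t : ℂ} (ht : t = (g : Matrix (Fin 2) (Fin 2) ℂ).trace ^ 2 - 2) :
    (conjSL g - 1) * (conjSL g ^ 2 - t • conjSL g + 1) = 0 := by
  ext1 x
  set A : Matrix (Fin 2) (Fin 2) ℂ := g.1 with hA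
  set A' : Matrix (Fin 2) (Fin 2) ℂ := ((g⁻¹ : SL(2, ℂ)) : Matrix (Fin 2) (Fin 2) ℂ) with hA'
  have hAA' : A * A' = 1 := by
    rw [hA, hA', ← Matrix.SpecialLinearGroup.coe_mul, mul_inv_cancel, Matrix.SpecialLinearGroup.coe_one]
  have hdet : A 0 0 * A 1 1 - A 0 1 * A 1 0 = 1 := by rw [← det_fin_two, hA, g.det_coe]
  have hadj : A' = A.adjugate := by rw [hA', Matrix.SpecialLinearGroup.coe_inv]
  let y := A * x * A' + A' * x * A - t • x
  have hy : A * y = y * A := by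
    have := (commute_add_conj A x).eq
    rwa [det_fin_two, hdet, mul_one, ← ht, ← hadj] at this
  have hy' : A * y * A' = y := by rw [hy, mul_assoc, hAA', mul_one]
  have h : (conjSL g ^ 2 - t • conjSL g + 1 : Module.End ℂ _) x = y := by
    have : (conjSL g ^ 2 - t • conjSL g + 1 : Module.End ℂ _) x = A * y * A' := by
      have hA'A : A' * A = 1 := by
        rw [hA, hA', ← Matrix.SpecialLinearGroup.coe_mul, inv_mul_cancel, Matrix.SpecialLinearGroup.coe_one]
      simp only [y, LinearMap.add_apply, LinearMap.sub_apply, LinearMap.smul_apply, sq,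
        Module.End.mul_apply, conjSL_apply, Module.End.one_apply, mul_add, add_mul, mul_sub, sub_mul,
        mul_smul_comm, smul_mul_assoc, ← hA, ← hA']
      have h3 : A * (A' * x * A) * A' = x := by
        rw [mul_assoc A' x A, ← mul_assoc A A', hAA', one_mul, mul_assoc, hAA', mul_one]
      rw [h3]
      abel
    rw [this, hy']
  rw [Module.End.mul_apply, h, LinearMap.sub_apply, conjSL_apply, Module.End.one_apply, hy', sub_self,
    LinearMap.zero_apply]

/-- A lattice in the space of matrices which is stable under a group `G` is a faithful
representation of `G`. -/
theorem exists_lattice_rep {R : Type*} [CommRing R] [Algebra R ℂ]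
    {A : Submodule R (Matrix (Fin 2) (Fin 2) ℂ)} (hspan : Submodule.span ℂ (A : Set (Matrix (Fin 2) (Fin 2) ℂ)) = ⊤)
    {G : Subgroup PSL(2, ℂ)} (hG : ∀ g ∈ G, ∀ x ∈ A, adjointRep g x ∈ A) :
    ∃ ρ : G →* Module.End R A, Function.Injective ρ ∧
      ∀ (g : G) (x : A), ((ρ g x : A) : Matrix (Fin 2) (Fin 2) ℂ) = adjointRep g x := by
  refine ⟨{ toFun := fun g => ((adjointRep g).restrictScalars R).restrict (hG g g.2)
            map_one' := ?_
            map_mul' := ?_ }, ?_, ?_⟩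
  · ext1 x
    apply Subtype.ext
    simp
  · intro g h
    ext1 x
    apply Subtype.ext
    change adjointRep (g * h : PSL(2, ℂ)) (x : Matrix (Fin 2) (Fin 2) ℂ)
      = adjointRep g (adjointRep h (x : Matrix (Fin 2) (Fin 2) ℂ))
    rw [map_mul, Module.End.mul_apply]
  · rw [injective_iff_map_eq_one]
    intro g hg
    apply Subtype.ext
    apply adjointRep_injective
    rw [OneMemClass.coe_one, map_one]
    refine LinearMap.ext_on hspan ?_
    intro x hx
    exact congrArg (fun f : Module.End R A => ((f ⟨x, hx⟩ : A) : Matrix (Fin 2) (Fin 2) ℂ)) hg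
  · intro g x
    rfl

theorem eq_or_eq_neg_of_mk_eq {F : Type*} [Field F] {g h : SL(2, F)}
    (hgh : QuotientGroup.mk' (Subgroup.center SL(2, F)) g =
      QuotientGroup.mk' (Subgroup.center SL(2, F)) h) :
    (g : Matrix (Fin 2) (Fin 2) F) = h ∨ (g : Matrix (Fin 2) (Fin 2) F) = -h := by
  obtain ⟨z, hz, rfl⟩ := (QuotientGroup.mk'_eq_mk' _).1 hgh
  obtain ⟨r, hr, hz⟩ := Matrix.SpecialLinearGroup.mem_center_iff.1 hz
  have hz' : (z : Matrix (Fin 2) (Fin 2) F) = r • 1 := by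
    rw [← hz, Matrix.scalar_apply, ← Matrix.smul_one_eq_diagonal]
  rw [Matrix.SpecialLinearGroup.coe_mul, hz', mul_smul_comm, mul_one]
  rcases sq_eq_sq_iff_eq_or_eq_neg.1 (show r ^ 2 = 1 ^ 2 by simpa using hr) with rfl | rfl
  · left; simp
  · right; simp

theorem trace_pow_SL {g : SL(2, ℂ)} {l : ℂ} (hl : l ≠ 0)
    (htr : (g : Matrix (Fin 2) (Fin 2) ℂ).trace = l + l⁻¹) (n : ℕ) :
    ((g ^ n : SL(2, ℂ)) : Matrix (Fin 2) (Fin 2) ℂ).trace = l ^ n + l⁻¹ ^ n := by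
  induction n using Nat.twoStepInduction with
  | zero => simp; norm_num
  | one => simpa using htr
  | more n h1 h2 =>
    have hdet : (g : Matrix (Fin 2) (Fin 2) ℂ).det = 1 := g.det_coe
    have hsq : (g : Matrix (Fin 2) (Fin 2) ℂ) ^ 2 = (l + l⁻¹) • (g : Matrix (Fin 2) (Fin 2) ℂ) - 1 := by
      rw [← htr]
      have h : (1 : Matrix (Fin 2) (Fin 2) ℂ) = (g : Matrix (Fin 2) (Fin 2) ℂ).det • 1 := by
        rw [hdet, one_smul]
      rw [h, det_fin_two, trace_fin_two, sq]
      ext i j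
      fin_cases i <;> fin_cases j <;> simp [Matrix.mul_apply, Fin.sum_univ_two] <;> ring
    rw [Matrix.SpecialLinearGroup.coe_pow] at h1 h2 ⊢
    rw [pow_add, hsq, mul_sub, mul_smul_comm, mul_one, ← pow_succ, trace_sub, trace_smul, h1, h2, smul_eq_mul]
    have hi : l * l⁻¹ = 1 := mul_inv_cancel₀ hl
    linear_combination (l ^ n + l⁻¹ ^ n) * hi

end Adjoint

/-! ### Quaternion algebras split at one infinite place -/

section SplitQuaternion

open Matrix NumberField

theorem trace_quaternion {A B : ℂ} (hA : A ≠ 0) (hB : B ≠ 0)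
    (θ : ℍ[ℂ,A,B] ≃ₐ[ℂ] Matrix (Fin 2) (Fin 2) ℂ) (z : ℍ[ℂ,A,B]) : (θ z).trace = 2 * z.re := by
  -- a matrix which anticommutes with a square root of a nonzero scalar has trace zero
  have key : ∀ (x y : ℍ[ℂ,A,B]) (r : ℂ), r ≠ 0 → y * y = algebraMap ℂ _ r → x * y = -(y * x) →
      (θ x).trace = 0 := by
    intro x y r hr hy hxy
    have h1 : (θ (x * y * y)).trace = r * (θ x).trace := by
      rw [mul_assoc, hy, map_mul, AlgEquiv.commutes, ← Algebra.commutes, ← Algebra.smul_def, trace_smul, smul_eq_mul]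
    have h2 : (θ (x * y * y)).trace = - (θ (x * y * y)).trace := by
      conv_lhs => rw [hxy, neg_mul, map_neg, trace_neg, mul_assoc, map_mul, trace_mul_comm, ← map_mul]
    have h3 : (θ (x * y * y)).trace = 0 := self_eq_neg.1 h2
    rw [h1] at h3
    exact (mul_eq_zero.1 h3).resolve_left hr
  have hi := key ⟨0, 1, 0, 0⟩ ⟨0, 0, 1, 0⟩ B hB (by ext <;> simp) (by ext <;> simp)
  have hj := key ⟨0, 0, 1, 0⟩ ⟨0, 1, 0, 0⟩ A hA (by ext <;> simp) (by ext <;> simp)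
  have hk := key ⟨0, 0, 0, 1⟩ ⟨0, 1, 0, 0⟩ A hA (by ext <;> simp) (by ext <;> simp)
  have hz : z = z.re • (1 : ℍ[ℂ,A,B]) + z.imI • ⟨0, 1, 0, 0⟩ + z.imJ • ⟨0, 0, 1, 0⟩ + z.imK • ⟨0, 0, 0, 1⟩ := by
    ext <;> simp
  rw [hz]
  simp only [map_add, map_smul, trace_add, trace_smul, hi, hj, hk, map_one, trace_one]
  simp
  ring

theorem map_star_quaternion {A B : ℂ} (hA : A ≠ 0) (hB : B ≠ 0)
    (θ : ℍ[ℂ,A,B] ≃ₐ[ℂ] Matrix (Fin 2) (Fin 2) ℂ) (z : ℍ[ℂ,A,B]) : θ (star z) = (θ z).adjugate := by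
  have h1 : star z = algebraMap ℂ _ (2 * z.re) - z := by
    rw [QuaternionAlgebra.coe_algebraMap, QuaternionAlgebra.star_eq_two_re_sub]
    simp
  rw [h1, map_sub, AlgEquiv.commutes, ← trace_quaternion hA hB θ, trace_fin_two, adjugate_fin_two]
  ext i j
  fin_cases i <;> fin_cases j <;> simp [Matrix.algebraMap_matrix_apply]

theorem quaternion_star_smul {k : Type*} [CommRing k] {a b : k} (r : k) (x : ℍ[k,a,b]) :
    star (r • x) = r • star x := by
  ext <;> simp

theorem quatBaseChange_star {k F : Type} [Field k] [Field F] (φ : k →+* F) {a b : k} (x : ℍ[k,a,b]) :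
    quatBaseChange φ a b (star x) = star (quatBaseChange φ a b x) := by
  ext <;> simp [quatBaseChange]

theorem quatBaseChange_algebraMap {k F : Type} [Field k] [Field F] (φ : k →+* F) {a b : k} (r : k) :
    quatBaseChange φ a b (algebraMap k _ r) = algebraMap F _ (φ r) := by
  ext <;> simp [quatBaseChange]

variable {k : Type} [Field k] {a b : k} {φ : k →+* ℂ}

/-- Elements of reduced norm one give elements of `SL(2, ℂ)`. -/
theorem exists_SL_of_norm_one (ha : a ≠ 0) (hb : b ≠ 0)
    (θ : ℍ[ℂ,φ a,φ b] ≃ₐ[ℂ] Matrix (Fin 2) (Fin 2) ℂ) {x : ℍ[k,a,b]} (hx : x * star x = 1) :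
    ∃ g : SL(2, ℂ), (g : Matrix (Fin 2) (Fin 2) ℂ) = θ (quatBaseChange φ a b x) := by
  refine ⟨⟨θ (quatBaseChange φ a b x), ?_⟩, rfl⟩
  have h1 := congrArg (fun y => θ (quatBaseChange φ a b y)) hx
  simp only [map_mul, map_one, quatBaseChange_star] at h1
  rw [map_star_quaternion (by simpa using ha) (by simpa using hb), Matrix.mul_adjugate] at h1
  have := congrFun (congrFun h1 0) 0
  simpa using this

/-- The quaternion algebra `(a, b / k)` is split at the place of `φ`, and ramified at all other
infinite places, which are real. -/
structure IsSplitExactlyAt (φ : k →+* ℂ) (a b : k) : Prop where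
  ne_zero_left : a ≠ 0
  ne_zero_right : b ≠ 0
  ramified : ∀ σ : k →+* ℂ, σ ≠ φ → σ ≠ ComplexEmbedding.conjugate φ →
    ∃ σ' : k →+* ℝ, (∀ x, σ x = σ' x) ∧ σ' a < 0 ∧ σ' b < 0
  split : ComplexEmbedding.conjugate φ = φ →
    ∃ φ' : k →+* ℝ, (∀ x, φ x = φ' x) ∧ (0 < φ' a ∨ 0 < φ' b)

/-- `c` has a square root in the completion of `k` at the place of `φ`. -/
def IsSplitAt (φ : k →+* ℂ) (c : k) : Prop :=
  ∃ s : ℂ, s ^ 2 = φ c ∧ (ComplexEmbedding.conjugate φ = φ → starRingEnd ℂ s ≠ -s)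

theorem isSplitAt_of_sq {c : k} (hc : c ≠ 0) {s : ℝ} (hs : (s : ℂ) ^ 2 = φ c) : IsSplitAt φ c := by
  refine ⟨s, hs, fun _ h => ?_⟩
  rw [Complex.conj_ofReal, self_eq_neg] at h
  rw [h] at hs
  exact hc (by simpa using hs.symm)

theorem IsSplitExactlyAt.isSplitAt (h : IsSplitExactlyAt φ a b) : IsSplitAt φ a ∨ IsSplitAt φ b := by
  by_cases hφ : ComplexEmbedding.conjugate φ = φ
  · obtain ⟨φ', hφ', hab⟩ := h.split hφ
    have key : ∀ c : k, 0 < φ' c → IsSplitAt φ c := by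
      intro c hc
      refine isSplitAt_of_sq (s := Real.sqrt (φ' c)) (by rintro rfl; simp at hc) ?_
      rw [hφ', ← Complex.ofReal_pow, Real.sq_sqrt hc.le]
    exact hab.imp (key a) (key b)
  · left
    obtain ⟨s, hs⟩ := IsSquare.exists_sq (φ a) (IsAlgClosed.exists_pow_nat_eq (φ a) two_pos |>.imp fun s hs => by rw [← hs, sq])
    exact ⟨s, hs.symm, fun h => absurd h hφ⟩

/-- The quaternion algebra contains a quadratic field which is split at `φ`. -/
theorem IsSplitExactlyAt.exists_anticommuting [NumberField k] (h : IsSplitExactlyAt φ a b) :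
    ∃ (I J : ℍ[k,a,b]) (c d : k), (∀ r : k, r ^ 2 ≠ c) ∧ IsSplitAt φ c ∧ d ≠ 0 ∧ d ≠ 1 ∧
      I * I = algebraMap k _ c ∧ J * J = algebraMap k _ d ∧ J * I = -(I * J) ∧ star I = -I ∧ star J = -J := by
  -- after replacing `J` by `2 J` we may assume `d ≠ 1`
  suffices h : ∃ (I J : ℍ[k,a,b]) (c d : k), (∀ r : k, r ^ 2 ≠ c) ∧ IsSplitAt φ c ∧ d ≠ 0 ∧
      I * I = algebraMap k _ c ∧ J * J = algebraMap k _ d ∧ J * I = -(I * J) ∧ star I = -I ∧ star J = -J by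
    obtain ⟨I, J, c, d, hc, hs, hd, hI, hJ, hIJ, hsI, hsJ⟩ := h
    by_cases hd1 : d = 1
    · refine ⟨I, (2 : k) • J, c, 4 * d, hc, hs, by simpa using hd, ?_, hI, ?_, ?_, hsI, ?_⟩
      · rw [hd1]
        norm_num
      · rw [smul_mul_smul_comm, hJ, map_mul, Algebra.smul_def]
        norm_num
      · rw [smul_mul_assoc, hIJ, mul_smul_comm, smul_neg]
      · rw [quaternion_star_smul, hsJ, smul_neg]
    · exact ⟨I, J, c, d, hc, hs, hd, hd1, hI, hJ, hIJ, hsI, hsJ⟩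
  have ha := h.ne_zero_left
  have hb := h.ne_zero_right
  obtain ⟨t, ht, s, hs⟩ := exists_not_isSquare k φ
  have hts : IsSplitAt φ t := isSplitAt_of_sq (by rintro rfl; exact ht 0 (by simp)) hs
  rcases h.isSplitAt with hsa | hsb
  · by_cases hsq : ∀ r : k, r ^ 2 ≠ a
    · exact ⟨⟨0, 1, 0, 0⟩, ⟨0, 0, 1, 0⟩, a, b, hsq, hsa, hb, by ext <;> simp, by ext <;> simp,
        by ext <;> simp, by ext <;> simp, by ext <;> simp⟩
    · push Not at hsq
      obtain ⟨r, hr⟩ := hsq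
      have hr0 : r ≠ 0 := by rintro rfl; exact ha (by simpa using hr.symm)
      -- `I = q j + p ij` has square `b (q - r p) (q + r p) = t`
      refine ⟨⟨0, 0, (1 + t / b) / 2, (1 - t / b) / (2 * r)⟩, ⟨0, 1, 0, 0⟩, t, a, ht, hts, ha, ?_,
        by ext <;> simp, ?_, by ext <;> simp, by ext <;> simp⟩
      · rw [QuaternionAlgebra.mk_mul_mk]
        ext <;> simp [← hr]
        all_goals field_simp
        all_goals ring
      · ext <;> simp
  · by_cases hsq : ∀ r : k, r ^ 2 ≠ b
    · exact ⟨⟨0, 0, 1, 0⟩, ⟨0, 1, 0, 0⟩, b, a, hsq, hsb, ha, by ext <;> simp, by ext <;> simp,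
        by ext <;> simp, by ext <;> simp, by ext <;> simp⟩
    · push Not at hsq
      obtain ⟨r, hr⟩ := hsq
      have hr0 : r ≠ 0 := by rintro rfl; exact hb (by simpa using hr.symm)
      refine ⟨⟨0, (1 + t / a) / 2, 0, (1 - t / a) / (2 * r)⟩, ⟨0, 0, 1, 0⟩, t, b, ht, hts, hb, ?_,
        by ext <;> simp, ?_, by ext <;> simp, by ext <;> simp⟩
      · rw [QuaternionAlgebra.mk_mul_mk]
        ext <;> simp [← hr]
        all_goals field_simp
        all_goals ring
      · ext <;> simp

theorem span_one_anticommuting_eq_top {I J : ℍ[k,a,b]} {c d : k} (hc : ∀ r : k, r ^ 2 ≠ c)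
    (h2 : (2 : k) ≠ 0) (hd : d ≠ 0) (hI : I * I = algebraMap k _ c) (hJ : J * J = algebraMap k _ d)
    (hIJ : J * I = -(I * J)) : Submodule.span k {1, I, J, I * J} = ⊤ := by
  have hc0 : c ≠ 0 := by rintro rfl; exact hc 0 (by simp)
  have hinj : Function.Injective (algebraMap k ℍ[k,a,b]) := QuaternionAlgebra.algebraMap_injective
  have key : ∀ z w : k, z • (1 : ℍ[k,a,b]) + w • I = 0 → z = 0 ∧ w = 0 := by
    intro z w h
    have h1 : (z • (1 : ℍ[k,a,b]) + w • I) * (z • (1 : ℍ[k,a,b]) - w • I)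
        = algebraMap k _ (z ^ 2 - c * w ^ 2) := by
      simp only [add_mul, mul_sub, smul_mul_smul_comm, hI, mul_one, one_mul,
        Algebra.algebraMap_eq_smul_one, smul_smul, sub_smul, mul_comm w z, sq, mul_comm c]
      abel
    rw [h, zero_mul, ← map_zero (algebraMap k ℍ[k,a,b])] at h1
    have h3 := hinj h1
    have hw : w = 0 := by
      by_contra hw
      refine hc (z / w) ?_
      field_simp
      linear_combination -h3
    rw [hw] at h3
    exact ⟨by simpa using h3.symm, hw⟩
  have hli : LinearIndependent k ![1, I, J, I * J] := by
    rw [Fintype.linearIndependent_iff]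
    intro g hg
    simp only [Fin.sum_univ_four, Matrix.cons_val] at hg
    have h1 : I * (g 0 • (1 : ℍ[k,a,b]) + g 1 • I + g 2 • J + g 3 • (I * J)) * I
        = c • (g 0 • (1 : ℍ[k,a,b]) + g 1 • I - g 2 • J - g 3 • (I * J)) := by
      have e1 : I * J * I = - (c • J) := by
        rw [mul_assoc, hIJ, mul_neg, ← mul_assoc, hI, Algebra.smul_def]
      have e2 : I * (I * J) * I = - (c • (I * J)) := by
        rw [mul_assoc, e1, mul_neg, mul_smul_comm]
      have e3 : I * I * I = c • I := by rw [hI, Algebra.smul_def]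
      have e4 : I * 1 * I = c • (1 : ℍ[k,a,b]) := by
        rw [mul_one, hI, Algebra.algebraMap_eq_smul_one]
      simp only [mul_add, add_mul, mul_smul_comm, smul_mul_assoc, e1, e2, e3, e4, smul_add, smul_sub,
        smul_neg, smul_comm c]
      abel
    rw [hg, mul_zero, zero_mul] at h1
    have h3 := (smul_eq_zero.1 h1.symm).resolve_left hc0
    have h4 : (2 : k) • (g 0 • (1 : ℍ[k,a,b]) + g 1 • I) = 0 := by
      have := congrArg₂ (· + ·) hg h3
      simp only [add_zero] at this
      rw [← this, two_smul]
      abel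
    have h5 := (smul_eq_zero.1 h4).resolve_left h2
    have h6 : (g 2 • (1 : ℍ[k,a,b]) + g 3 • I) * J = 0 := by
      rw [h5, zero_add] at hg
      rw [add_mul, smul_mul_assoc, one_mul, smul_mul_assoc, hg]
    have h7 : g 2 • (1 : ℍ[k,a,b]) + g 3 • I = 0 := by
      have := congrArg (· * J) h6
      simp only [mul_assoc, hJ, zero_mul] at this
      rw [← Algebra.commutes, ← Algebra.smul_def] at this
      exact (smul_eq_zero.1 this).resolve_left hd
    obtain ⟨h80, h81⟩ := key _ _ h5
    obtain ⟨h82, h83⟩ := key _ _ h7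
    intro i
    fin_cases i <;> assumption
  have := hli.span_eq_top_of_card_eq_finrank (by
    rw [QuaternionAlgebra.finrank_eq_four, Fintype.card_fin])
  rw [← this]
  congr 1
  ext x
  simp only [Set.mem_insert_iff, Set.mem_singleton_iff, Set.mem_range, Fin.exists_fin_succ,
    Matrix.cons_val, eq_comm (a := x)]
  simp

/-- A norm one element of infinite order stays outside `k` under taking powers. -/
theorem exists_pow_eq_add_smul {v : ℍ[k,a,b]} {c : k} (hv : v * v = algebraMap k _ c) {s : ℂ}
    (hs : s ^ 2 = φ c) {α β : k} (h1 : α ^ 2 - c * β ^ 2 = 1) (hn : 1 < ‖φ α + φ β * s‖) {D : ℕ}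
    (hD : D ≠ 0) : ∃ α' β' : k, β' ≠ 0 ∧
      (algebraMap k ℍ[k,a,b] α + β • v) ^ D = algebraMap k ℍ[k,a,b] α' + β' • v := by
  have key : ∀ n : ℕ, ∃ α' β' : k, (algebraMap k ℍ[k,a,b] α + β • v) ^ n = algebraMap k ℍ[k,a,b] α' + β' • v
      ∧ α' ^ 2 - c * β' ^ 2 = 1 ∧ φ α' + φ β' * s = (φ α + φ β * s) ^ n := by
    intro n
    induction n with
    | zero => exact ⟨1, 0, by simp⟩
    | succ n ih =>
      obtain ⟨α', β', e1, e2, e3⟩ := ih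
      refine ⟨α' * α + c * β' * β, α' * β + β' * α, ?_, ?_, ?_⟩
      · rw [pow_succ, e1]
        simp only [add_mul, mul_add, smul_mul_smul_comm, hv, Algebra.algebraMap_eq_smul_one, smul_smul,
          one_mul, mul_one, add_smul]
        rw [mul_comm (β' * β) c, mul_assoc]
        abel
      · linear_combination (α ^ 2 - c * β ^ 2) * e2 + h1
      · rw [pow_succ, ← e3]
        simp only [map_add, map_mul]
        linear_combination (-φ β' * φ β) * hs
  obtain ⟨α', β', e1, e2, e3⟩ := key D
  refine ⟨α', β', ?_, e1⟩
  rintro rfl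
  have h4 : ‖φ α'‖ = 1 := by
    have : ‖φ α'‖ ^ 2 = 1 := by
      rw [← norm_pow, ← map_pow, show α' ^ 2 = 1 by simpa using e2, map_one, norm_one]
    exact (pow_eq_one_iff_of_nonneg (norm_nonneg _) two_ne_zero).1 this
  have h5 := one_lt_pow₀ hn hD
  rw [← norm_pow, ← e3] at h5
  simp [h4] at h5

/-- A subgroup of finite index in the group of elements of norm one of an order spans the quaternion
algebra. -/
theorem span_eq_top_of_pow_mem [NumberField k] (h : IsSplitExactlyAt φ a b)
    {O : Subalgebra (𝓞 k) ℍ[k,a,b]} (hO : Submodule.span k (O : Set ℍ[k,a,b]) = ⊤)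
    (H : Submonoid ℍ[k,a,b]) (hH : ∀ x ∈ O, x * star x = 1 → ∃ D : ℕ, D ≠ 0 ∧ x ^ D ∈ H) :
    Submodule.span k (H : Set ℍ[k,a,b]) = ⊤ := by
  obtain ⟨I, J, c, d, hc, ⟨s, hs, hsplit⟩, hd, hd1, hI, hJ, hIJ, hsI, hsJ⟩ := h.exists_anticommuting
  let S := Algebra.adjoin k (H : Set ℍ[k,a,b])
  have hS : Subalgebra.toSubmodule S = Submodule.span k (H : Set ℍ[k,a,b]) := by
    rw [Algebra.adjoin_eq_span, Submonoid.closure_eq]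
  have key : ∀ (v : ℍ[k,a,b]) (e : k) (s : ℂ), (∀ r : k, r ^ 2 ≠ e) → v * v = algebraMap k _ e →
      s ^ 2 = φ e → (ComplexEmbedding.conjugate φ = φ → starRingEnd ℂ s ≠ -s) → star v = -v →
      v ∈ S := by
    intro v e s he hv hs hsplit hsv
    obtain ⟨α, β, hx, hx1, hxn⟩ := exists_norm_one_mem_order hO he hv φ hs hsplit
    obtain ⟨D, hD, hDH⟩ := hH _ hx (by
      rw [star_add, quaternion_star_smul, hsv, QuaternionAlgebra.coe_algebraMap, QuaternionAlgebra.star_coe,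
        ← QuaternionAlgebra.coe_algebraMap, ← map_one (algebraMap k ℍ[k,a,b]), ← hx1]
      have e1 : (α • (1 : ℍ[k,a,b]) + β • v) * (α • 1 + β • -v) = (α * α) • 1 - (β * β) • (v * v) := by
        simp only [add_mul, mul_add, smul_mul_smul_comm, one_mul, mul_one, mul_neg, smul_neg]
        module
      rw [Algebra.algebraMap_eq_smul_one, e1, hv, Algebra.algebraMap_eq_smul_one,
        Algebra.algebraMap_eq_smul_one]
      module)
    obtain ⟨α', β', hβ, hpow⟩ := exists_pow_eq_add_smul hv hs hx1 hxn hD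
    have hmem : (algebraMap k ℍ[k,a,b] α' + β' • v) ∈ S := by
      rw [← hpow]
      exact Algebra.subset_adjoin hDH
    have h1 := S.sub_mem hmem (S.algebraMap_mem α')
    rw [add_sub_cancel_left] at h1
    have h2 := S.smul_mem h1 β'⁻¹
    rwa [smul_smul, inv_mul_cancel₀ hβ, one_smul] at h2
  have hIS : I ∈ S := key I c s hc hI hs hsplit hsI
  -- the conjugate of `I` by `1 + J`, up to a scalar
  have hvS : (1 + d) • I + (2 : k) • (J * I) ∈ S := by
    have hd1' : 1 - d ≠ 0 := sub_ne_zero.2 hd1.symm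
    refine key _ (c * (1 - d) ^ 2) (s * φ (1 - d)) ?_ ?_ ?_ ?_ ?_
    · intro r hr
      refine hc (r / (1 - d)) ?_
      rw [div_pow, hr]
      field_simp
    · have e1 : I * (J * I) = -(c • J) := by rw [hIJ, mul_neg, ← mul_assoc, hI, Algebra.smul_def]
      have e2 : J * I * I = c • J := by rw [mul_assoc, hI, ← Algebra.commutes, Algebra.smul_def]
      have e3 : J * I * (J * I) = -((c * d) • 1) := by
        rw [mul_assoc, e1, mul_neg, mul_smul_comm, hJ, Algebra.algebraMap_eq_smul_one, smul_smul]
      rw [add_mul, mul_add, mul_add]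
      simp only [smul_mul_smul_comm, e1, e2, e3, hI, Algebra.algebraMap_eq_smul_one]
      module
    · rw [mul_pow, hs, map_mul, map_pow]
    · intro hφ h0
      have h1 : starRingEnd ℂ (φ (1 - d)) = φ (1 - d) := by
        conv_rhs => rw [← hφ]
        rfl
      rw [map_mul, h1, ← neg_mul] at h0
      exact hsplit hφ (mul_right_cancel₀ ((map_ne_zero φ).2 hd1') h0)
    · rw [star_add, quaternion_star_smul, quaternion_star_smul, star_mul, hsI, hsJ, neg_mul_neg, hIJ]
      module
  have hJIS : J * I ∈ S := by
    have h1 := S.sub_mem hvS (S.smul_mem hIS (1 + d))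
    rw [add_sub_cancel_left] at h1
    have h2 := S.smul_mem h1 (2 : k)⁻¹
    rwa [smul_smul, inv_mul_cancel₀ two_ne_zero, one_smul] at h2
  have hJS : J ∈ S := by
    have hc0 : c ≠ 0 := by rintro rfl; exact hc 0 (by simp)
    have h1 := S.smul_mem (S.mul_mem hJIS hIS) c⁻¹
    rwa [mul_assoc, hI, ← Algebra.commutes, ← Algebra.smul_def, smul_smul, inv_mul_cancel₀ hc0, one_smul] at h1
  rw [← hS, eq_top_iff, ← span_one_anticommuting_eq_top hc two_ne_zero hd hI hJ hIJ, Submodule.span_le]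
  rintro x (rfl | rfl | rfl | rfl)
  · exact S.one_mem
  · exact hIS
  · exact hJS
  · exact S.mul_mem hIS hJS

end SplitQuaternion

/-! ### Arithmetic groups in `PSL(2, ℂ)` -/

section ArithmeticGroups

open Matrix NumberField

/-- Commensurable groups `G`, `N` have a common subgroup of finite index which is normal in `G`. -/
theorem exists_common_subgroup_of_commensurable {P : Type*} [Group P] {G N : Subgroup P}
    (h : Subgroup.Commensurable G N) :
    ∃ G₀ : Subgroup P, G₀ ≤ G ∧ G₀ ≤ N ∧ (∀ γ ∈ G, ∀ g ∈ G₀, γ * g * γ⁻¹ ∈ G₀) ∧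
      G₀.relIndex G ≠ 0 ∧ (∃ D : ℕ, D ≠ 0 ∧ ∀ g ∈ G, g ^ D ∈ G₀) ∧
      ∀ g ∈ N, ∃ D : ℕ, D ≠ 0 ∧ g ^ D ∈ G₀ := by
  let K : Subgroup G := (N.subgroupOf G).normalCore
  have : (N.subgroupOf G).FiniteIndex := ⟨h.2⟩
  have hK : K.index ≠ 0 := Subgroup.FiniteIndex.index_ne_zero
  have hKmem : ∀ (g : P) (hg : g ∈ G), g ∈ K.map G.subtype ↔ (⟨g, hg⟩ : G) ∈ K := by
    intro g hg
    simp [hg]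
  have hD : ∀ g ∈ G, g ^ K.index ∈ K.map G.subtype := by
    intro g hg
    rw [hKmem _ (G.pow_mem hg _)]
    exact K.pow_index_mem ⟨g, hg⟩
  refine ⟨K.map G.subtype, Subgroup.map_subtype_le K, ?_, ?_, ?_, ⟨K.index, hK, hD⟩, ?_⟩
  · rintro _ ⟨g, hg, rfl⟩
    have : g ∈ N.subgroupOf G := Subgroup.normalCore_le _ hg
    exact this
  · rintro γ hγ _ ⟨g, hg, rfl⟩
    exact ⟨⟨γ, hγ⟩ * g * ⟨γ, hγ⟩⁻¹, Subgroup.Normal.conj_mem inferInstance g hg _, rfl⟩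
  · have : (K.map G.subtype).subgroupOf G = K := Subgroup.comap_map_eq_self_of_injective G.subtype_injective K
    rw [Subgroup.relIndex, this]
    exact hK
  · intro g hg
    obtain ⟨n, hn0, hn, hgn⟩ := Subgroup.exists_pow_mem_of_relIndex_ne_zero h.1 hg
    refine ⟨n * K.index, mul_ne_zero (by omega) hK, ?_⟩
    rw [pow_mul]
    exact hD _ hgn.1

theorem exists_norm_eq_one_add_inv {r : ℝ} (hr : |r| ≤ 2) : ∃ η : ℂ, ‖η‖ = 1 ∧ (r : ℂ) = η + η⁻¹ := by
  obtain ⟨h1, h2⟩ := abs_le.1 hr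
  refine ⟨Complex.exp (Real.arccos (r / 2) * Complex.I), Complex.norm_exp_ofReal_mul_I _, ?_⟩
  rw [← Complex.exp_neg, ← neg_mul, ← Complex.two_cos, ← Complex.ofReal_cos,
    Real.cos_arccos (by linarith) (by linarith)]
  push_cast
  ring

theorem eq_or_eq_inv_of_add_inv_eq {x y : ℂ} (hx : x ≠ 0) (hy : y ≠ 0) (h : x + x⁻¹ = y + y⁻¹) :
    x = y ∨ x = y⁻¹ := by
  have h1 : (x - y) * (x * y - 1) = 0 := by
    field_simp at h
    linear_combination h
  rcases mul_eq_zero.1 h1 with h2 | h2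
  · exact Or.inl (sub_eq_zero.1 h2)
  · exact Or.inr (eq_inv_of_mul_eq_one_left (sub_eq_zero.1 h2))

theorem isIntegral_of_add_inv {x : ℂ} (hx : x ≠ 0) (h : IsIntegral ℤ (x + x⁻¹)) : IsIntegral ℤ x := by
  have h1 : IsIntegral (integralClosure ℤ ℂ) x := by
    let y : integralClosure ℤ ℂ := ⟨x + x⁻¹, h⟩
    refine ⟨Polynomial.X ^ 2 - Polynomial.C y * Polynomial.X + 1, by monicity!, ?_⟩
    have : algebraMap (integralClosure ℤ ℂ) ℂ y = x + x⁻¹ := rfl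
    simp [this]
    field_simp
    ring
  exact isIntegral_trans x h1

variable {k : Type} [Field k] [NumberField k] {a b : k} {φ : k →+* ℂ}

theorem IsQuatOrder.isIntegral_two_re {O : Subalgebra (𝓞 k) ℍ[k,a,b]} (hO : IsQuatOrder O)
    {x : ℍ[k,a,b]} (hx : x ∈ O) : IsIntegral ℤ (2 * x.re) := by
  have h1 : IsIntegral (𝓞 k) (algebraMap k ℍ[k,a,b] (2 * x.re)) := by
    have : algebraMap k ℍ[k,a,b] (2 * x.re) = x + star x := by
      rw [QuaternionAlgebra.coe_algebraMap, QuaternionAlgebra.self_add_star']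
      simp
    rw [this]
    exact .of_mem_of_fg O hO.fg _ (O.add_mem hx (hO.star_mem hx))
  have h2 : IsIntegral (𝓞 k) (2 * x.re) :=
    (isIntegral_algebraMap_iff QuaternionAlgebra.algebraMap_injective).1 h1
  exact isIntegral_trans _ h2

/-- Traces of elements of norm one are bounded at the ramified real places. -/
theorem abs_two_re_le {σ : k →+* ℝ} (ha : σ a < 0) (hb : σ b < 0) {x : ℍ[k,a,b]}
    (hx : x * star x = 1) : |σ (2 * x.re)| ≤ 2 := by
  have h1 := congrArg (fun y => σ y.re) hx
  simp only [QuaternionAlgebra.re_mul, QuaternionAlgebra.re_star, QuaternionAlgebra.imI_star,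
    QuaternionAlgebra.imJ_star, QuaternionAlgebra.imK_star, QuaternionAlgebra.re_one, map_add, map_sub,
    map_mul, map_neg, map_one, map_zero] at h1
  have h2 : σ x.re ^ 2 ≤ 1 := by
    nlinarith [mul_nonneg (neg_nonneg.2 ha.le) (sq_nonneg (σ x.imI)),
      mul_nonneg (neg_nonneg.2 hb.le) (sq_nonneg (σ x.imJ)),
      mul_nonneg (mul_nonneg (neg_nonneg.2 ha.le) (neg_nonneg.2 hb.le)) (sq_nonneg (σ x.imK))]
  rw [map_mul, map_ofNat, abs_mul, abs_two]
  have := abs_le_one_iff_mul_self_le_one.2 (by nlinarith : σ x.re * σ x.re ≤ 1)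
  linarith

/-- Traces of elements of `Γ_O^1` are algebraic integers of `k`, bounded at the ramified places. -/
theorem exists_integral_trace (h : IsSplitExactlyAt φ a b)
    {θ : ℍ[ℂ,φ a,φ b] ≃ₐ[ℂ] Matrix (Fin 2) (Fin 2) ℂ} {O : Subalgebra (𝓞 k) ℍ[k,a,b]}
    {hO : IsQuatOrder O} {g : SL(2, ℂ)}
    (hg : QuotientGroup.mk' (Subgroup.center SL(2, ℂ)) g ∈ normOneGroup φ θ O hO) :
    ∃ y : k, IsIntegral ℤ y ∧ φ y = (g : Matrix (Fin 2) (Fin 2) ℂ).trace ∧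
      ∀ σ : k →+* ℂ, σ ≠ φ → σ ≠ ComplexEmbedding.conjugate φ → ∃ r : ℝ, |r| ≤ 2 ∧ σ y = r := by
  obtain ⟨x, hx, hx1, g', hg', hgg'⟩ := hg
  have htr : (g' : Matrix (Fin 2) (Fin 2) ℂ).trace = φ (2 * x.re) := by
    rw [hg', trace_quaternion (by simpa using h.ne_zero_left) (by simpa using h.ne_zero_right)]
    rw [map_mul, map_ofNat]
    rfl
  have hram : ∀ σ : k →+* ℂ, σ ≠ φ → σ ≠ ComplexEmbedding.conjugate φ →
      ∃ r : ℝ, |r| ≤ 2 ∧ σ (2 * x.re) = r := by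
    intro σ h1 h2
    obtain ⟨σ', hσ', ha, hb⟩ := h.ramified σ h1 h2
    exact ⟨σ' (2 * x.re), abs_two_re_le ha hb hx1, hσ' _⟩
  rcases eq_or_eq_neg_of_mk_eq hgg' with e | e
  · exact ⟨2 * x.re, hO.isIntegral_two_re hx, by rw [e, htr], hram⟩
  · refine ⟨-(2 * x.re), (hO.isIntegral_two_re hx).neg, by rw [e, trace_neg, htr, map_neg], ?_⟩
    intro σ h1 h2
    obtain ⟨r, hr, hr'⟩ := hram σ h1 h2
    exact ⟨-r, by rwa [abs_neg], by rw [map_neg, hr']; simp⟩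

/-- If conjugation by `g` preserves the `k`-form `B` of the algebra of matrices, then
`tr(g)² = tr(Ad g)` lies in `k`. -/
theorem exists_eq_trace_sq (ha : a ≠ 0) (hb : b ≠ 0)
    (θ : ℍ[ℂ,φ a,φ b] ≃ₐ[ℂ] Matrix (Fin 2) (Fin 2) ℂ) (g : SL(2, ℂ))
    (hg : ∀ x : ℍ[k,a,b], ∃ y : ℍ[k,a,b],
      conjSL g (θ (quatBaseChange φ a b x)) = θ (quatBaseChange φ a b y)) :
    ∃ s : k, φ s = (g : Matrix (Fin 2) (Fin 2) ℂ).trace ^ 2 := by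
  have ha' : φ a ≠ 0 := by simpa using ha
  have hb' : φ b ≠ 0 := by simpa using hb
  let z := θ.symm g
  have hz : θ z = g := θ.apply_symm_apply _
  have hz' : θ (star z) = (g⁻¹ : SL(2, ℂ)) := by
    rw [map_star_quaternion ha' hb', hz, Matrix.SpecialLinearGroup.coe_inv]
  have hzz : z * star z = 1 := by
    apply θ.injective
    rw [map_mul, hz, hz', map_one, ← Matrix.SpecialLinearGroup.coe_mul, mul_inv_cancel,
      Matrix.SpecialLinearGroup.coe_one]
  have hconj : ∀ x, ∃ y, z * quatBaseChange φ a b x * star z = quatBaseChange φ a b y := by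
    intro x
    obtain ⟨y, hy⟩ := hg x
    refine ⟨y, θ.injective ?_⟩
    rw [map_mul, map_mul, hz, hz', ← hy, conjSL_apply]
  obtain ⟨yi, hi⟩ := hconj ⟨0, 1, 0, 0⟩
  obtain ⟨yj, hj⟩ := hconj ⟨0, 0, 1, 0⟩
  obtain ⟨yk, hk⟩ := hconj ⟨0, 0, 0, 1⟩
  refine ⟨1 + yi.imI + yj.imJ + yk.imK, ?_⟩
  have e0 := congrArg (fun y => y.re) hzz
  have ei := congrArg (fun y => y.imI) hi
  have ej := congrArg (fun y => y.imJ) hj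
  have ek := congrArg (fun y => y.imK) hk
  rw [← hz, trace_quaternion ha' hb']
  simp [quatBaseChange] at e0 ei ej ek
  simp only [map_add, map_one, ← ei, ← ej, ← ek]
  linear_combination -e0

end ArithmeticGroups

/-! ### Torsion-free subgroups of arithmetic groups -/

section ArithmeticGroupsTorsionFree

open Matrix NumberField

theorem exists_eq_add_inv (z : ℂ) : ∃ ν : ℂ, ν ≠ 0 ∧ z = ν + ν⁻¹ := by
  obtain ⟨s, hs⟩ := IsAlgClosed.exists_pow_nat_eq (z ^ 2 - 4) two_pos
  have h : (z + s) / 2 * ((z - s) / 2) = 1 := by linear_combination (-1 / 4) * hs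
  refine ⟨(z + s) / 2, left_ne_zero_of_mul_eq_one h, ?_⟩
  rw [← eq_inv_of_mul_eq_one_right h]
  ring

theorem not_isUnit_three (k : Type*) [Field k] [NumberField k] : ¬ IsUnit (3 : 𝓞 k) := by
  intro h
  have h1 : IsUnit (algebraMap ℤ (𝓞 k) 3) := by simpa using h
  have h2 := (isUnit_map_iff (algebraMap ℤ (𝓞 k)) 3).1 h1
  rw [Int.isUnit_iff] at h2
  omega

variable {k : Type} [Field k] [NumberField k] {a b : k} {φ : k →+* ℂ}

/-- The eigenvalues of a loxodromic element of an arithmetic group have absolute value one at the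
ramified places: this holds for a power of the element, which is in `Γ_O^1`. -/
theorem exists_norm_eq_one_of_pow_trace {t y : k} {l : ℂ} (hl : l ≠ 0) {D : ℕ} (hD : D ≠ 0)
    (ht : φ t = l ^ 2 + (l ^ 2)⁻¹) (hy : φ y = l ^ D + l⁻¹ ^ D) (σ : k →+* ℂ) {r : ℝ} (hr : |r| ≤ 2)
    (hσ : σ y = r) : ∃ ν : ℂ, ‖ν‖ = 1 ∧ σ t = ν + ν⁻¹ := by
  obtain ⟨ν, hν0, hν⟩ := exists_eq_add_inv (σ t)
  refine ⟨ν, ?_, hν⟩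
  have hP : ∀ (τ : k →+* ℂ) (x : ℂ), x ≠ 0 → τ t = x + x⁻¹ →
      τ ((Polynomial.dickson 1 (1 : k) D).eval t) = x ^ D + x⁻¹ ^ D := by
    intro τ x hx hτ
    rw [← Polynomial.eval_map_apply, Polynomial.map_dickson, map_one, hτ,
      Polynomial.dickson_one_one_eval_add_inv x x⁻¹ (mul_inv_cancel₀ hx)]
  have h1 : (Polynomial.dickson 1 (1 : k) D).eval t = y ^ 2 - 2 := by
    apply φ.injective
    rw [hP φ _ (pow_ne_zero 2 hl) ht, map_sub, map_pow, hy, map_ofNat]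
    have : l ^ D * l⁻¹ ^ D = 1 := by rw [← mul_pow, mul_inv_cancel₀ hl, one_pow]
    rw [← inv_pow, ← pow_mul, ← pow_mul, mul_comm 2 D, pow_mul, pow_mul]
    linear_combination (-2) * this
  have h2 := hP σ ν hν0 hν
  rw [h1, map_sub, map_pow, hσ, map_ofNat] at h2
  obtain ⟨η, hη, hη'⟩ := exists_norm_eq_one_add_inv (r := r ^ 2 - 2) (by
    have := sq_le_sq' (abs_le.1 hr).1 (abs_le.1 hr).2
    rw [abs_le]
    constructor <;> nlinarith [sq_nonneg r])
  have hη0 : η ≠ 0 := by rintro rfl; simp at hη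
  have h3 : ν ^ D + (ν ^ D)⁻¹ = η + η⁻¹ := by
    rw [← hη', ← inv_pow, ← h2]
    push_cast
    ring
  have h4 : ‖ν‖ ^ D = 1 := by
    rw [← norm_pow]
    rcases eq_or_eq_inv_of_add_inv_eq (pow_ne_zero D hν0) hη0 h3 with h | h
    · rw [h, hη]
    · rw [h, norm_inv, hη, inv_one]
  exact (pow_eq_one_iff_of_nonneg (norm_nonneg _) hD).1 h4

/-- A lattice in the algebra of matrices, contained in the image of the quaternion algebra, and
stable under conjugation by a group `Γ` commensurable with `Γ_O^1`: the span of a normal subgroup. -/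
theorem exists_stable_lattice (h : IsSplitExactlyAt φ a b)
    {θ : ℍ[ℂ,φ a,φ b] ≃ₐ[ℂ] Matrix (Fin 2) (Fin 2) ℂ} {O : Subalgebra (𝓞 k) ℍ[k,a,b]}
    {hO : IsQuatOrder O} {Γ G₀ : Subgroup PSL(2, ℂ)} (hG₀ : G₀ ≤ normOneGroup φ θ O hO)
    (hnorm : ∀ γ ∈ Γ, ∀ g ∈ G₀, γ * g * γ⁻¹ ∈ G₀)
    (hpow : ∀ g ∈ normOneGroup φ θ O hO, ∃ D : ℕ, D ≠ 0 ∧ g ^ D ∈ G₀)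
    [Algebra (𝓞 k) ℂ] (halg : ∀ r : 𝓞 k, algebraMap (𝓞 k) ℂ r = φ r) :
    ∃ A : Submodule (𝓞 k) (Matrix (Fin 2) (Fin 2) ℂ), A.FG ∧
      Submodule.span ℂ (A : Set (Matrix (Fin 2) (Fin 2) ℂ)) = ⊤ ∧
      (∀ g ∈ Γ, ∀ x ∈ A, adjointRep g x ∈ A) ∧
      ∀ g ∈ Γ, ∀ x : ℍ[k,a,b], ∃ y : ℍ[k,a,b],
        adjointRep g (θ (quatBaseChange φ a b x)) = θ (quatBaseChange φ a b y) := by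
  let π := QuotientGroup.mk' (Subgroup.center SL(2, ℂ))
  let H : Submonoid ℍ[k,a,b] :=
    { carrier := {x | x ∈ O ∧ x * star x = 1 ∧ ∃ g : SL(2, ℂ),
        (g : Matrix (Fin 2) (Fin 2) ℂ) = θ (quatBaseChange φ a b x) ∧ π g ∈ G₀}
      one_mem' := ⟨O.one_mem, by simp, 1, by simp, by rw [map_one]; exact G₀.one_mem⟩
      mul_mem' := by
        rintro x y ⟨hx, hx1, g, hg, hgG⟩ ⟨hy, hy1, g', hg', hgG'⟩
        refine ⟨O.mul_mem hx hy, ?_, g * g', by simp [hg, hg'], ?_⟩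
        · rw [star_mul, mul_assoc, ← mul_assoc y, hy1, one_mul, hx1]
        · rw [map_mul]
          exact G₀.mul_mem hgG hgG' }
  have hH : Submodule.span k (H : Set ℍ[k,a,b]) = ⊤ := by
    refine span_eq_top_of_pow_mem h hO.span H fun x hx hx1 => ?_
    obtain ⟨g, hg⟩ := exists_SL_of_norm_one h.ne_zero_left h.ne_zero_right θ hx1
    obtain ⟨D, hD, hDG⟩ := hpow (π g) ⟨x, hx, hx1, g, hg, rfl⟩
    refine ⟨D, hD, O.pow_mem hx D, ?_, g ^ D, ?_, by rwa [map_pow]⟩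
    · have hcomm : Commute x (star x) := (star_comm_self' x).symm
      rw [star_pow, ← hcomm.mul_pow, hx1, one_pow]
    · rw [Matrix.SpecialLinearGroup.coe_pow, hg, map_pow, map_pow]
  let f : ℍ[k,a,b] →ₗ[𝓞 k] Matrix (Fin 2) (Fin 2) ℂ :=
    { toFun := fun x => θ (quatBaseChange φ a b x)
      map_add' := fun x y => by rw [map_add, map_add]
      map_smul' := fun r x => by
        rw [← algebraMap_smul k r x, Algebra.smul_def, map_mul, quatBaseChange_algebraMap, map_mul,
          AlgEquiv.commutes, RingHom.id_apply, ← algebraMap_smul ℂ r, halg, Algebra.smul_def] }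
  have hfk : ∀ (r : k) (x : ℍ[k,a,b]), f (r • x) = φ r • f x := by
    intro r x
    change θ (quatBaseChange φ a b (r • x)) = φ r • θ (quatBaseChange φ a b x)
    rw [Algebra.smul_def, map_mul, quatBaseChange_algebraMap, map_mul, AlgEquiv.commutes,
      ← Algebra.smul_def]
  have hconj : ∀ g ∈ Γ, ∀ x ∈ H, ∃ y ∈ H, adjointRep g (f x) = f y := by
    rintro g hg x ⟨hx, hx1, g', hg', hgG'⟩
    obtain ⟨γ, rfl⟩ := QuotientGroup.mk'_surjective _ g
    have hmem : π (γ * g' * γ⁻¹) ∈ G₀ := by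
      rw [map_mul, map_mul, map_inv]
      exact hnorm _ hg _ hgG'
    have hval : adjointRep (π γ) (f x) = ((γ * g' * γ⁻¹ : SL(2, ℂ)) : Matrix (Fin 2) (Fin 2) ℂ) := by
      rw [adjointRep_mk, conjSL_apply, Matrix.SpecialLinearGroup.coe_mul,
        Matrix.SpecialLinearGroup.coe_mul, hg']
      rfl
    obtain ⟨y, hy, hy1, g'', hg'', heq⟩ := hG₀ hmem
    rcases eq_or_eq_neg_of_mk_eq heq with e | e
    · exact ⟨y, ⟨hy, hy1, _, by rw [e, hg''], hmem⟩, by rw [hval, e, hg'']; rfl⟩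
    · have e' : ((γ * g' * γ⁻¹ : SL(2, ℂ)) : Matrix (Fin 2) (Fin 2) ℂ) = θ (quatBaseChange φ a b (-y)) := by
        rw [e, hg'', map_neg, map_neg]
      exact ⟨-y, ⟨O.neg_mem hy, by rw [star_neg, neg_mul_neg, hy1], _, e', hmem⟩, by rw [hval, e']; rfl⟩
  refine ⟨(Submodule.span (𝓞 k) (H : Set ℍ[k,a,b])).map f, ?_, ?_, ?_, ?_⟩
  · have : IsNoetherian (𝓞 k) (Subalgebra.toSubmodule O) := isNoetherian_of_fg_of_noetherian _ hO.fg
    refine (isNoetherian_submodule.1 this _ ?_).map f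
    exact Submodule.span_le.2 fun x hx => hx.1
  · set V := Submodule.span ℂ
      (((Submodule.span (𝓞 k) (H : Set ℍ[k,a,b])).map f : Submodule _ _) : Set (Matrix (Fin 2) (Fin 2) ℂ))
    have hV : ∀ x, f x ∈ V := by
      intro x
      have hx : x ∈ Submodule.span k (H : Set ℍ[k,a,b]) := by rw [hH]; trivial
      induction hx using Submodule.span_induction with
      | mem x hx => exact Submodule.subset_span ⟨x, Submodule.subset_span hx, rfl⟩
      | zero => rw [map_zero]; exact V.zero_mem
      | add x y _ _ hx hy => rw [map_add]; exact V.add_mem hx hy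
      | smul r x _ hx => rw [hfk]; exact V.smul_mem _ hx
    rw [eq_top_iff]
    intro M _
    have hM : M = (θ.symm M).re • f 1 + (θ.symm M).imI • f ⟨0, 1, 0, 0⟩
        + (θ.symm M).imJ • f ⟨0, 0, 1, 0⟩ + (θ.symm M).imK • f ⟨0, 0, 0, 1⟩ := by
      apply θ.symm.injective
      simp only [map_add, map_smul]
      have : ∀ x, θ.symm (f x) = quatBaseChange φ a b x := fun x => θ.symm_apply_apply _
      simp only [this]
      ext <;> simp [quatBaseChange]
    rw [hM]
    exact V.add_mem (V.add_mem (V.add_mem (V.smul_mem _ (hV _)) (V.smul_mem _ (hV _)))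
      (V.smul_mem _ (hV _))) (V.smul_mem _ (hV _))
  · rintro g hg _ ⟨x, hx, rfl⟩
    change x ∈ Submodule.span (𝓞 k) (H : Set ℍ[k,a,b]) at hx
    induction hx using Submodule.span_induction with
    | mem x hx =>
      obtain ⟨y, hy, e⟩ := hconj g hg x hx
      exact ⟨y, Submodule.subset_span hy, e.symm⟩
    | zero => rw [map_zero, map_zero]; exact Submodule.zero_mem _
    | add x y _ _ hx hy => rw [map_add, map_add]; exact Submodule.add_mem _ hx hy
    | smul r x _ hx =>
      rw [map_smul, ← algebraMap_smul ℂ r (f x), map_smul, algebraMap_smul]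
      exact Submodule.smul_mem _ r hx
  · intro g hg x
    change ∃ y, adjointRep g (f x) = f y
    have hx : x ∈ Submodule.span k (H : Set ℍ[k,a,b]) := by rw [hH]; trivial
    induction hx using Submodule.span_induction with
    | mem x hx =>
      obtain ⟨y, hy, e⟩ := hconj g hg x hx
      exact ⟨y, e⟩
    | zero => exact ⟨0, by rw [map_zero, map_zero]⟩
    | add x y _ _ hx hy =>
      obtain ⟨x', hx⟩ := hx
      obtain ⟨y', hy⟩ := hy
      exact ⟨x' + y', by rw [map_add, map_add, map_add, hx, hy]⟩
    | smul r x _ hx =>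
      obtain ⟨x', hx⟩ := hx
      exact ⟨r • x', by rw [hfk, map_smul, hx, hfk]⟩

/-- A loxodromic element of a group commensurable with `Γ_O^1` is contained in a torsion-free
subgroup of finite index. -/
theorem exists_torsionFree_subgroup (h : IsSplitExactlyAt φ a b)
    {θ : ℍ[ℂ,φ a,φ b] ≃ₐ[ℂ] Matrix (Fin 2) (Fin 2) ℂ} {O : Subalgebra (𝓞 k) ℍ[k,a,b]}
    {hO : IsQuatOrder O} {Γ : Subgroup PSL(2, ℂ)}
    (hΓ : Subgroup.Commensurable Γ (normOneGroup φ θ O hO)) {γ : SL(2, ℂ)}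
    (hγ : QuotientGroup.mk' (Subgroup.center SL(2, ℂ)) γ ∈ Γ) {l : ℂ} (hl : 1 < ‖l‖)
    (htr : (γ : Matrix (Fin 2) (Fin 2) ℂ).trace = l + l⁻¹) :
    ∃ Γ' ≤ Γ, Γ'.relIndex Γ ≠ 0 ∧ QuotientGroup.mk' (Subgroup.center SL(2, ℂ)) γ ∈ Γ' ∧
      ∀ g ∈ Γ', IsOfFinOrder g → g = 1 := by
  have hl0 : l ≠ 0 := by rintro rfl; simp at hl; linarith
  obtain ⟨G₀, hG₀Γ, hG₀, hnorm, -, ⟨D, hD, hDΓ⟩, hpow⟩ := exists_common_subgroup_of_commensurable hΓ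
  let alg : Algebra (𝓞 k) ℂ := (φ.comp (algebraMap (𝓞 k) k)).toAlgebra
  obtain ⟨A, hAfg, hAspan, hAΓ, hAk⟩ := exists_stable_lattice h hG₀ hnorm hpow (fun r => rfl)
  obtain ⟨ρ, hρinj, hρ⟩ := exists_lattice_rep hAspan hAΓ
  have : Module.Finite (𝓞 k) A := Module.Finite.iff_fg.2 hAfg
  have : Module.IsTorsionFree (𝓞 k) A := by
    refine Module.IsTorsionFree.of_smul_eq_zero fun r x hrx => ?_
    have h1 : φ r • (x : Matrix (Fin 2) (Fin 2) ℂ) = 0 := by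
      have := congrArg (Subtype.val) hrx
      rw [Submodule.coe_smul, ← algebraMap_smul ℂ r] at this
      exact this
    rcases smul_eq_zero.1 h1 with h2 | h2
    · left
      exact RingOfIntegers.coe_eq_zero_iff.1 ((map_eq_zero φ).1 h2)
    · right
      exact Subtype.ext h2
  -- the trace of a power of `γ`, which is in `Γ_O^1`
  obtain ⟨y, hyint, hy, hyσ⟩ := exists_integral_trace h (g := γ ^ D) (by
    rw [map_pow]
    exact hG₀ (hDΓ _ hγ))
  rw [trace_pow_SL hl0 htr] at hy
  -- the eigenvalue parameter `t = l² + l⁻²` of the adjoint action is in `𝓞 k`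
  obtain ⟨s, hs⟩ := exists_eq_trace_sq h.ne_zero_left h.ne_zero_right θ γ (hAk _ hγ)
  have hst : φ (s - 2) = l ^ 2 + (l ^ 2)⁻¹ := by
    rw [map_sub, hs, htr, map_ofNat]
    field_simp
    ring
  have hlint : IsIntegral ℤ l := by
    refine IsIntegral.of_pow (Nat.pos_of_ne_zero hD) (isIntegral_of_add_inv (pow_ne_zero D hl0) ?_)
    rw [← inv_pow, ← hy]
    exact hyint.map φ.toIntAlgHom
  have hlint' : IsIntegral ℤ l⁻¹ := by
    refine IsIntegral.of_pow (Nat.pos_of_ne_zero hD)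
      (isIntegral_of_add_inv (pow_ne_zero D (inv_ne_zero hl0)) ?_)
    rw [← inv_pow, inv_inv, add_comm, ← hy]
    exact hyint.map φ.toIntAlgHom
  have htint : IsIntegral ℤ (s - 2) := by
    rw [← isIntegral_algHom_iff φ.toIntAlgHom φ.injective]
    change IsIntegral ℤ (φ (s - 2))
    rw [hst, ← inv_pow]
    exact (hlint.pow 2).add (hlint'.pow 2)
  let t : 𝓞 k := ⟨s - 2, htint⟩
  have ht : φ t = l ^ 2 + (l ^ 2)⁻¹ := hst
  have hcubic : (ρ ⟨_, hγ⟩ - 1) * ((ρ ⟨_, hγ⟩) ^ 2 - t • ρ ⟨_, hγ⟩ + 1) = 0 := by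
    ext1 x
    apply Subtype.ext
    have h1 := congrArg (fun f => f (x : Matrix (Fin 2) (Fin 2) ℂ)) (conjSL_cubic γ (t := φ t) (by
      rw [ht, htr]
      field_simp
      ring))
    have h2 : ∀ z : Matrix (Fin 2) (Fin 2) ℂ, φ t • z = t • z := fun z => algebraMap_smul ℂ t z
    simp only [Module.End.mul_apply, LinearMap.sub_apply, LinearMap.add_apply, LinearMap.smul_apply,
      sq, Module.End.one_apply, LinearMap.zero_apply, h2] at h1
    simp only [Module.End.mul_apply, LinearMap.sub_apply, LinearMap.add_apply, LinearMap.smul_apply,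
      sq, Module.End.one_apply, LinearMap.zero_apply, Submodule.coe_sub, Submodule.coe_add,
      Submodule.coe_smul, hρ, adjointRep_mk, Submodule.coe_zero]
    exact h1
  obtain ⟨N, hN, hmain⟩ := exists_torsionFree_of_symmGeomSum ρ hρinj
    (fun w hw => finite_quotient_span_singleton hw) (by norm_num) (not_isUnit_three k)
  obtain ⟨m, hNm, hw0, hw, hwN⟩ := exists_not_isUnit_symmGeomSum φ (t := t) (μ := l ^ 2)
    (by rw [norm_pow]; exact one_lt_pow₀ hl two_ne_zero) ht (fun σ h1 h2 => by
      obtain ⟨r, hr, hr'⟩ := hyσ σ h1 h2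
      exact exists_norm_eq_one_of_pow_trace hl0 hD ht hy σ hr hr') hN
  obtain ⟨G', hG'ind, hγG', hG'tf⟩ := hmain ⟨_, hγ⟩ t m hcubic hw0 hw hwN hNm
  refine ⟨G'.map Γ.subtype, Subgroup.map_subtype_le G', ?_, ⟨_, hγG', rfl⟩, ?_⟩
  · have : (G'.map Γ.subtype).subgroupOf Γ = G' :=
      Subgroup.comap_map_eq_self_of_injective Γ.subtype_injective G'
    rw [Subgroup.relIndex, this]
    exact hG'ind
  · rintro _ ⟨g, hg, rfl⟩ hfin
    have h1 := hG'tf g hg ((Subgroup.subtype_injective Γ).isOfFinOrder_iff.1 hfin)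
    rw [h1, map_one]

end ArithmeticGroupsTorsionFree

/-! ### Loxodromic elements and their traces -/

section ArithmeticGroupsSpectrum

open Matrix NumberField

variable {k : Type} [Field k] [NumberField k] {a b : k} {φ : k →+* ℂ}

theorem countable_of_commensurable_normOneGroup
    {θ : ℍ[ℂ,φ a,φ b] ≃ₐ[ℂ] Matrix (Fin 2) (Fin 2) ℂ} {O : Subalgebra (𝓞 k) ℍ[k,a,b]}
    {hO : IsQuatOrder O} {Γ : Subgroup PSL(2, ℂ)}
    (hΓ : Subgroup.Commensurable Γ (normOneGroup φ θ O hO)) : Countable Γ := by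
  have hk : Countable k := (Module.finBasis ℚ k).equivFun.toEquiv.injective.countable
  have hB : Countable ℍ[k,a,b] := (QuaternionAlgebra.equivProd a 0 b).injective.countable
  have h1 : ((normOneGroup φ θ O hO : Subgroup PSL(2, ℂ)) : Set PSL(2, ℂ)).Countable := by
    have hsub : ((normOneGroup φ θ O hO : Subgroup PSL(2, ℂ)) : Set PSL(2, ℂ)) ⊆
        ⋃ x : ℍ[k,a,b], {p | ∃ g : SL(2, ℂ),
          (g : Matrix (Fin 2) (Fin 2) ℂ) = θ (quatBaseChange φ a b x) ∧
            p = QuotientGroup.mk' (Subgroup.center SL(2, ℂ)) g} := by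
      rintro p ⟨x, -, -, hp⟩
      exact Set.mem_iUnion.2 ⟨x, hp⟩
    refine (Set.countable_iUnion fun x => Set.Subsingleton.countable ?_).mono hsub
    rintro p ⟨g, hg, rfl⟩ q ⟨g', hg', rfl⟩
    rw [Subtype.ext (hg.trans hg'.symm)]
  obtain ⟨G₀, hG₀Γ, hG₀, -, hind, -⟩ := exists_common_subgroup_of_commensurable hΓ
  have h2 : Countable (G₀.subgroupOf Γ) := by
    have : Countable G₀ := (h1.mono hG₀).to_subtype
    exact (Subgroup.subgroupOfEquivOfLe hG₀Γ).injective.countable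
  have : (G₀.subgroupOf Γ).FiniteIndex := ⟨hind⟩
  have : Finite (Γ ⧸ G₀.subgroupOf Γ) := inferInstance
  exact (Subgroup.groupEquivQuotientProdSubgroup (s := G₀.subgroupOf Γ)).injective.countable

/-- Groups commensurable with `Γ_O^1` contain loxodromic elements. -/
theorem exists_loxodromic (h : IsSplitExactlyAt φ a b)
    {θ : ℍ[ℂ,φ a,φ b] ≃ₐ[ℂ] Matrix (Fin 2) (Fin 2) ℂ} {O : Subalgebra (𝓞 k) ℍ[k,a,b]}
    {hO : IsQuatOrder O} {Γ : Subgroup PSL(2, ℂ)}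
    (hΓ : Subgroup.Commensurable Γ (normOneGroup φ θ O hO)) :
    ∃ γ : SL(2, ℂ), QuotientGroup.mk' (Subgroup.center SL(2, ℂ)) γ ∈ Γ ∧
      ∃ l : ℂ, 1 < ‖l‖ ∧ (γ : Matrix (Fin 2) (Fin 2) ℂ).trace = l + l⁻¹ := by
  obtain ⟨G₀, hG₀Γ, -, -, -, -, hpow⟩ := exists_common_subgroup_of_commensurable hΓ
  obtain ⟨I, J, c, d, hc, ⟨s, hs, hsplit⟩, -, -, hI, -, -, hsI, -⟩ := h.exists_anticommuting
  obtain ⟨α, β, hx, hx1, hxn⟩ := exists_norm_one_mem_order hO.span hc hI φ hs hsplit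
  have hnorm : (algebraMap k ℍ[k,a,b] α + β • I) * star (algebraMap k ℍ[k,a,b] α + β • I) = 1 := by
    rw [star_add, quaternion_star_smul, hsI, QuaternionAlgebra.coe_algebraMap, QuaternionAlgebra.star_coe,
      ← QuaternionAlgebra.coe_algebraMap, ← map_one (algebraMap k ℍ[k,a,b]), ← hx1]
    have e1 : (α • (1 : ℍ[k,a,b]) + β • I) * (α • 1 + β • -I) = (α * α) • 1 - (β * β) • (I * I) := by
      simp only [add_mul, mul_add, smul_mul_smul_comm, one_mul, mul_one, mul_neg, smul_neg]
      module
    rw [Algebra.algebraMap_eq_smul_one, e1, hI, Algebra.algebraMap_eq_smul_one,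
      Algebra.algebraMap_eq_smul_one]
    module
  obtain ⟨g, hg⟩ := exists_SL_of_norm_one h.ne_zero_left h.ne_zero_right θ hnorm
  have hIre : I.re = 0 := by
    have := congrArg (fun y => y.re) hsI
    simp at this
    exact self_eq_neg.1 this
  have htr : (g : Matrix (Fin 2) (Fin 2) ℂ).trace = 2 * φ α := by
    rw [hg, trace_quaternion (by simpa using h.ne_zero_left) (by simpa using h.ne_zero_right)]
    simp [quatBaseChange, QuaternionAlgebra.coe_algebraMap, hIre]
  set l := φ α + φ β * s with hl
  have hl0 : l ≠ 0 := by
    rintro h0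
    rw [h0] at hxn
    simp at hxn
    linarith
  have hinv : φ α - φ β * s = l⁻¹ := by
    apply eq_inv_of_mul_eq_one_left
    have h1 := congrArg φ hx1
    simp only [map_sub, map_mul, map_pow, map_one] at h1
    rw [hl]
    linear_combination h1 - (φ β) ^ 2 * hs
  have htr' : (g : Matrix (Fin 2) (Fin 2) ℂ).trace = l + l⁻¹ := by
    rw [htr, ← hinv, hl]
    ring
  obtain ⟨D, hD, hDG⟩ := hpow _ ⟨_, hx, hnorm, g, hg, rfl⟩
  refine ⟨g ^ D, hG₀Γ (by rwa [map_pow]), l ^ D, ?_, ?_⟩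
  · rw [norm_pow]
    exact one_lt_pow₀ hxn hD
  · rw [trace_pow_SL hl0 htr', inv_pow]

/-- Discreteness of the length spectrum: the traces of a power of the elements in question are
algebraic integers with bounded conjugates. -/
theorem finite_translation_lengths (h : IsSplitExactlyAt φ a b)
    {θ : ℍ[ℂ,φ a,φ b] ≃ₐ[ℂ] Matrix (Fin 2) (Fin 2) ℂ} {O : Subalgebra (𝓞 k) ℍ[k,a,b]}
    {hO : IsQuatOrder O} {Γ : Subgroup PSL(2, ℂ)}
    (hΓ : Subgroup.Commensurable Γ (normOneGroup φ θ O hO)) (L : ℝ) :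
    {ℓ : ℝ | 0 < ℓ ∧ ℓ ≤ L ∧ ∃ γ : SL(2, ℂ), QuotientGroup.mk' (Subgroup.center SL(2, ℂ)) γ ∈ Γ ∧
      ∃ l : ℂ, ‖l‖ = Real.exp (ℓ / 2) ∧ (γ : Matrix (Fin 2) (Fin 2) ℂ).trace = l + l⁻¹}.Finite := by
  obtain ⟨G₀, -, hG₀, -, -, ⟨D, hD, hDΓ⟩, -⟩ := exists_common_subgroup_of_commensurable hΓ
  let F : Set k := {y | IsIntegral ℤ y ∧ ∀ σ : k →+* ℂ, ‖σ y‖ ≤ 2 * Real.exp (L / 2) ^ D}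
  have hF : F.Finite := Embeddings.finite_of_norm_le k ℂ _
  let S : k → Set ℝ := fun y => {ℓ | 0 < ℓ ∧ ∃ l : ℂ, ‖l‖ = Real.exp (ℓ / 2) ∧ φ y = l ^ D + l⁻¹ ^ D}
  have hne : ∀ (l : ℂ) (ℓ : ℝ), ‖l‖ = Real.exp (ℓ / 2) → l ≠ 0 := by
    rintro l ℓ hl rfl
    rw [norm_zero] at hl
    exact (Real.exp_pos _).ne hl
  have hS : ∀ y, (S y).Subsingleton := by
    rintro y ℓ₁ ⟨hℓ₁, l₁, hl₁, hy₁⟩ ℓ₂ ⟨hℓ₂, l₂, hl₂, hy₂⟩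
    have h1 : 1 < ‖l₁‖ := by rw [hl₁, Real.one_lt_exp_iff]; linarith
    have h2 : 1 < ‖l₂‖ := by rw [hl₂, Real.one_lt_exp_iff]; linarith
    have key : l₁ ^ D = l₂ ^ D ∨ l₁ ^ D = (l₂ ^ D)⁻¹ :=
      eq_or_eq_inv_of_add_inv_eq (pow_ne_zero D (hne _ _ hl₁)) (pow_ne_zero D (hne _ _ hl₂))
        (by rw [← inv_pow, ← inv_pow, ← hy₁, ← hy₂])
    rcases key with e | e
    · have e' := congrArg norm e
      rw [norm_pow, norm_pow] at e'
      have e'' := (pow_left_inj₀ (norm_nonneg _) (norm_nonneg _) hD).1 e'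
      rw [hl₁, hl₂, Real.exp_eq_exp] at e''
      linarith
    · have e' := congrArg norm e
      rw [norm_inv, norm_pow, norm_pow] at e'
      have h3 := one_lt_pow₀ h1 hD
      have h4 := inv_lt_one_of_one_lt₀ (one_lt_pow₀ h2 hD)
      rw [e'] at h3
      linarith
  refine (hF.biUnion fun y _ => (hS y).finite).subset ?_
  rintro ℓ ⟨hℓ, hℓL, γ, hγ, l, hl, htr⟩
  obtain ⟨y, hyint, hy, hyσ⟩ := exists_integral_trace h (g := γ ^ D) (by
    rw [map_pow]
    exact hG₀ (hDΓ _ hγ))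
  rw [trace_pow_SL (hne _ _ hl) htr] at hy
  rw [Set.mem_iUnion₂]
  refine ⟨y, ⟨hyint, ?_⟩, hℓ, l, hl, hy⟩
  have hL : 1 ≤ Real.exp (L / 2) := Real.one_le_exp (by linarith)
  have hφ : ‖φ y‖ ≤ 2 * Real.exp (L / 2) ^ D := by
    rw [hy]
    refine (norm_add_le _ _).trans ?_
    rw [norm_pow, norm_pow, norm_inv, hl]
    have h1 : Real.exp (ℓ / 2) ^ D ≤ Real.exp (L / 2) ^ D :=
      pow_le_pow_left₀ (Real.exp_pos _).le (Real.exp_le_exp.2 (by linarith)) D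
    have h2 : (Real.exp (ℓ / 2))⁻¹ ^ D ≤ Real.exp (L / 2) ^ D := by
      refine pow_le_pow_left₀ (inv_nonneg.2 (Real.exp_pos _).le) ?_ D
      exact (inv_le_one_of_one_le₀ (Real.one_le_exp (by linarith))).trans hL
    linarith
  intro σ
  by_cases h1 : σ = φ
  · rw [h1]
    exact hφ
  by_cases h2 : σ = ComplexEmbedding.conjugate φ
  · rw [h2, ComplexEmbedding.conjugate_coe_eq, RCLike.norm_conj]
    exact hφ
  obtain ⟨r, hr, hr'⟩ := hyσ σ h1 h2
  rw [hr', Complex.norm_real, Real.norm_eq_abs]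
  have := one_le_pow₀ hL (n := D)
  linarith

end ArithmeticGroupsSpectrum

/-! ### Geometry of hyperbolic 3-space -/

namespace UpperHalfSpace

/-- Twice the hyperbolic cosine of the distance. -/
noncomputable def twoCosh (p q : UpperHalfSpace) : ℝ :=
  (‖p.z - q.z‖ ^ 2 + p.t ^ 2 + q.t ^ 2) / (p.t * q.t)

theorem dist_eq_arsinh (p q : UpperHalfSpace) :
    dist p q = 2 * Real.arsinh (Real.sqrt ((twoCosh p q - 2) / 4)) := by
  have hp := p.t_pos
  have hq := q.t_pos
  have h : (twoCosh p q - 2) / 4 = (‖p.z - q.z‖ ^ 2 + (p.t - q.t) ^ 2) / (2 ^ 2 * (p.t * q.t)) := by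
    unfold twoCosh
    field_simp
    ring
  rw [h, Real.sqrt_div' _ (by positivity), Real.sqrt_mul (by positivity), Real.sqrt_sq (by norm_num)]
  rfl

theorem two_mul_cosh_dist (p q : UpperHalfSpace) : 2 * Real.cosh (dist p q) = twoCosh p q := by
  have hp := p.t_pos
  have hq := q.t_pos
  have h : 0 ≤ (twoCosh p q - 2) / 4 := by
    have : (twoCosh p q - 2) / 4 = (‖p.z - q.z‖ ^ 2 + (p.t - q.t) ^ 2) / (4 * (p.t * q.t)) := by
      unfold twoCosh
      field_simp
      ring
    rw [this]
    positivity
  rw [dist_eq_arsinh, Real.cosh_two_mul, Real.cosh_sq, Real.sinh_arsinh, Real.sq_sqrt h]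
  ring

/-- The Hermitian form of determinant one attached to a point, evaluated at two vectors (of which
the second is given by its conjugate). -/
noncomputable def hermForm (p : UpperHalfSpace) (r s r' s' : ℂ) : ℂ :=
  ((r * p.z + s) * (r' * starRingEnd ℂ p.z + s') + r * r' * (p.t : ℂ) ^ 2) / p.t

theorem hermForm_smul (g : SL(2, ℂ)) (p : UpperHalfSpace) (r s r' s' : ℂ) :
    hermForm (g • p) r s r' s' = hermForm p (r * g 0 0 + s * g 1 0) (r * g 0 1 + s * g 1 1)
      (r' * starRingEnd ℂ (g 0 0) + s' * starRingEnd ℂ (g 1 0))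
      (r' * starRingEnd ℂ (g 0 1) + s' * starRingEnd ℂ (g 1 1)) := by
  change hermForm (act g p) r s r' s' = _
  have hD : (den g p : ℂ) ≠ 0 := by exact_mod_cast (den_pos g p).ne'
  have ht : (p.t : ℂ) ≠ 0 := by exact_mod_cast p.t_pos.ne'
  have key := den_mul_aux (r := r) (r' := r') (s := s) (s' := s') hD (den_coe g p) (det_eq g)
    (det_conj_eq g)
  unfold hermForm
  rw [key]
  simp only [act, map_add, map_mul, map_div₀, map_pow, Complex.conj_ofReal, Complex.conj_conj,
    Complex.ofReal_div]
  rw [div_div_eq_mul_div]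

theorem twoCosh_eq_hermForm (p q : UpperHalfSpace) :
    (twoCosh p q : ℂ) = hermForm p 1 0 1 0 * hermForm q 0 1 0 1 + hermForm p 0 1 0 1 * hermForm q 1 0 1 0
      - hermForm p 1 0 0 1 * hermForm q 0 1 1 0 - hermForm p 0 1 1 0 * hermForm q 1 0 0 1 := by
  have hp : (p.t : ℂ) ≠ 0 := by exact_mod_cast p.t_pos.ne'
  have hq : (q.t : ℂ) ≠ 0 := by exact_mod_cast q.t_pos.ne'
  have h : ((‖p.z - q.z‖ ^ 2 : ℝ) : ℂ) = (p.z - q.z) * (starRingEnd ℂ p.z - starRingEnd ℂ q.z) := by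
    rw [← map_sub, Complex.mul_conj, Complex.normSq_eq_norm_sq]
  unfold twoCosh hermForm
  rw [Complex.ofReal_div, Complex.ofReal_add, Complex.ofReal_add, h]
  push_cast
  field_simp
  ring

theorem twoCosh_smul (g : SL(2, ℂ)) (p q : UpperHalfSpace) : twoCosh (g • p) (g • q) = twoCosh p q := by
  apply Complex.ofReal_injective
  rw [twoCosh_eq_hermForm, twoCosh_eq_hermForm]
  simp only [hermForm_smul]
  have hp : (p.t : ℂ) ≠ 0 := by exact_mod_cast p.t_pos.ne'
  have hq : (q.t : ℂ) ≠ 0 := by exact_mod_cast q.t_pos.ne'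
  have h1 := det_eq g
  have h2 := det_conj_eq g
  generalize g 0 0 = α at *
  generalize g 0 1 = β at *
  generalize g 1 0 = γ at *
  generalize g 1 1 = δ at *
  unfold hermForm
  generalize starRingEnd ℂ α = α' at *
  generalize starRingEnd ℂ β = β' at *
  generalize starRingEnd ℂ γ = γ' at *
  generalize starRingEnd ℂ δ = δ' at *
  field_simp
  generalize starRingEnd ℂ p.z = z' at *
  generalize starRingEnd ℂ q.z = w' at *
  linear_combination (((p.z - q.z) * (z' - w') + (p.t : ℂ) ^ 2 + (q.t : ℂ) ^ 2)) * (α' * δ' - β' * γ') * h1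
    + (((p.z - q.z) * (z' - w') + (p.t : ℂ) ^ 2 + (q.t : ℂ) ^ 2)) * h2

theorem dist_smul_smul (g : SL(2, ℂ)) (p q : UpperHalfSpace) : dist (g • p) (g • q) = dist p q := by
  rw [dist_eq_arsinh, dist_eq_arsinh, twoCosh_smul]

/-- The vertical geodesic `t ↦ (0, e^t)`. -/
noncomputable def vertical (u : ℝ) : UpperHalfSpace := ⟨0, Real.exp u, Real.exp_pos u⟩

theorem isGeodesicLine_vertical : IsGeodesicLine vertical := by
  intro s t
  have h : Real.cosh (dist (vertical s) (vertical t)) = Real.cosh (s - t) := by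
    have := two_mul_cosh_dist (vertical s) (vertical t)
    have h2 : twoCosh (vertical s) (vertical t) = 2 * Real.cosh (s - t) := by
      unfold twoCosh vertical
      rw [Real.cosh_eq, neg_sub, Real.exp_sub, Real.exp_sub]
      have := Real.exp_ne_zero s
      have := Real.exp_ne_zero t
      simp
      field_simp
    linarith
  have h0 : 0 ≤ dist (vertical s) (vertical t) := by
    rw [dist_eq_arsinh]
    exact mul_nonneg zero_le_two (Real.arsinh_nonneg_iff.2 (Real.sqrt_nonneg _))
  rw [← Real.cosh_abs (s - t)] at h
  exact Real.cosh_strictMonoOn.injOn h0 (Set.mem_Ici.2 (abs_nonneg _)) h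

/-- A point is determined by its distances to two points of the vertical geodesic, if these
distances are those of a point of the geodesic. -/
theorem eq_vertical_of_dist {p : UpperHalfSpace} {s t u : ℝ} (hst : s ≠ t)
    (hs : dist p (vertical s) = |u - s|) (ht : dist p (vertical t) = |u - t|) : p = vertical u := by
  have hp := p.t_pos
  have key : ∀ v, dist p (vertical v) = |u - v| →
      ‖p.z‖ ^ 2 + p.t ^ 2 + Real.exp v ^ 2 = p.t * (Real.exp u + Real.exp v ^ 2 / Real.exp u) := by
    intro v hv
    have h := two_mul_cosh_dist p (vertical v)
    rw [hv, Real.cosh_abs, Real.cosh_eq, neg_sub, Real.exp_sub, Real.exp_sub] at h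
    unfold twoCosh vertical at h
    have := Real.exp_pos v
    have := Real.exp_pos u
    simp only [sub_zero] at h
    field_simp at h ⊢
    linarith
  have h1 := key s hs
  have h2 := key t ht
  have hne : Real.exp s ^ 2 - Real.exp t ^ 2 ≠ 0 := by
    intro h
    have := (pow_left_inj₀ (Real.exp_pos s).le (Real.exp_pos t).le two_ne_zero).1 (sub_eq_zero.1 h)
    exact hst (Real.exp_injective this)
  have hu := Real.exp_pos u
  have h3 : p.t = Real.exp u := by
    have h4 : (Real.exp s ^ 2 - Real.exp t ^ 2) * (p.t - Real.exp u) = 0 := by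
      field_simp at h1 h2
      linear_combination h2 - h1
    exact sub_eq_zero.1 ((mul_eq_zero.1 h4).resolve_left hne)
  have h5 : ‖p.z‖ = 0 := by
    rw [h3] at h1
    field_simp at h1
    have : ‖p.z‖ ^ 2 = 0 := by linarith
    exact pow_eq_zero_iff two_ne_zero |>.1 this
  ext1
  · exact norm_eq_zero.1 h5
  · exact h3

theorem smul_z (g : SL(2, ℂ)) (p : UpperHalfSpace) :
    (g • p).z = ((g 0 0 * p.z + g 0 1) * starRingEnd ℂ (g 1 0 * p.z + g 1 1)
        + g 0 0 * starRingEnd ℂ (g 1 0) * (p.t : ℂ) ^ 2) / (den g p : ℂ) := rfl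

theorem smul_t (g : SL(2, ℂ)) (p : UpperHalfSpace) : (g • p).t = p.t / den g p := rfl

theorem exists_smul_eq_vertical_zero (p : UpperHalfSpace) : ∃ g : SL(2, ℂ), g • p = vertical 0 := by
  have hp := p.t_pos
  have hs : ((Real.sqrt p.t : ℝ) : ℂ) ≠ 0 := by exact_mod_cast (Real.sqrt_pos.2 hp).ne'
  let g : SL(2, ℂ) := ⟨!![(Real.sqrt p.t : ℂ)⁻¹, -p.z * (Real.sqrt p.t : ℂ)⁻¹; 0, Real.sqrt p.t], by
    rw [Matrix.det_fin_two_of]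
    field_simp
    ring⟩
  have g00 : g 0 0 = (Real.sqrt p.t : ℂ)⁻¹ := rfl
  have g01 : g 0 1 = -p.z * (Real.sqrt p.t : ℂ)⁻¹ := rfl
  have g10 : g 1 0 = 0 := rfl
  have g11 : g 1 1 = Real.sqrt p.t := rfl
  have hden : den g p = p.t := by
    simp [den, g10, g11, Complex.normSq_ofReal, Real.mul_self_sqrt hp.le]
  refine ⟨g, ?_⟩
  ext1
  · rw [smul_z, g00, g01, g10]
    simp only [vertical, map_zero, mul_zero, zero_mul, add_zero]
    rw [div_eq_zero_iff]
    left
    ring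
  · rw [smul_t, hden]
    simp [vertical, hp.ne']

/-- Rotations about `(0, 1)` move any point to the vertical axis. -/
theorem exists_rotation (q : UpperHalfSpace) :
    ∃ g : SL(2, ℂ), g • vertical 0 = vertical 0 ∧ (g • q).z = 0 := by
  by_cases hw : q.z = 0
  · exact ⟨1, one_smul _ _, by rw [one_smul, hw]⟩
  let e : ℂ := 1 - q.z * starRingEnd ℂ q.z - (q.t : ℂ) ^ 2
  have hw' : starRingEnd ℂ q.z ≠ 0 := by simpa using hw
  obtain ⟨x, hx⟩ : ∃ x : ℂ, q.z + x * e - x ^ 2 * starRingEnd ℂ q.z = 0 := by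
    obtain ⟨s, hs⟩ := IsAlgClosed.exists_pow_nat_eq (e ^ 2 + 4 * q.z * starRingEnd ℂ q.z) two_pos
    refine ⟨(e + s) / (2 * starRingEnd ℂ q.z), ?_⟩
    field_simp
    linear_combination -hs
  let n : ℝ := Real.sqrt (1 + ‖x‖ ^ 2)
  have hn2 : n ^ 2 = 1 + ‖x‖ ^ 2 := Real.sq_sqrt (by positivity)
  have hn0 : n ≠ 0 := by
    intro h
    rw [h] at hn2
    nlinarith [sq_nonneg ‖x‖]
  have hnC : (n : ℂ) ≠ 0 := by exact_mod_cast hn0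
  have hxx : x * starRingEnd ℂ x = (n : ℂ) ^ 2 - 1 := by
    rw [Complex.mul_conj, Complex.normSq_eq_norm_sq, ← Complex.ofReal_pow n, hn2]
    push_cast
    ring
  let g : SL(2, ℂ) := ⟨!![(n : ℂ)⁻¹, x * (n : ℂ)⁻¹; -starRingEnd ℂ x * (n : ℂ)⁻¹, (n : ℂ)⁻¹], by
    rw [Matrix.det_fin_two_of]
    field_simp
    linear_combination hxx⟩
  have g00 : g 0 0 = (n : ℂ)⁻¹ := rfl
  have g01 : g 0 1 = x * (n : ℂ)⁻¹ := rfl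
  have g10 : g 1 0 = -starRingEnd ℂ x * (n : ℂ)⁻¹ := rfl
  have g11 : g 1 1 = (n : ℂ)⁻¹ := rfl
  have hcn : starRingEnd ℂ (n : ℂ)⁻¹ = (n : ℂ)⁻¹ := by rw [map_inv₀, Complex.conj_ofReal]
  refine ⟨g, ?_, ?_⟩
  · have hden : den g (vertical 0) = 1 := by
      apply Complex.ofReal_injective
      rw [den_coe, g10, g11, map_mul, map_neg, Complex.conj_conj, hcn]
      simp only [vertical, map_zero, mul_zero, zero_add, Real.exp_zero, Complex.ofReal_one]
      field_simp
      linear_combination hxx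
    ext1
    · rw [smul_z, hden, g00, g01, g10, g11]
      simp only [vertical, map_mul, map_neg, Complex.conj_conj, hcn, mul_zero, zero_add,
        Real.exp_zero, Complex.ofReal_one]
      ring
    · rw [smul_t, hden, div_one]
  · rw [smul_z, g00, g01, g10, g11, div_eq_zero_iff]
    left
    simp only [map_add, map_mul, map_neg, Complex.conj_conj, hcn]
    simp only [e] at hx
    linear_combination ((n : ℂ)⁻¹) ^ 2 * hx

theorem exists_smul_vertical_neg : ∃ g : SL(2, ℂ), ∀ u, g • vertical u = vertical (-u) := by
  let g : SL(2, ℂ) := ⟨!![0, -1; 1, 0], by rw [Matrix.det_fin_two_of]; ring⟩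
  have g00 : g 0 0 = 0 := rfl
  have g01 : g 0 1 = -1 := rfl
  have g10 : g 1 0 = 1 := rfl
  have g11 : g 1 1 = 0 := rfl
  refine ⟨g, fun u => ?_⟩
  have hden : den g (vertical u) = Real.exp u ^ 2 := by
    simp [den, g10, g11, vertical]
  ext1
  · rw [smul_z, g00, g01, g10, g11]
    simp [vertical]
  · rw [smul_t, hden]
    simp only [vertical, Real.exp_neg]
    have := Real.exp_ne_zero u
    field_simp

/-- Every complete geodesic can be moved to the vertical geodesic. -/
theorem exists_smul_eq_vertical {A : ℝ → UpperHalfSpace} (hA : IsGeodesicLine A) :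
    ∃ g : SL(2, ℂ), ∀ u, g • A u = vertical u := by
  obtain ⟨g₁, h₁⟩ := exists_smul_eq_vertical_zero (A 0)
  obtain ⟨g₂, h₂, h₂'⟩ := exists_rotation (g₁ • A 1)
  suffices h : ∃ g : SL(2, ℂ), g • A 0 = vertical 0 ∧ g • A 1 = vertical 1 by
    obtain ⟨g, h0, h1⟩ := h
    refine ⟨g, fun u => eq_vertical_of_dist zero_ne_one ?_ ?_⟩
    · rw [← h0, dist_smul_smul, hA]
    · rw [← h1, dist_smul_smul, hA]
  set q := g₂ • g₁ • A 1 with hq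
  have hg0 : g₂ • g₁ • A 0 = vertical 0 := by rw [h₁, h₂]
  have hqv : q = vertical (Real.log q.t) := by
    ext1
    · exact h₂'
    · simp [vertical, Real.exp_log q.t_pos]
  have hd : dist (vertical (Real.log q.t)) (vertical 0) = 1 := by
    rw [← hqv, ← hg0, hq, dist_smul_smul, dist_smul_smul, hA]
    simp
  rw [isGeodesicLine_vertical, sub_zero] at hd
  rcases eq_or_eq_neg_of_abs_eq hd with h | h
  · exact ⟨g₂ * g₁, by rw [mul_smul, hg0], by rw [mul_smul, ← hq, hqv, h]⟩
  · obtain ⟨g₃, h₃⟩ := exists_smul_vertical_neg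
    refine ⟨g₃ * (g₂ * g₁), ?_, ?_⟩
    · rw [mul_smul, mul_smul, hg0, h₃, neg_zero]
    · rw [mul_smul, mul_smul, ← hq, hqv, h, h₃, neg_neg]

/-- Complete geodesics with two common points coincide. -/
theorem IsGeodesicLine.eq_of_eq_of_eq {A B : ℝ → UpperHalfSpace} (hA : IsGeodesicLine A)
    (hB : IsGeodesicLine B) {s t : ℝ} (hst : s ≠ t) (hs : A s = B s) (ht : A t = B t) : A = B := by
  obtain ⟨g, hg⟩ := exists_smul_eq_vertical hA
  funext u
  have h : g • B u = vertical u := by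
    refine eq_vertical_of_dist hst ?_ ?_
    · rw [← hg s, hs, dist_smul_smul, hB]
    · rw [← hg t, ht, dist_smul_smul, hB]
  exact smul_left_cancel g ((hg u).trans h.symm)

/-- An element which translates a geodesic by `ℓ` has an eigenvalue of absolute value `e^(ℓ/2)`. -/
theorem exists_eigenvalue_of_translation {A : ℝ → UpperHalfSpace} (hA : IsGeodesicLine A) {ℓ : ℝ}
    {γ : SL(2, ℂ)} (hγ : ∀ t, γ • A t = A (t + ℓ)) :
    ∃ l : ℂ, ‖l‖ = Real.exp (ℓ / 2) ∧ (γ : Matrix (Fin 2) (Fin 2) ℂ).trace = l + l⁻¹ := by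
  obtain ⟨g, hg⟩ := exists_smul_eq_vertical hA
  let h := g * γ * g⁻¹
  have hh : ∀ u, h • vertical u = vertical (u + ℓ) := by
    intro u
    rw [← hg u, ← hg (u + ℓ), ← hγ, mul_smul, mul_smul, inv_smul_smul]
  have htr : (γ : Matrix (Fin 2) (Fin 2) ℂ).trace = (h : Matrix (Fin 2) (Fin 2) ℂ).trace := by
    rw [Matrix.SpecialLinearGroup.coe_mul, Matrix.SpecialLinearGroup.coe_mul, Matrix.trace_mul_cycle,
      ← Matrix.SpecialLinearGroup.coe_mul g⁻¹ g, inv_mul_cancel, Matrix.SpecialLinearGroup.coe_one,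
      one_mul]
  have hden : ∀ u, Complex.normSq (h 1 1) + Complex.normSq (h 1 0) * Real.exp u ^ 2 = Real.exp (-ℓ) := by
    intro u
    have h1 := congrArg UpperHalfSpace.t (hh u)
    rw [smul_t] at h1
    have h2 := den_pos h (vertical u)
    have h3 : den h (vertical u) = Complex.normSq (h 1 1) + Complex.normSq (h 1 0) * Real.exp u ^ 2 := by
      simp [den, vertical]
    rw [← h3, Real.exp_neg]
    change Real.exp u / _ = Real.exp (u + ℓ) at h1
    rw [Real.exp_add] at h1
    have := Real.exp_pos u
    have := Real.exp_pos ℓ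
    field_simp at h1 ⊢
    linarith
  have hc : h 1 0 = 0 := by
    have h0 := hden 0
    have h1 := hden 1
    rw [← Complex.normSq_eq_zero]
    have h2 : Complex.normSq (h 1 0) * (Real.exp 1 ^ 2 - Real.exp 0 ^ 2) = 0 := by linear_combination h1 - h0
    refine (mul_eq_zero.1 h2).resolve_right ?_
    have := Real.exp_one_gt_d9
    rw [Real.exp_zero]
    nlinarith
  have hdet := det_eq h
  rw [hc, mul_zero, sub_zero] at hdet
  refine ⟨h 0 0, ?_, ?_⟩
  · have h1 := hden 0
    rw [hc, map_zero, zero_mul, add_zero, Complex.normSq_eq_norm_sq] at h1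
    have h2 : ‖h 0 0‖ * ‖h 1 1‖ = 1 := by rw [← norm_mul, hdet, norm_one]
    have h3 : ‖h 0 0‖ ^ 2 = Real.exp (ℓ / 2) ^ 2 := by
      have h4 : ‖h 0 0‖ ^ 2 * ‖h 1 1‖ ^ 2 = 1 := by rw [← mul_pow, h2, one_pow]
      rw [h1, Real.exp_neg] at h4
      have := Real.exp_pos ℓ
      rw [← Real.exp_nat_mul]
      push_cast
      rw [mul_div_cancel₀ _ two_ne_zero]
      field_simp at h4
      linarith
    exact (pow_left_inj₀ (norm_nonneg _) (Real.exp_pos _).le two_ne_zero).1 h3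
  · rw [htr, Matrix.trace_fin_two, eq_inv_of_mul_eq_one_right hdet]

theorem smul_vertical_of_diagonal {g : SL(2, ℂ)} (h01 : g 0 1 = 0) (h10 : g 1 0 = 0) {ℓ : ℝ}
    (hℓ : ‖g 0 0‖ = Real.exp (ℓ / 2)) (u : ℝ) : g • vertical u = vertical (u + ℓ) := by
  have hdet := det_eq g
  rw [h10, mul_zero, sub_zero] at hdet
  have hden : den g (vertical u) = Real.exp (-ℓ) := by
    simp only [den, h10, zero_mul, zero_add, map_zero, add_zero]
    have h2 : ‖g 0 0‖ * ‖g 1 1‖ = 1 := by rw [← norm_mul, hdet, norm_one]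
    rw [Complex.normSq_eq_norm_sq, eq_inv_of_mul_eq_one_right h2, hℓ, ← Real.exp_neg, ← Real.exp_nat_mul]
    congr 1
    push_cast
    ring
  ext1
  · rw [smul_z, h01, h10]
    simp [vertical]
  · rw [smul_t, hden]
    simp only [vertical]
    rw [← Real.exp_sub, sub_neg_eq_add]

end UpperHalfSpace

/-! ### Ramification of quaternion algebras at real places -/

section Ramification

/-- A quaternion algebra over `ℝ` with a positive first parameter is split. -/
theorem nonempty_algEquiv_of_pos {x y : ℝ} (hx : 0 < x) (hy : y ≠ 0) :
    Nonempty (ℍ[ℝ,x,y] ≃ₐ[ℝ] Matrix (Fin 2) (Fin 2) ℝ) := by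
  have hs0 : √x ≠ 0 := (Real.sqrt_pos.2 hx).ne'
  have hs : √x * √x = x := Real.mul_self_sqrt hx.le
  let B : QuaternionAlgebra.Basis (Matrix (Fin 2) (Fin 2) ℝ) x 0 y :=
    { i := !![√x, 0; 0, -√x]
      j := !![0, y; 1, 0]
      k := !![0, √x * y; -√x, 0]
      i_mul_i := by
        ext i j
        fin_cases i <;> fin_cases j <;> simp [hs]
      j_mul_j := by
        ext i j
        fin_cases i <;> fin_cases j <;> simp
      i_mul_j := by
        ext i j
        fin_cases i <;> fin_cases j <;> simp
      j_mul_i := by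
        ext i j
        fin_cases i <;> fin_cases j <;> simp [mul_comm] }
  have hB : ∀ q, B.liftHom q = !![q.re + q.imI * √x, y * (q.imJ + q.imK * √x);
      q.imJ - q.imK * √x, q.re - q.imI * √x] := by
    intro q
    ext i j
    fin_cases i <;> fin_cases j <;>
      simp [B, QuaternionAlgebra.Basis.lift, Matrix.algebraMap_matrix_apply] <;> ring
  have hinj : Function.Injective B.liftHom.toLinearMap := by
    rw [← LinearMap.ker_eq_bot, LinearMap.ker_eq_bot']
    intro q hq
    have hq' : B.liftHom q = 0 := hq
    rw [hB] at hq'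
    have h00 := congrFun (congrFun hq' 0) 0
    have h01 := congrFun (congrFun hq' 0) 1
    have h10 := congrFun (congrFun hq' 1) 0
    have h11 := congrFun (congrFun hq' 1) 1
    simp only [Matrix.of_apply, Matrix.cons_val', Matrix.cons_val_zero, Matrix.cons_val_one,
      Matrix.zero_apply, Matrix.cons_val_fin_one] at h00 h01 h10 h11
    have h01' := (mul_eq_zero.1 h01).resolve_left hy
    have hI : q.imI * √x = 0 := by linarith
    have hK : q.imK * √x = 0 := by linarith
    ext
    · simp only [QuaternionAlgebra.re_zero]; linarith
    · exact (mul_eq_zero.1 hI).resolve_right hs0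
    · simp only [QuaternionAlgebra.imJ_zero]; linarith
    · exact (mul_eq_zero.1 hK).resolve_right hs0
  have hsurj := (LinearMap.injective_iff_surjective_of_finrank_eq_finrank (by
    rw [QuaternionAlgebra.finrank_eq_four, Module.finrank_matrix]; simp)).1 hinj
  exact ⟨AlgEquiv.ofBijective B.liftHom ⟨hinj, hsurj⟩⟩

variable {k : Type} [Field k] {a b : k}

theorem RamifiedAtReal.neg {σ : k →+* ℝ} (h : RamifiedAtReal a b σ) (ha : a ≠ 0) (hb : b ≠ 0) :
    σ a < 0 ∧ σ b < 0 := by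
  have ha' : σ a ≠ 0 := by simpa using ha
  have hb' : σ b ≠ 0 := by simpa using hb
  constructor
  · by_contra hn
    obtain ⟨θ⟩ := nonempty_algEquiv_of_pos (lt_of_le_of_ne (not_lt.1 hn) ha'.symm) hb'
    exact h.false θ
  · by_contra hn
    obtain ⟨θ⟩ := nonempty_algEquiv_of_pos (lt_of_le_of_ne (not_lt.1 hn) hb'.symm) ha'
    exact h.false ((QuaternionAlgebra.swapEquiv _ _).trans θ)

/-- A split quaternion algebra over `ℝ` has a positive parameter: the norm form of `(x, y / ℝ)` is
definite if `x, y < 0`, but a matrix algebra has nilpotent elements. -/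
theorem pos_or_pos_of_algEquiv {x y : ℝ} (hx : x ≠ 0) (hy : y ≠ 0)
    (θ : ℍ[ℝ,x,y] ≃ₐ[ℝ] Matrix (Fin 2) (Fin 2) ℝ) : 0 < x ∨ 0 < y := by
  by_contra! h
  have hx' : x < 0 := lt_of_le_of_ne h.1 hx
  have hy' : y < 0 := lt_of_le_of_ne h.2 hy
  set q := θ.symm !![0, 1; 0, 0] with hq
  have hqq : q * q = 0 := by
    rw [hq, ← map_mul, show (!![0, 1; 0, 0] : Matrix (Fin 2) (Fin 2) ℝ) * !![0, 1; 0, 0] = 0 by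
      ext i j; fin_cases i <;> fin_cases j <;> simp, map_zero]
  have hq0 : q ≠ 0 := by
    intro h0
    rw [hq, EmbeddingLike.map_eq_zero_iff] at h0
    simpa using congrFun (congrFun h0 0) 1
  have hN : q.re ^ 2 - x * q.imI ^ 2 - y * q.imJ ^ 2 + x * y * q.imK ^ 2 = 0 := by
    have h1 : star q * q = algebraMap ℝ ℍ[ℝ,x,y]
        (q.re ^ 2 - x * q.imI ^ 2 - y * q.imJ ^ 2 + x * y * q.imK ^ 2) := by
      ext <;> simp [QuaternionAlgebra.algebraMap_eq] <;> ring
    have h2 : star q * q * q = 0 := by rw [mul_assoc, hqq, mul_zero]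
    rw [h1, ← Algebra.smul_def] at h2
    exact (smul_eq_zero.1 h2).resolve_right hq0
  have hxy : 0 < x * y := mul_pos_of_neg_of_neg hx' hy'
  have e0 := sq_nonneg q.re
  have e1 := mul_nonneg (neg_nonneg.2 hx'.le) (sq_nonneg q.imI)
  have e2 := mul_nonneg (neg_nonneg.2 hy'.le) (sq_nonneg q.imJ)
  have e3 := mul_nonneg hxy.le (sq_nonneg q.imK)
  apply hq0
  ext
  · exact pow_eq_zero_iff two_ne_zero |>.1 (by linarith)
  · exact pow_eq_zero_iff two_ne_zero |>.1
      ((mul_eq_zero.1 (show x * q.imI ^ 2 = 0 by linarith)).resolve_left hx)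
  · exact pow_eq_zero_iff two_ne_zero |>.1
      ((mul_eq_zero.1 (show y * q.imJ ^ 2 = 0 by linarith)).resolve_left hy)
  · exact pow_eq_zero_iff two_ne_zero |>.1
      ((mul_eq_zero.1 (show x * y * q.imK ^ 2 = 0 by linarith)).resolve_left hxy.ne')

open NumberField in
/-- The ramification conditions which define arithmetic Kleinian groups. -/
theorem isSplitExactlyAt_of_kleinian [NumberField k] (hk : InfinitePlace.nrComplexPlaces k = 1)
    (ha : a ≠ 0) (hb : b ≠ 0) {φ : k →+* ℂ} (hφ : ¬ ComplexEmbedding.IsReal φ)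
    (hram : ∀ σ : k →+* ℝ, RamifiedAtReal a b σ) : IsSplitExactlyAt φ a b where
  ne_zero_left := ha
  ne_zero_right := hb
  ramified := by
    intro σ h1 h2
    have hσ : ComplexEmbedding.IsReal σ := by
      by_contra hσ
      have hsub : Subsingleton {w : InfinitePlace k // w.IsComplex} :=
        by
        classical
        exact Fintype.card_le_one_iff_subsingleton.1 hk.le
      have := hsub.elim ⟨InfinitePlace.mk φ, ⟨φ, hφ, rfl⟩⟩ ⟨InfinitePlace.mk σ, ⟨σ, hσ, rfl⟩⟩
      rcases InfinitePlace.mk_eq_iff.1 (Subtype.ext_iff.1 this) with h | h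
      · exact h1 h.symm
      · exact h2 h.symm
    exact ⟨hσ.embedding, fun x => (hσ.coe_embedding_apply x).symm, (hram _).neg ha hb⟩
  split := fun h => absurd (ComplexEmbedding.isReal_iff.2 h) hφ

open NumberField in
/-- The ramification conditions which define arithmetic Fuchsian groups. -/
theorem isSplitExactlyAt_of_fuchsian [NumberField k] [IsTotallyReal k]
    (ha : a ≠ 0) (hb : b ≠ 0) {φ : k →+* ℝ} (θ : ℍ[ℝ,φ a,φ b] ≃ₐ[ℝ] Matrix (Fin 2) (Fin 2) ℝ)
    (hram : ∀ σ : k →+* ℝ, σ ≠ φ → RamifiedAtReal a b σ) :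
    IsSplitExactlyAt (Complex.ofRealHom.comp φ) a b where
  ne_zero_left := ha
  ne_zero_right := hb
  ramified := by
    intro σ h1 _
    have hσ : ComplexEmbedding.IsReal σ := IsTotallyReal.complexEmbedding_isReal σ
    refine ⟨hσ.embedding, fun x => (hσ.coe_embedding_apply x).symm, (hram _ ?_).neg ha hb⟩
    rintro rfl
    apply h1
    ext x
    exact (hσ.coe_embedding_apply x).symm
  split := fun _ => ⟨φ, fun _ => rfl,
    pos_or_pos_of_algEquiv (by simpa using ha) (by simpa using hb) θ⟩

end Ramification

/-! ### Conjugation and extension of scalars of the splitting -/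

section Splitting

variable {k : Type} [Field k] [NumberField k] {a b : k}

/-- A conjugate of the group of a splitting is the group of a conjugate splitting. -/
theorem exists_normOneGroup_eq_conj {F : Type} [Field F] {φ : k →+* F}
    (θ : ℍ[F,φ a,φ b] ≃ₐ[F] Matrix (Fin 2) (Fin 2) F) {O : Subalgebra (𝓞 k) ℍ[k,a,b]}
    (hO : IsQuatOrder O) (g : PSL(2, F)) :
    ∃ θ' : ℍ[F,φ a,φ b] ≃ₐ[F] Matrix (Fin 2) (Fin 2) F,
      MulAut.conj g • normOneGroup φ θ O hO = normOneGroup φ θ' O hO := by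
  obtain ⟨h, rfl⟩ := QuotientGroup.mk'_surjective _ g
  have h1 : ((h⁻¹ : SL(2, F)) : Matrix (Fin 2) (Fin 2) F) * (h : Matrix (Fin 2) (Fin 2) F) = 1 := by
    rw [← Matrix.SpecialLinearGroup.coe_mul, inv_mul_cancel, Matrix.SpecialLinearGroup.coe_one]
  have h2 : (h : Matrix (Fin 2) (Fin 2) F) * ((h⁻¹ : SL(2, F)) : Matrix (Fin 2) (Fin 2) F) = 1 := by
    rw [← Matrix.SpecialLinearGroup.coe_mul, mul_inv_cancel, Matrix.SpecialLinearGroup.coe_one]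
  let u : (Matrix (Fin 2) (Fin 2) F)ˣ := ⟨h, (h⁻¹ : SL(2, F)), h2, h1⟩
  let c : Matrix (Fin 2) (Fin 2) F ≃ₐ[F] Matrix (Fin 2) (Fin 2) F :=
    MulSemiringAction.toAlgEquiv F _ (ConjAct.toConjAct u)
  have hc : ∀ M, c M = h * M * (h⁻¹ : SL(2, F)) := fun M => rfl
  refine ⟨θ.trans c, ?_⟩
  ext p
  rw [Subgroup.mem_pointwise_smul_iff_inv_smul_mem]
  constructor
  · rintro ⟨x, hx, hx1, γ, hγ, hp⟩
    refine ⟨x, hx, hx1, h * γ * h⁻¹, ?_, ?_⟩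
    · rw [AlgEquiv.trans_apply, hc, ← hγ]
      simp only [Matrix.SpecialLinearGroup.coe_mul]
    · rw [map_mul, map_mul, ← hp, map_inv]
      simp [← map_inv, MulAut.smul_def, mul_assoc]
  · rintro ⟨x, hx, hx1, γ, hγ, hp⟩
    refine ⟨x, hx, hx1, h⁻¹ * γ * h, ?_, ?_⟩
    · rw [AlgEquiv.trans_apply, hc] at hγ
      simp only [Matrix.SpecialLinearGroup.coe_mul]
      rw [hγ, mul_assoc, mul_assoc, h1, mul_one, ← mul_assoc, h1, one_mul]
    · rw [map_mul, map_mul, ← hp, map_inv]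
      simp [← map_inv, MulAut.smul_def, mul_assoc]

/-- Extension of scalars to `ℂ` of a splitting over `ℝ`. -/
theorem exists_complex_splitting {k : Type} [Field k] {a b : k} {φ : k →+* ℝ}
    (θ : ℍ[ℝ,φ a,φ b] ≃ₐ[ℝ] Matrix (Fin 2) (Fin 2) ℝ) :
    ∃ θ' : ℍ[ℂ,Complex.ofRealHom.comp φ a,Complex.ofRealHom.comp φ b] ≃ₐ[ℂ]
      Matrix (Fin 2) (Fin 2) ℂ, ∀ x, θ' (quatBaseChange (Complex.ofRealHom.comp φ) a b x) =
        (θ (quatBaseChange φ a b x)).map Complex.ofReal := by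
  let m : Matrix (Fin 2) (Fin 2) ℝ →ₐ[ℝ] Matrix (Fin 2) (Fin 2) ℂ := Complex.ofRealAm.mapMatrix
  let B := ((QuaternionAlgebra.Basis.self ℝ (c₁ := φ a) (c₂ := 0) (c₃ := φ b)).compHom
    θ.toAlgHom).compHom m
  let C : QuaternionAlgebra.Basis (Matrix (Fin 2) (Fin 2) ℂ) (Complex.ofRealHom.comp φ a) 0
      (Complex.ofRealHom.comp φ b) :=
    { i := B.i
      j := B.j
      k := B.k
      i_mul_i := by
        rw [B.i_mul_i, zero_smul, zero_smul]
        ext i j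
        simp
      j_mul_j := by
        rw [B.j_mul_j]
        ext i j
        simp
      i_mul_j := B.i_mul_j
      j_mul_i := by
        rw [B.j_mul_i, zero_smul, zero_smul] }
  have hC : ∀ q : ℍ[ℝ,φ a,φ b], C.liftHom ⟨q.re, q.imI, q.imJ, q.imK⟩ = m (θ q) := by
    intro q
    have h1 : q = algebraMap ℝ _ q.re + q.imI • (QuaternionAlgebra.Basis.self ℝ).i
        + q.imJ • (QuaternionAlgebra.Basis.self ℝ).j + q.imK • (QuaternionAlgebra.Basis.self ℝ).k := by
      ext <;> simp [QuaternionAlgebra.algebraMap_eq]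
    have h2 : m (θ q) = algebraMap ℝ _ q.re + q.imI • B.i + q.imJ • B.j + q.imK • B.k := by
      conv_lhs => rw [h1]
      simp only [map_add, map_smul, AlgEquiv.commutes, AlgHom.commutes]
      rfl
    rw [h2]
    change algebraMap ℂ _ (q.re : ℂ) + (q.imI : ℂ) • B.i + (q.imJ : ℂ) • B.j + (q.imK : ℂ) • B.k = _
    ext i j
    simp [Matrix.algebraMap_matrix_apply]
  have hreal : ∀ M : Matrix (Fin 2) (Fin 2) ℝ, ∃ q, C.liftHom q = M.map Complex.ofReal := by
    intro M
    obtain ⟨q, rfl⟩ := θ.surjective M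
    exact ⟨_, hC q⟩
  have hsurj : Function.Surjective C.liftHom.toLinearMap := by
    intro M
    obtain ⟨q, hq⟩ := hreal (M.map Complex.re)
    obtain ⟨r, hr⟩ := hreal (M.map Complex.im)
    refine ⟨q + Complex.I • r, ?_⟩
    change C.liftHom (q + Complex.I • r) = M
    rw [map_add, map_smul, hq, hr]
    ext i j
    simp [mul_comm Complex.I, Complex.re_add_im]
  have hinj := (LinearMap.injective_iff_surjective_of_finrank_eq_finrank (by
    rw [QuaternionAlgebra.finrank_eq_four, Module.finrank_matrix]; simp)).2 hsurj
  exact ⟨AlgEquiv.ofBijective C.liftHom ⟨hinj, hsurj⟩, fun x => hC (quatBaseChange φ a b x)⟩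

theorem pslInclusion_mk (g : SL(2, ℝ)) :
    pslInclusion (QuotientGroup.mk' (Subgroup.center SL(2, ℝ)) g) =
      QuotientGroup.mk' (Subgroup.center SL(2, ℂ))
        (Matrix.SpecialLinearGroup.map Complex.ofRealHom g) := rfl

theorem exists_map_normOneGroup_eq {φ : k →+* ℝ}
    (θ : ℍ[ℝ,φ a,φ b] ≃ₐ[ℝ] Matrix (Fin 2) (Fin 2) ℝ) {O : Subalgebra (𝓞 k) ℍ[k,a,b]}
    (hO : IsQuatOrder O) :
    ∃ θ' : ℍ[ℂ,Complex.ofRealHom.comp φ a,Complex.ofRealHom.comp φ b] ≃ₐ[ℂ]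
      Matrix (Fin 2) (Fin 2) ℂ,
      (normOneGroup φ θ O hO).map pslInclusion =
        normOneGroup (Complex.ofRealHom.comp φ) θ' O hO := by
  obtain ⟨θ', hθ'⟩ := exists_complex_splitting θ
  refine ⟨θ', ?_⟩
  ext p
  constructor
  · rintro ⟨_, ⟨x, hx, hx1, g, hg, rfl⟩, rfl⟩
    refine ⟨x, hx, hx1, Matrix.SpecialLinearGroup.map Complex.ofRealHom g, ?_, pslInclusion_mk g⟩
    rw [hθ', ← hg]
    rfl
  · rintro ⟨x, hx, hx1, g, hg, rfl⟩
    have hdet : (θ (quatBaseChange φ a b x)).det = 1 := by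
      apply Complex.ofReal_injective
      rw [Complex.ofReal_one, ← g.det_coe, hg, hθ']
      exact RingHom.map_det Complex.ofRealHom _
    let h : SL(2, ℝ) := ⟨_, hdet⟩
    refine ⟨QuotientGroup.mk' _ h, ⟨x, hx, hx1, h, rfl, rfl⟩, ?_⟩
    rw [pslInclusion_mk]
    congr 1
    apply Subtype.ext
    rw [hg, hθ']
    rfl

theorem pslInclusion_injective : Function.Injective pslInclusion := by
  rw [injective_iff_map_eq_one]
  intro p hp
  obtain ⟨g, rfl⟩ := QuotientGroup.mk'_surjective _ p
  rw [pslInclusion_mk, ← map_one (QuotientGroup.mk' (Subgroup.center SL(2, ℂ)))] at hp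
  have hcen : ∀ h : SL(2, ℝ), h = 1 ∨ h = -1 → QuotientGroup.mk' (Subgroup.center SL(2, ℝ)) h = 1 := by
    intro h hh
    rw [QuotientGroup.mk'_apply, QuotientGroup.eq_one_iff, Subgroup.mem_center_iff]
    rcases hh with rfl | rfl <;> intro <;> simp
  apply hcen
  rcases eq_or_eq_neg_of_mk_eq hp with h | h
  · left
    ext i j
    have := congrFun (congrFun h i) j
    apply Complex.ofReal_injective
    rw [Matrix.SpecialLinearGroup.map_apply_coe] at this
    fin_cases i <;> fin_cases j <;> simpa using this
  · right
    ext i j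
    have := congrFun (congrFun h i) j
    apply Complex.ofReal_injective
    rw [Matrix.SpecialLinearGroup.map_apply_coe] at this
    fin_cases i <;> fin_cases j <;> simpa using this

end Splitting

/-! ### Embedding of the hyperbolic plane in hyperbolic 3-space -/

namespace UpperHalfPlane

/-- The totally geodesic embedding of the hyperbolic plane onto the vertical half-plane over the
real line. -/
noncomputable def toUpperHalfSpace (w : UpperHalfPlane) : UpperHalfSpace := ⟨w.re, w.im, w.im_pos⟩

theorem toUpperHalfSpace_injective : Function.Injective toUpperHalfSpace := by
  intro v w h
  have h1 := Complex.ofReal_injective (congrArg UpperHalfSpace.z h)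
  exact UpperHalfPlane.ext_re_im h1 (congrArg UpperHalfSpace.t h)

theorem dist_toUpperHalfSpace (v w : UpperHalfPlane) :
    dist v.toUpperHalfSpace w.toUpperHalfSpace = dist v w := by
  rw [UpperHalfPlane.dist_eq, Complex.dist_eq_re_im]
  change 2 * Real.arsinh (√(‖(v.re : ℂ) - (w.re : ℂ)‖ ^ 2 + (v.im - w.im) ^ 2) / _) = _
  rw [← Complex.ofReal_sub, Complex.norm_real, Real.norm_eq_abs, sq_abs]
  rfl

theorem toUpperHalfSpace_smul (g : SL(2, ℝ)) (w : UpperHalfPlane) :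
    (g • w).toUpperHalfSpace =
      Matrix.SpecialLinearGroup.map Complex.ofRealHom g • w.toUpperHalfSpace := by
  set G := Matrix.SpecialLinearGroup.map Complex.ofRealHom g with hG
  have hGij : ∀ i j, G i j = (g i j : ℂ) := fun i j => rfl
  have hden : UpperHalfSpace.den G w.toUpperHalfSpace = Complex.normSq (g 1 0 * w + g 1 1) := by
    simp only [UpperHalfSpace.den, hGij, toUpperHalfSpace, ← Complex.ofReal_mul,
      ← Complex.ofReal_add, Complex.normSq_ofReal]
    simp [Complex.normSq_apply]
    ring
  have hpos := UpperHalfSpace.den_pos G w.toUpperHalfSpace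
  rw [hden] at hpos
  have hne : (g 1 0 : ℂ) * w + g 1 1 ≠ 0 := Complex.normSq_pos.1 hpos
  have hre : (g • w).re = ((g 0 0 * w.re + g 0 1) * (g 1 0 * w.re + g 1 1) + g 0 0 * g 1 0 * w.im ^ 2) /
      Complex.normSq (g 1 0 * w + g 1 1) := by
    rw [← UpperHalfPlane.coe_re, UpperHalfPlane.coe_specialLinearGroup_apply, Complex.div_re]
    simp
    ring
  have him : (g • w).im = w.im / Complex.normSq (g 1 0 * w + g 1 1) := by
    have hdet : g 0 0 * g 1 1 - g 0 1 * g 1 0 = 1 := by rw [← Matrix.det_fin_two, g.det_coe]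
    rw [← UpperHalfPlane.coe_im, UpperHalfPlane.coe_specialLinearGroup_apply, Complex.div_im,
      ← sub_div]
    congr 1
    simp
    linear_combination w.im * hdet
  ext1
  · rw [UpperHalfSpace.smul_z, hden]
    change (((g • w).re : ℝ) : ℂ) = _
    rw [hre]
    simp only [hGij, toUpperHalfSpace, map_add, map_mul, Complex.conj_ofReal]
    push_cast
    ring
  · rw [UpperHalfSpace.smul_t, hden]
    exact him

theorem _root_.IsGeodesicLine.toUpperHalfSpace {A : ℝ → UpperHalfPlane} (hA : IsGeodesicLine A) :
    IsGeodesicLine fun t => (A t).toUpperHalfSpace := by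
  intro s t
  rw [dist_toUpperHalfSpace, hA]

theorem dist_SL_smul (g : SL(2, ℝ)) (v w : UpperHalfPlane) : dist (g • v) (g • w) = dist v w := by
  rw [← dist_toUpperHalfSpace, toUpperHalfSpace_smul, toUpperHalfSpace_smul,
    UpperHalfSpace.dist_smul_smul, dist_toUpperHalfSpace]

theorem eq_of_eq_of_eq_of_isGeodesicLine {A B : ℝ → UpperHalfPlane} (hA : IsGeodesicLine A)
    (hB : IsGeodesicLine B) {s t : ℝ} (hst : s ≠ t) (hs : A s = B s) (ht : A t = B t) : A = B := by
  have h := UpperHalfSpace.IsGeodesicLine.eq_of_eq_of_eq hA.toUpperHalfSpace hB.toUpperHalfSpace hst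
    (congrArg toUpperHalfSpace hs) (congrArg toUpperHalfSpace ht)
  exact funext fun u => toUpperHalfSpace_injective (congrFun h u)

/-- The geodesic `u ↦ i e^u`. -/
noncomputable def vertical (u : ℝ) : UpperHalfPlane :=
  ⟨⟨0, Real.exp u⟩, Real.exp_pos u⟩

theorem isGeodesicLine_vertical : IsGeodesicLine vertical := by
  intro s t
  rw [← dist_toUpperHalfSpace]
  exact UpperHalfSpace.isGeodesicLine_vertical s t

theorem smul_vertical_of_diagonal {g : SL(2, ℝ)} (h01 : g 0 1 = 0) (h10 : g 1 0 = 0) {ℓ : ℝ}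
    (hℓ : ‖g 0 0‖ = Real.exp (ℓ / 2)) (u : ℝ) : g • vertical u = vertical (u + ℓ) := by
  apply toUpperHalfSpace_injective
  rw [toUpperHalfSpace_smul]
  apply UpperHalfSpace.smul_vertical_of_diagonal
  · exact congrArg Complex.ofReal h01
  · exact congrArg Complex.ofReal h10
  · exact (Complex.norm_real _).trans hℓ

end UpperHalfPlane

/-! ### Closed geodesics and translations -/

section Translation

/-- An element of `SL(2, F)` with eigenvalues `l ≠ l⁻¹` in `F` is diagonalizable in `SL(2, F)`. -/
theorem exists_conj_diagonal {F : Type*} [Field F] {g : SL(2, F)} {l : F} (hl : l ≠ 0)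
    (hl2 : l ≠ l⁻¹) (htr : (g : Matrix (Fin 2) (Fin 2) F).trace = l + l⁻¹) :
    ∃ h : SL(2, F), (h * g * h⁻¹) 0 0 = l ∧ (h * g * h⁻¹) 0 1 = 0 ∧ (h * g * h⁻¹) 1 0 = 0 := by
  have hdet : g 0 0 * g 1 1 - g 0 1 * g 1 0 = 1 := by rw [← Matrix.det_fin_two, g.det_coe]
  rw [Matrix.trace_fin_two] at htr
  have hll : l * l⁻¹ = 1 := mul_inv_cancel₀ hl
  -- it suffices to find independent left eigenvectors, which are the rows of `h`
  suffices H : ∃ v w : Fin 2 → F, v 0 * w 1 - v 1 * w 0 ≠ 0 ∧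
      (v 0 * g 0 0 + v 1 * g 1 0 = l * v 0 ∧ v 0 * g 0 1 + v 1 * g 1 1 = l * v 1) ∧
      (w 0 * g 0 0 + w 1 * g 1 0 = l⁻¹ * w 0 ∧ w 0 * g 0 1 + w 1 * g 1 1 = l⁻¹ * w 1) by
    obtain ⟨v, w, hd, ⟨hv0, hv1⟩, hw0, hw1⟩ := H
    set d := v 0 * w 1 - v 1 * w 0 with hd'
    let h : SL(2, F) := ⟨!![v 0, v 1; d⁻¹ * w 0, d⁻¹ * w 1], by
      rw [Matrix.det_fin_two_of]
      have : d⁻¹ * d = 1 := inv_mul_cancel₀ hd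
      linear_combination this + d⁻¹ * hd'⟩
    let D : SL(2, F) := ⟨!![l, 0; 0, l⁻¹], by rw [Matrix.det_fin_two_of]; simpa using hll⟩
    have hgD : h * g = D * h := by
      apply Subtype.ext
      rw [Matrix.SpecialLinearGroup.coe_mul, Matrix.SpecialLinearGroup.coe_mul]
      change !![v 0, v 1; d⁻¹ * w 0, d⁻¹ * w 1] * (g : Matrix (Fin 2) (Fin 2) F) =
        !![l, 0; 0, l⁻¹] * !![v 0, v 1; d⁻¹ * w 0, d⁻¹ * w 1]
      ext i j
      fin_cases i <;> fin_cases j <;> simp [Matrix.mul_apply, Fin.sum_univ_two]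
      · exact hv0
      · exact hv1
      · linear_combination d⁻¹ * hw0
      · linear_combination d⁻¹ * hw1
    refine ⟨h, ?_⟩
    rw [hgD, mul_inv_cancel_right]
    exact ⟨rfl, rfl, rfl⟩
  by_cases hr : g 1 0 = 0
  · have hpu : (g 0 0 - l) * (g 0 0 - l⁻¹) = 0 := by
      rw [hr] at hdet
      linear_combination g 0 0 * htr - hdet + hll
    rcases mul_eq_zero.1 hpu with h | h
    · have hp := sub_eq_zero.1 h
      have hu : g 1 1 = l⁻¹ := by rw [hp] at htr; exact add_left_cancel htr
      refine ⟨![l - l⁻¹, g 0 1], ![0, 1], ?_, ⟨?_, ?_⟩, ?_, ?_⟩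
      · simpa using sub_ne_zero.2 hl2
      all_goals simp [hr, hp, hu]
      all_goals ring
    · have hp := sub_eq_zero.1 h
      have hu : g 1 1 = l := by rw [hp] at htr; linear_combination htr
      refine ⟨![0, 1], ![l⁻¹ - l, g 0 1], ?_, ⟨?_, ?_⟩, ?_, ?_⟩
      · simpa using sub_ne_zero.2 hl2
      all_goals simp [hr, hp, hu]
      all_goals ring
  · refine ⟨![g 1 0, l - g 0 0], ![g 1 0, l⁻¹ - g 0 0], ?_, ⟨?_, ?_⟩, ?_, ?_⟩
    · have : g 1 0 * (l⁻¹ - g 0 0) - (l - g 0 0) * g 1 0 = g 1 0 * (l⁻¹ - l) := by ring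
      simpa [this] using ⟨hr, sub_ne_zero.2 hl2.symm⟩
    · simp; ring
    · simp
      linear_combination l * htr - hdet + hll
    · simp; ring
    · simp
      linear_combination l⁻¹ * htr - hdet + hll

theorem countable_preimageSL {F : Type} [Field F] {Γ : Subgroup PSL(2, F)} (hΓ : Countable Γ) :
    Countable (preimageSL Γ) := by
  choose s hs using QuotientGroup.mk'_surjective (Subgroup.center SL(2, F))
  have h : ((preimageSL Γ : Subgroup SL(2, F)) : Set SL(2, F)) ⊆
      ⋃ p : Γ, {s p, -s p} := by
    intro g hg
    refine Set.mem_iUnion.2 ⟨⟨_, hg⟩, ?_⟩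
    rcases eq_or_eq_neg_of_mk_eq (hs (QuotientGroup.mk' (Subgroup.center SL(2, F)) g)) with e | e
    · left
      exact Subtype.ext e.symm
    · right
      rw [Set.mem_singleton_iff]
      apply Subtype.ext
      rw [Matrix.SpecialLinearGroup.coe_neg, e, neg_neg]
  exact ((Set.countable_iUnion fun p => (Set.toFinite _).countable).mono h).to_subtype

variable {F : Type} [Field F] {X : Type} [MulAction SL(2, F) X] [Dist X]

/-- A closed geodesic of length `ℓ` is covered by a line which some element of the group translates
by `ℓ`. -/
theorem IsClosedGeodesic.exists_translation
    (hiso : ∀ (g : SL(2, F)) (x y : X), dist (g • x) (g • y) = dist x y)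
    (huniq : ∀ A B : ℝ → X, IsGeodesicLine A → IsGeodesicLine B →
      ∀ s t : ℝ, s ≠ t → A s = B s → A t = B t → A = B)
    {Γ : Subgroup PSL(2, F)} (hΓ : Countable Γ) {ℓ : ℝ} {c : AddCircle ℓ → HypOrbifold X Γ}
    (hc : IsClosedGeodesic c) :
    0 < ℓ ∧ ∃ A : ℝ → X, IsGeodesicLine A ∧ (∀ t : ℝ, c (t : AddCircle ℓ) = HypOrbifold.mk X Γ (A t)) ∧
      ∃ γ : SL(2, F), QuotientGroup.mk' (Subgroup.center SL(2, F)) γ ∈ Γ ∧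
        ∀ t, γ • A t = A (t + ℓ) := by
  obtain ⟨hℓ, A, hA, hcA⟩ := hc
  refine ⟨hℓ, A, hA, hcA, ?_⟩
  have h1 : ∀ t, ∃ γ : preimageSL Γ, γ • A t = A (t + ℓ) := by
    intro t
    have h : HypOrbifold.mk X Γ (A (t + ℓ)) = HypOrbifold.mk X Γ (A t) := by
      rw [← hcA, ← hcA, AddCircle.coe_add, AddCircle.coe_period, add_zero]
    exact Quotient.exact h
  choose γ hγ using h1
  have hcount := countable_preimageSL hΓ
  -- uncountably many points of the line, countably many group elements
  obtain ⟨s, t, hst, hne⟩ := Function.not_injective_iff.1 fun h : Function.Injective γ =>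
    not_countable_iff.2 (inferInstanceAs (Uncountable ℝ)) h.countable
  refine ⟨γ s, (γ s).2, fun u => ?_⟩
  have h2 : IsGeodesicLine fun u => (γ s : SL(2, F)) • A u := fun u v => by rw [hiso, hA]
  have h3 : IsGeodesicLine fun u => A (u + ℓ) := fun u v => by rw [hA, add_sub_add_right_eq_sub]
  exact congrFun (huniq _ _ h2 h3 s t hne (hγ s) (by rw [hst]; exact hγ t)) u

/-- A translation in `Γ'` along a line closes up the image of the line in `X / Γ'`. -/
theorem exists_isClosedGeodesic {Γ' : Subgroup PSL(2, F)} {ℓ : ℝ} (hℓ : 0 < ℓ) {A : ℝ → X}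
    (hA : IsGeodesicLine A) {γ : SL(2, F)}
    (hγ : QuotientGroup.mk' (Subgroup.center SL(2, F)) γ ∈ Γ') (hγA : ∀ t, γ • A t = A (t + ℓ)) :
    ∃ c : AddCircle ℓ → HypOrbifold X Γ', IsClosedGeodesic c ∧
      ∀ t : ℝ, c (t : AddCircle ℓ) = HypOrbifold.mk X Γ' (A t) := by
  have hper : Function.Periodic (fun t => HypOrbifold.mk X Γ' (A t)) ℓ := fun t =>
    Quotient.sound ⟨⟨γ, hγ⟩, hγA t⟩
  exact ⟨hper.lift, ⟨hℓ, A, hA, fun t => rfl⟩, fun t => rfl⟩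

theorem liftsToCover_of_translation {Γ' Γ : Subgroup PSL(2, F)} (h : Γ' ≤ Γ) {ℓ : ℝ} (hℓ : 0 < ℓ)
    {c : AddCircle ℓ → HypOrbifold X Γ} {A : ℝ → X} (hA : IsGeodesicLine A)
    (hc : ∀ t : ℝ, c (t : AddCircle ℓ) = HypOrbifold.mk X Γ (A t)) {γ : SL(2, F)}
    (hγ : QuotientGroup.mk' (Subgroup.center SL(2, F)) γ ∈ Γ') (hγA : ∀ t, γ • A t = A (t + ℓ)) :
    LiftsToCover h c := by
  obtain ⟨c', hc', hc'A⟩ := exists_isClosedGeodesic hℓ hA hγ hγA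
  refine ⟨c', hc', fun t => ?_⟩
  induction t using QuotientAddGroup.induction_on with
  | H t =>
    exact (congrArg _ (hc'A t)).trans (hc t).symm

theorem closedGeodesicLengths_mono {Γ' Γ : Subgroup PSL(2, F)} (h : Γ' ≤ Γ) :
    closedGeodesicLengths X Γ' ⊆ closedGeodesicLengths X Γ := by
  rintro ℓ ⟨c, hℓ, A, hA, hc⟩
  exact ⟨fun t => HypOrbifold.cover X h (c t), hℓ, A, hA, fun t => congrArg _ (hc t)⟩

/-- If the length spectrum is nonempty and discrete, and closed geodesics lift to finite manifold
covers, then there are a systole and a finite manifold cover with the same systole. -/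
theorem exists_isSystole_of_lifts {Γ : Subgroup PSL(2, F)}
    (hne : (closedGeodesicLengths X Γ).Nonempty)
    (hfin : ∀ L, {ℓ ∈ closedGeodesicLengths X Γ | ℓ ≤ L}.Finite)
    (hlift : ∀ (ℓ : ℝ) (c : AddCircle ℓ → HypOrbifold X Γ), IsClosedGeodesic c →
      ∃ (Γ' : Subgroup PSL(2, F)) (h : IsFiniteManifoldCover Γ' Γ), LiftsToCover h.le c) :
    ∃ s : ℝ, IsSystole X Γ s ∧ ∃ Γ' : Subgroup PSL(2, F), IsFiniteManifoldCover Γ' Γ ∧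
      IsSystole X Γ' s := by
  obtain ⟨L, hL⟩ := hne
  obtain ⟨s, ⟨hs, hsL⟩, hmin⟩ :=
    Set.exists_min_image {ℓ ∈ closedGeodesicLengths X Γ | ℓ ≤ L} id (hfin L) ⟨L, hL, le_rfl⟩
  have hsys : IsSystole X Γ s := by
    refine ⟨hs, fun ℓ hℓ => ?_⟩
    rcases le_total ℓ L with h | h
    · exact hmin ℓ ⟨hℓ, h⟩
    · exact hsL.trans h
  obtain ⟨c, hc⟩ := hs
  obtain ⟨Γ', hΓ', c', hc', -⟩ := hlift s c hc
  exact ⟨s, hsys, Γ', hΓ', ⟨c', hc'⟩, fun ℓ hℓ => hsys.2 (closedGeodesicLengths_mono hΓ'.le hℓ)⟩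

end Translation

/-! ### Arithmetic orbifolds -/

section ArithmeticOrbifolds

/-- Arithmetic Kleinian groups are commensurable with the norm one group of an order, and not only
in the wide sense. -/
theorem IsArithmeticKleinian.exists_commensurable {Γ : Subgroup PSL(2, ℂ)}
    (h : IsArithmeticKleinian Γ) :
    ∃ (k : Type) (_ : Field k) (_ : NumberField k) (a b : k) (φ : k →+* ℂ)
      (θ : ℍ[ℂ,φ a,φ b] ≃ₐ[ℂ] Matrix (Fin 2) (Fin 2) ℂ) (O : Subalgebra (𝓞 k) ℍ[k,a,b])
      (hO : IsQuatOrder O), IsSplitExactlyAt φ a b ∧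
        Subgroup.Commensurable Γ (normOneGroup φ θ O hO) := by
  obtain ⟨k, _, _, hk, a, b, ha, hb, φ, hφ, θ, hram, O, hO, g, hg⟩ := h
  obtain ⟨θ', hθ'⟩ := exists_normOneGroup_eq_conj θ hO.prop g
  exact ⟨k, _, _, a, b, φ, θ', O, hO.prop, isSplitExactlyAt_of_kleinian hk ha hb hφ hram, hθ' ▸ hg⟩

theorem IsArithmeticFuchsian.exists_commensurable {Γ : Subgroup PSL(2, ℝ)}
    (h : IsArithmeticFuchsian Γ) :
    ∃ (k : Type) (_ : Field k) (_ : NumberField k) (a b : k) (φ : k →+* ℂ)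
      (θ : ℍ[ℂ,φ a,φ b] ≃ₐ[ℂ] Matrix (Fin 2) (Fin 2) ℂ) (O : Subalgebra (𝓞 k) ℍ[k,a,b])
      (hO : IsQuatOrder O), IsSplitExactlyAt φ a b ∧
        Subgroup.Commensurable (Γ.map pslInclusion) (normOneGroup φ θ O hO) := by
  obtain ⟨k, _, _, hk, a, b, ha, hb, φ, θ, hram, O, hO, g, hg⟩ := h
  obtain ⟨θ₁, hθ₁⟩ := exists_map_normOneGroup_eq θ hO.prop
  rw [hθ₁] at hg
  obtain ⟨θ₂, hθ₂⟩ := exists_normOneGroup_eq_conj θ₁ hO.prop g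
  exact ⟨k, _, _, a, b, _, θ₂, O, hO.prop, isSplitExactlyAt_of_fuchsian ha hb θ hram, hθ₂ ▸ hg⟩

theorem one_lt_norm_of_norm_eq_exp {l : ℂ} {ℓ : ℝ} (hℓ : 0 < ℓ) (hl : ‖l‖ = Real.exp (ℓ / 2)) :
    1 < ‖l‖ := by
  rw [hl]
  exact Real.one_lt_exp_iff.2 (half_pos hℓ)

theorem ne_inv_of_one_lt_norm {𝕜 : Type*} [NormedField 𝕜] {l : 𝕜} (hl : 1 < ‖l‖) : l ≠ l⁻¹ := by
  intro h
  have h1 : ‖l‖ = ‖l‖⁻¹ := by rw [← norm_inv, ← h]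
  have h2 := inv_lt_one_of_one_lt₀ hl
  linarith

theorem norm_eq_exp_two_mul_log {r : ℝ} (hr : 1 < r) : r = Real.exp (2 * Real.log r / 2) := by
  rw [mul_div_cancel_left₀ _ two_ne_zero, Real.exp_log (by linarith)]

theorem IsArithmeticKleinian.lifts {Γ : Subgroup PSL(2, ℂ)} (hΓ : IsArithmeticKleinian Γ) (ℓ : ℝ)
    (c : AddCircle ℓ → HypOrbifold UpperHalfSpace Γ) (hc : IsClosedGeodesic c) :
    ∃ (Γ' : Subgroup PSL(2, ℂ)) (h : IsFiniteManifoldCover Γ' Γ), LiftsToCover h.le c := by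
  obtain ⟨k, _, _, a, b, φ, θ, O, hO, hsplit, hcom⟩ := hΓ.exists_commensurable
  obtain ⟨hℓ, A, hA, hcA, γ, hγ, hγA⟩ := hc.exists_translation UpperHalfSpace.dist_smul_smul
    (fun A B hA hB s t hst hs ht => UpperHalfSpace.IsGeodesicLine.eq_of_eq_of_eq hA hB hst hs ht)
    (countable_of_commensurable_normOneGroup hcom)
  obtain ⟨l, hl, htr⟩ := UpperHalfSpace.exists_eigenvalue_of_translation hA hγA
  obtain ⟨Γ', hle, hidx, hmem, htf⟩ := exists_torsionFree_subgroup hsplit hcom hγ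
    (one_lt_norm_of_norm_eq_exp hℓ hl) htr
  exact ⟨Γ', ⟨hle, hidx, htf⟩, liftsToCover_of_translation hle hℓ hA hcA hmem hγA⟩

theorem IsArithmeticKleinian.nonempty_lengths {Γ : Subgroup PSL(2, ℂ)}
    (hΓ : IsArithmeticKleinian Γ) : (closedGeodesicLengths UpperHalfSpace Γ).Nonempty := by
  obtain ⟨k, _, _, a, b, φ, θ, O, hO, hsplit, hcom⟩ := hΓ.exists_commensurable
  obtain ⟨γ, hγ, l, hl, htr⟩ := exists_loxodromic hsplit hcom
  obtain ⟨h, h00, h01, h10⟩ := exists_conj_diagonal (norm_pos_iff.1 (zero_lt_one.trans hl))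
    (ne_inv_of_one_lt_norm hl) htr
  have hA : IsGeodesicLine fun t => h⁻¹ • UpperHalfSpace.vertical t := fun s t => by
    rw [UpperHalfSpace.dist_smul_smul, UpperHalfSpace.isGeodesicLine_vertical]
  obtain ⟨c, hc, -⟩ := exists_isClosedGeodesic (ℓ := 2 * Real.log ‖l‖)
    (mul_pos two_pos (Real.log_pos hl)) hA hγ fun t => by
      rw [← UpperHalfSpace.smul_vertical_of_diagonal h01 h10
        (by rw [h00]; exact norm_eq_exp_two_mul_log hl), mul_smul, mul_smul, inv_smul_smul]
  exact ⟨_, c, hc⟩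

theorem IsArithmeticKleinian.finite_lengths {Γ : Subgroup PSL(2, ℂ)}
    (hΓ : IsArithmeticKleinian Γ) (L : ℝ) :
    {ℓ ∈ closedGeodesicLengths UpperHalfSpace Γ | ℓ ≤ L}.Finite := by
  obtain ⟨k, _, _, a, b, φ, θ, O, hO, hsplit, hcom⟩ := hΓ.exists_commensurable
  refine (finite_translation_lengths hsplit hcom L).subset ?_
  rintro ℓ ⟨⟨c, hc⟩, hL⟩
  obtain ⟨hℓ, A, hA, -, γ, hγ, hγA⟩ := hc.exists_translation UpperHalfSpace.dist_smul_smul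
    (fun A B hA hB s t hst hs ht => UpperHalfSpace.IsGeodesicLine.eq_of_eq_of_eq hA hB hst hs ht)
    (countable_of_commensurable_normOneGroup hcom)
  exact ⟨hℓ, hL, γ, hγ, UpperHalfSpace.exists_eigenvalue_of_translation hA hγA⟩

theorem countable_of_countable_map {Γ : Subgroup PSL(2, ℝ)} (h : Countable (Γ.map pslInclusion)) :
    Countable Γ :=
  (Γ.equivMapOfInjective pslInclusion pslInclusion_injective).injective.countable

/-- The translation along a closed geodesic of a Fuchsian group, considered in `PSL(2, ℂ)`. -/
theorem IsClosedGeodesic.exists_translation_fuchsian {Γ : Subgroup PSL(2, ℝ)} (hΓ : Countable Γ)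
    {ℓ : ℝ} {c : AddCircle ℓ → HypOrbifold UpperHalfPlane Γ} (hc : IsClosedGeodesic c) :
    0 < ℓ ∧ ∃ A : ℝ → UpperHalfPlane, IsGeodesicLine A ∧
      (∀ t : ℝ, c (t : AddCircle ℓ) = HypOrbifold.mk UpperHalfPlane Γ (A t)) ∧
      ∃ γ : SL(2, ℝ), QuotientGroup.mk' (Subgroup.center SL(2, ℝ)) γ ∈ Γ ∧
        (∀ t, γ • A t = A (t + ℓ)) ∧ ∃ l : ℂ, ‖l‖ = Real.exp (ℓ / 2) ∧
          (Matrix.SpecialLinearGroup.map Complex.ofRealHom γ : Matrix (Fin 2) (Fin 2) ℂ).trace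
            = l + l⁻¹ := by
  obtain ⟨hℓ, A, hA, hcA, γ, hγ, hγA⟩ := hc.exists_translation UpperHalfPlane.dist_SL_smul
    (fun A B hA hB s t hst hs ht =>
      UpperHalfPlane.eq_of_eq_of_eq_of_isGeodesicLine hA hB hst hs ht) hΓ
  refine ⟨hℓ, A, hA, hcA, γ, hγ, hγA,
    UpperHalfSpace.exists_eigenvalue_of_translation hA.toUpperHalfSpace fun t => ?_⟩
  rw [← UpperHalfPlane.toUpperHalfSpace_smul, hγA]

theorem IsArithmeticFuchsian.lifts {Γ : Subgroup PSL(2, ℝ)} (hΓ : IsArithmeticFuchsian Γ) (ℓ : ℝ)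
    (c : AddCircle ℓ → HypOrbifold UpperHalfPlane Γ) (hc : IsClosedGeodesic c) :
    ∃ (Γ' : Subgroup PSL(2, ℝ)) (h : IsFiniteManifoldCover Γ' Γ), LiftsToCover h.le c := by
  obtain ⟨k, _, _, a, b, φ, θ, O, hO, hsplit, hcom⟩ := hΓ.exists_commensurable
  obtain ⟨hℓ, A, hA, hcA, γ, hγ, hγA, l, hl, htr⟩ := hc.exists_translation_fuchsian
    (countable_of_countable_map (countable_of_commensurable_normOneGroup hcom))
  obtain ⟨G', hle, hidx, hmem, htf⟩ := exists_torsionFree_subgroup hsplit hcom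
    (Subgroup.mem_map_of_mem pslInclusion hγ) (one_lt_norm_of_norm_eq_exp hℓ hl) htr
  have hle' : G'.comap pslInclusion ≤ Γ := by
    intro p hp
    obtain ⟨q, hq, hqp⟩ := hle hp
    rwa [← pslInclusion_injective hqp]
  refine ⟨G'.comap pslInclusion, ⟨hle', ?_, ?_⟩,
    liftsToCover_of_translation hle' hℓ hA hcA hmem hγA⟩
  · rwa [Subgroup.relIndex_comap]
  · intro g hg hfin
    apply pslInclusion_injective
    rw [map_one]
    exact htf _ hg (MonoidHom.isOfFinOrder pslInclusion hfin)

theorem IsArithmeticFuchsian.finite_lengths {Γ : Subgroup PSL(2, ℝ)}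
    (hΓ : IsArithmeticFuchsian Γ) (L : ℝ) :
    {ℓ ∈ closedGeodesicLengths UpperHalfPlane Γ | ℓ ≤ L}.Finite := by
  obtain ⟨k, _, _, a, b, φ, θ, O, hO, hsplit, hcom⟩ := hΓ.exists_commensurable
  refine (finite_translation_lengths hsplit hcom L).subset ?_
  rintro ℓ ⟨⟨c, hc⟩, hL⟩
  obtain ⟨hℓ, -, -, -, γ, hγ, -, h⟩ := hc.exists_translation_fuchsian
    (countable_of_countable_map (countable_of_commensurable_normOneGroup hcom))
  exact ⟨hℓ, hL, _, Subgroup.mem_map_of_mem pslInclusion hγ, h⟩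

/-- If `l + l⁻¹` is real and `|l| > 1` then `l` is real: otherwise the conjugate of `l` would be the
other root `l⁻¹` of the same real quadratic polynomial. -/
theorem exists_ofReal_of_add_inv {l : ℂ} (hl : 1 < ‖l‖) {τ : ℝ} (h : (τ : ℂ) = l + l⁻¹) :
    ∃ r : ℝ, l = r := by
  have hl0 : l ≠ 0 := norm_pos_iff.1 (zero_lt_one.trans hl)
  set m := starRingEnd ℂ l with hm
  have hm0 : m ≠ 0 := by simpa [hm] using hl0
  have h1 : (τ : ℂ) = m + m⁻¹ := by
    have := congrArg (starRingEnd ℂ) h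
    simpa [hm] using this
  have h2 : (m - l) * (m * l - 1) = 0 := by
    rw [h] at h1
    field_simp at h1
    linear_combination -h1
  rcases mul_eq_zero.1 h2 with h3 | h3
  · exact ⟨l.re, (Complex.conj_eq_iff_re.1 (sub_eq_zero.1 h3)).symm⟩
  · have h4 := congrArg norm (sub_eq_zero.1 h3)
    rw [norm_mul, hm, Complex.norm_conj, norm_one] at h4
    nlinarith

theorem IsArithmeticFuchsian.nonempty_lengths {Γ : Subgroup PSL(2, ℝ)}
    (hΓ : IsArithmeticFuchsian Γ) : (closedGeodesicLengths UpperHalfPlane Γ).Nonempty := by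
  obtain ⟨k, _, _, a, b, φ, θ, O, hO, hsplit, hcom⟩ := hΓ.exists_commensurable
  obtain ⟨g, ⟨p, hp, hpg⟩, l, hl, htr⟩ := exists_loxodromic hsplit hcom
  obtain ⟨γ, rfl⟩ := QuotientGroup.mk'_surjective _ p
  rw [pslInclusion_mk] at hpg
  have htrγ : (Matrix.SpecialLinearGroup.map Complex.ofRealHom γ : Matrix (Fin 2) (Fin 2) ℂ).trace =
      (((γ : Matrix (Fin 2) (Fin 2) ℝ).trace : ℝ) : ℂ) := by
    rw [Matrix.trace_fin_two, Matrix.trace_fin_two, Complex.ofReal_add]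
    rfl
  obtain ⟨l', hl', htr'⟩ : ∃ l' : ℂ, 1 < ‖l'‖ ∧
      (((γ : Matrix (Fin 2) (Fin 2) ℝ).trace : ℝ) : ℂ) = l' + l'⁻¹ := by
    rcases eq_or_eq_neg_of_mk_eq hpg with h | h
    · exact ⟨l, hl, by rw [← htrγ, h, htr]⟩
    · refine ⟨-l, by rwa [norm_neg], ?_⟩
      rw [← htrγ, h, Matrix.trace_neg, htr, inv_neg, neg_add]
  obtain ⟨r, rfl⟩ := exists_ofReal_of_add_inv hl' htr'
  rw [Complex.norm_real] at hl'
  have htrR : (γ : Matrix (Fin 2) (Fin 2) ℝ).trace = r + r⁻¹ := by exact_mod_cast htr'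
  obtain ⟨h, h00, h01, h10⟩ := exists_conj_diagonal (norm_pos_iff.1 (zero_lt_one.trans hl'))
    (ne_inv_of_one_lt_norm hl') htrR
  have hA : IsGeodesicLine fun t => h⁻¹ • UpperHalfPlane.vertical t := fun s t => by
    rw [UpperHalfPlane.dist_SL_smul, UpperHalfPlane.isGeodesicLine_vertical]
  obtain ⟨c, hc, -⟩ := exists_isClosedGeodesic (ℓ := 2 * Real.log ‖r‖)
    (mul_pos two_pos (Real.log_pos hl')) hA hp fun t => by
      rw [← UpperHalfPlane.smul_vertical_of_diagonal h01 h10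
        (by rw [h00]; exact norm_eq_exp_two_mul_log hl'), mul_smul, mul_smul, inv_smul_smul]
  exact ⟨_, c, hc⟩

end ArithmeticOrbifolds

theorem lemma2p1 :
    -- arithmetic hyperbolic 2-orbifolds
    (∀ Γ : Subgroup PSL(2, ℝ), IsArithmeticFuchsian Γ →
      (∀ (ℓ : ℝ) (c : AddCircle ℓ → HypOrbifold UpperHalfPlane Γ), IsClosedGeodesic c →
        ∃ (Γ' : Subgroup PSL(2, ℝ)) (h : IsFiniteManifoldCover Γ' Γ), LiftsToCover h.le c) ∧
      ∃ s : ℝ, IsSystole UpperHalfPlane Γ s ∧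
        ∃ Γ' : Subgroup PSL(2, ℝ), IsFiniteManifoldCover Γ' Γ ∧
          IsSystole UpperHalfPlane Γ' s) ∧
    -- arithmetic hyperbolic 3-orbifolds
    (∀ Γ : Subgroup PSL(2, ℂ), IsArithmeticKleinian Γ →
      (∀ (ℓ : ℝ) (c : AddCircle ℓ → HypOrbifold UpperHalfSpace Γ), IsClosedGeodesic c →
        ∃ (Γ' : Subgroup PSL(2, ℂ)) (h : IsFiniteManifoldCover Γ' Γ), LiftsToCover h.le c) ∧
      ∃ s : ℝ, IsSystole UpperHalfSpace Γ s ∧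
        ∃ Γ' : Subgroup PSL(2, ℂ), IsFiniteManifoldCover Γ' Γ ∧
          IsSystole UpperHalfSpace Γ' s) := by
  exact ⟨fun Γ hΓ => ⟨hΓ.lifts, exists_isSystole_of_lifts hΓ.nonempty_lengths hΓ.finite_lengths hΓ.lifts⟩,
    fun Γ hΓ => ⟨hΓ.lifts, exists_isSystole_of_lifts hΓ.nonempty_lengths hΓ.finite_lengths hΓ.lifts⟩⟩
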